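/- Let $k$ be a field, let $H$ be a finite-dimensional semisimple weak Hopf algebra over $k$ with comultiplication $\Delta(h)=h_{(1)}\otimes h_{(2)}$ and counit $\epsilon$, let $\epsilon_t(h)=\epsilon(1_{(1)}h)1_{(2)}$, let $H^t=\epsilon_t(H)$ be the target algebra, and let $A$ be an associative unital $k$-algebra. Let $\operatorname{coRep}(H)$ be the monoidal category of finite-dimensional left $H$-comodules $x\mapsto x_{(-1)}\otimes x_{(0)}$. Each comodule is an $H^t$-bimodule via $z\cdot x=\epsilon(zx_{(-1)})x_{(0)}$ and $x\cdot z=\epsilon(x_{(-1)}z)x_{(0)}$; the tensor product is $X\otimes_{H^t}Y$ with coaction $x\otimes y\mapsto x_{(-1)}y_{(-1)}\otimes(x_{(0)}\otimes y_{(0)})$, and the unit object is $H^t$. The weak fiber functor $F_H:\operatorname{coRep}(H)\to\operatorname{Vec}$ is the forgetful functor, with lax monoidal structure given by the quotient maps $X\otimes_k Y\to X\otimes_{H^t}Y$ and the unit $k\to H^t$. A based action of $\operatorname{coRep}(H)$ on $A$ is a monoidal functor $(F,J):\operatorname{coRep}(H)\to\operatorname{Bim}(A)$ (where $k$ acts centrally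 on bimodules) with finite-dimensional subspaces $V_X\subseteq F(X)$ such that $1_A\in V_{\mathbf 1}$ (under $A\cong F(\mathbf 1)$), $F(f)(V_X)\subseteq V_Y$ for every $f:X\to Y$, and $J(V_X\otimes V_Y)\subseteq V_{X\otimes Y}$. It is over $F_H$ if the induced lax monoidal functor $X\mapsto V_X$ is monoidally naturally isomorphic to $F_H$. Two based actions $(F,V)$, $(G,U)$ on $A$ are equivalent if there is a monoidal natural isomorphism $\eta:F\to G$ with $\eta_X(V_X)=U_X$ for all $X$. A left $H$-module algebra structure on $A$ is a left $H$-module structure with $h\cdot(ab)=(h_{(1)}\cdot a)(h_{(2)}\cdot b)$ and $h\cdot 1_A=\epsilon_t(h)\cdot 1_A$. Consider only those structures for which $H^t\to A$, $z\mapsto z\cdot 1_A$, is injective. For such a structure let $A\otimes_{H^t}X$ be formed with the right action $a\cdot z=a(z\cdot 1_A)$ of $H^t$ on $A$. A $J$-twisted algebra isomorphism of $H$ is an algebra automorphism $\alpha$ of $H$ that is the component at the regular comodule $H$ of a monoidal natural automorphism of $F_H$. Two such structures $\triangleright_1,\triangleright_2$ agree up to $J$-twisted isomorphism if, for some $J$-twisted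 algebra isomorphism $\alpha$ and all $h\in H$, $a\in A$, $$(\alpha(h)_{(1)}\triangleright_2 a)\otimes\alpha(h)_{(2)}=(h_{(1)}\triangleright_1 a)\otimes\alpha(h_{(2)})\quad\text{in } A\otimes_{H^t}H,$$ the tensor product being formed with respect to $\triangleright_2$; that is, $\alpha$ carries the commutation relation $ha=(h_{(1)}\triangleright_1a)h_{(2)}$ to the corresponding one for $\triangleright_2$. Theorem. Agreement up to $J$-twisted isomorphism is an equivalence relation on the left $H$-module algebra structures on $A$ with $H^t\to A$ injective, and its classes are in bijection with the equivalence classes of based actions of $\operatorname{coRep}(H)$ on $A$ over $F_H$. The bijection is such that the class of a module algebra structure corresponds to the class of $(F,J,V)$ if and only if there is a monoidal natural isomorphism $\theta_X:X\to V_X$ from $F_H$ to the induced functor such that, for all $X$, the assignment $a\otimes x\mapsto a\,\theta_X(x)$ is a well-defined bijection $A\otimes_{H^t}X\to F(X)$ and $\theta_X(x)\,a=(x_{(-1)}\cdot a)\,\theta_X(x_{(0)})$ for all $x\in X$, $a\in A$. -/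

import Mathlib

universe u

noncomputable section

open CategoryTheory MonoidalCategory
open scoped TensorProduct

namespace WeakHopf

section Weak

variable (k : Type u) {H : Type u} [Field k] [Ring H] [Algebra k H] [Coalgebra k H]

/-- The target counital map `ε_t(h) = ε(1₍₁₎ h) 1₍₂₎`. -/
def targetMap : H →ₗ[k] H where
  toFun h := TensorProduct.lid k H
    ((Coalgebra.counit (R := k) (A := H)).rTensor H (Coalgebra.comul (R := k) (1 : H) * (h ⊗ₜ[k] 1)))
  map_add' x y := by simp [TensorProduct.add_tmul, mul_add]
  map_smul' c x := by simp [← TensorProduct.smul_tmul']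

/-- The source counital map `ε_s(h) = 1₍₁₎ ε(h 1₍₂₎)`. -/
def sourceMap : H →ₗ[k] H where
  toFun h := TensorProduct.rid k H
    ((Coalgebra.counit (R := k) (A := H)).lTensor H ((1 ⊗ₜ[k] h) * Coalgebra.comul (R := k) (1 : H)))
  map_add' x y := by simp [TensorProduct.tmul_add, add_mul]
  map_smul' c x := by simp

variable (H)

/-- The target algebra `H^t`, the image of `ε_t`. -/
def target : Submodule k H := LinearMap.range (targetMap k (H := H))

/-- The bilinear map `(f, h) ↦ ε(f g₍₁₎) ε(g₍₂₎ h)` evaluated at a tensor `t` in place of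
`g₍₁₎ ⊗ g₍₂₎`. -/
def counitPair (f h : H) : H ⊗[k] H →ₗ[k] k :=
  LinearMap.mul' k k ∘ₗ TensorProduct.map
    (Coalgebra.counit ∘ₗ LinearMap.mulLeft k f) (Coalgebra.counit ∘ₗ LinearMap.mulRight k h)

end Weak

/-- A weak Hopf algebra over a field `k`: an algebra and a coalgebra `H` with multiplicative
comultiplication, weakly comultiplicative unit, weakly multiplicative counit, and an antipode. -/
class WeakHopfAlgebra (k H : Type u) [Field k] [Ring H] [Algebra k H] [Coalgebra k H] where
  comul_mul : ∀ g h : H, Coalgebra.comul (R := k) (g * h)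
    = Coalgebra.comul (R := k) g * Coalgebra.comul (R := k) h
  comul_one_left : (Coalgebra.comul (R := k) (A := H)).rTensor H (Coalgebra.comul (1 : H))
    = (Coalgebra.comul (R := k) (1 : H) ⊗ₜ[k] (1 : H))
      * (TensorProduct.assoc k H H H).symm ((1 : H) ⊗ₜ[k] Coalgebra.comul (R := k) (1 : H))
  comul_one_right : (Coalgebra.comul (R := k) (A := H)).rTensor H (Coalgebra.comul (1 : H))
    = (TensorProduct.assoc k H H H).symm ((1 : H) ⊗ₜ[k] Coalgebra.comul (R := k) (1 : H))
      * (Coalgebra.comul (R := k) (1 : H) ⊗ₜ[k] (1 : H))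
  counit_mul_left : ∀ f g h : H, Coalgebra.counit (R := k) (f * g * h)
    = counitPair k H f h (Coalgebra.comul g)
  counit_mul_right : ∀ f g h : H, Coalgebra.counit (R := k) (f * g * h)
    = counitPair k H f h (TensorProduct.comm k H H (Coalgebra.comul g))
  antipode : H →ₗ[k] H
  mul_antipode_right : ∀ h : H,
    LinearMap.mul' k H (antipode.lTensor H (Coalgebra.comul h)) = targetMap k h
  mul_antipode_left : ∀ h : H,
    LinearMap.mul' k H (antipode.rTensor H (Coalgebra.comul h)) = sourceMap k h
  antipode_mul_antipode : ∀ h : H,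
    LinearMap.mul' k H (TensorProduct.map antipode
      (LinearMap.mul' k H ∘ₗ antipode.lTensor H ∘ₗ Coalgebra.comul) (Coalgebra.comul h))
      = antipode h

section Bal

variable {k : Type u} [Field k] {ι κ : Type u}
  {M N P M' N' : Type u} [AddCommGroup M] [Module k M] [AddCommGroup N] [Module k N]
  [AddCommGroup P] [Module k P]
  [AddCommGroup M'] [Module k M'] [AddCommGroup N'] [Module k N']

/-- The balancing relations `m · i ⊗ n - m ⊗ i · n`. -/
def balRel (r : ι → M →ₗ[k] M) (l : ι → N →ₗ[k] N) : Submodule k (M ⊗[k] N) :=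
  Submodule.span k {t | ∃ i m n, t = r i m ⊗ₜ[k] n - m ⊗ₜ[k] l i n}

/-- The relative tensor product of `M` and `N` over a set `ι` acting on the right of `M`
(through `r`) and on the left of `N` (through `l`). -/
def BalTensor (r : ι → M →ₗ[k] M) (l : ι → N →ₗ[k] N) : Type u :=
  (M ⊗[k] N) ⧸ balRel r l

instance (r : ι → M →ₗ[k] M) (l : ι → N →ₗ[k] N) : AddCommGroup (BalTensor r l) :=
  inferInstanceAs (AddCommGroup ((M ⊗[k] N) ⧸ balRel r l))

instance (r : ι → M →ₗ[k] M) (l : ι → N →ₗ[k] N) : Module k (BalTensor r l) :=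
  inferInstanceAs (Module k ((M ⊗[k] N) ⧸ balRel r l))

instance (r : ι → M →ₗ[k] M) (l : ι → N →ₗ[k] N) [FiniteDimensional k M] [FiniteDimensional k N] :
    FiniteDimensional k (BalTensor r l) :=
  inferInstanceAs (FiniteDimensional k ((M ⊗[k] N) ⧸ balRel r l))

namespace BalTensor

/-- The universal balanced map `(m, n) ↦ m ⊗ n`. -/
def mk (r : ι → M →ₗ[k] M) (l : ι → N →ₗ[k] N) : M →ₗ[k] N →ₗ[k] BalTensor r l :=
  (TensorProduct.mk k M N).compr₂ (balRel r l).mkQ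

variable {r : ι → M →ₗ[k] M} {l : ι → N →ₗ[k] N}

theorem mk_bal (i : ι) (m : M) (n : N) : mk r l (r i m) n = mk r l m (l i n) :=
  (Submodule.Quotient.eq _).2 (Submodule.subset_span ⟨i, m, n, rfl⟩)

/-- The linear map out of a relative tensor product induced by a balanced bilinear map. -/
def lift (B : M →ₗ[k] N →ₗ[k] P) (h : ∀ i m n, B (r i m) n = B m (l i n)) :
    BalTensor r l →ₗ[k] P :=
  (balRel r l).liftQ (TensorProduct.lift B) (by
    rw [balRel, Submodule.span_le]
    rintro _ ⟨i, m, n, rfl⟩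
    simp [h])

@[simp] theorem lift_mk (B : M →ₗ[k] N →ₗ[k] P) (h : ∀ i m n, B (r i m) n = B m (l i n))
    (m : M) (n : N) : lift B h (mk r l m n) = B m n :=
  TensorProduct.lift.tmul m n

theorem hom_ext {f g : BalTensor r l →ₗ[k] P} (h : ∀ m n, f (mk r l m n) = g (mk r l m n)) :
    f = g := by
  apply Submodule.linearMap_qext
  apply TensorProduct.ext'
  exact h

theorem ind {p : BalTensor r l → Prop} (x : BalTensor r l) (h0 : p 0)
    (hadd : ∀ x y, p x → p y → p (x + y)) (hmk : ∀ m n, p (mk r l m n)) : p x := by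
  obtain ⟨t, rfl⟩ := Submodule.mkQ_surjective _ x
  induction t with
  | zero => rw [map_zero]; exact h0
  | add a b ha hb => rw [map_add]; exact hadd _ _ ha hb
  | tmul m n => exact hmk m n

/-- Functoriality of the relative tensor product. -/
def map {r' : ι → M' →ₗ[k] M'} {l' : ι → N' →ₗ[k] N'} (f : M →ₗ[k] M') (g : N →ₗ[k] N')
    (hf : ∀ i m, f (r i m) = r' i (f m)) (hg : ∀ i n, g (l i n) = l' i (g n)) :
    BalTensor r l →ₗ[k] BalTensor r' l' :=
  lift ((mk r' l').compl₁₂ f g) (by intro i m n; simp [hf, hg, mk_bal])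

@[simp] theorem map_mk {r' : ι → M' →ₗ[k] M'} {l' : ι → N' →ₗ[k] N'} (f : M →ₗ[k] M')
    (g : N →ₗ[k] N') (hf : ∀ i m, f (r i m) = r' i (f m)) (hg : ∀ i n, g (l i n) = l' i (g n))
    (m : M) (n : N) : map f g hf hg (mk r l m n) = mk r' l' (f m) (g n) := by
  simp [map]

section assoc

variable {r₁ : ι → M →ₗ[k] M} {l₁ : ι → N →ₗ[k] N} {r₂ : κ → N →ₗ[k] N} {l₂ : κ → P →ₗ[k] P}
  {rMN : κ → BalTensor r₁ l₁ →ₗ[k] BalTensor r₁ l₁}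
  {lNP : ι → BalTensor r₂ l₂ →ₗ[k] BalTensor r₂ l₂}

variable (hr : ∀ j m n, rMN j (mk r₁ l₁ m n) = mk r₁ l₁ m (r₂ j n))
  (hl : ∀ i n p, lNP i (mk r₂ l₂ n p) = mk r₂ l₂ (l₁ i n) p)

/-- The map `(m ⊗ n) ⊗ p ↦ m ⊗ (n ⊗ p)`. -/
def assocHom : BalTensor rMN l₂ →ₗ[k] BalTensor r₁ lNP :=
  lift (lift (LinearMap.mk₂ k (fun m n => (mk r₁ lNP m) ∘ₗ (mk r₂ l₂ n))
      (by intros; ext; simp) (by intros; ext; simp) (by intros; ext; simp)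
      (by intros; ext; simp)) (by intro i m n; ext p; simp [mk_bal, ← hl]))
    (by
      intro j x p
      induction x using ind with
      | h0 => simp
      | hadd x y hx hy => simp only [map_add, LinearMap.add_apply, hx, hy]
      | hmk m n => simp [hr, mk_bal])

theorem assocHom_mk (m : M) (n : N) (p : P) :
    assocHom hr hl (mk rMN l₂ (mk r₁ l₁ m n) p) = mk r₁ lNP m (mk r₂ l₂ n p) := by
  simp [assocHom]

/-- The map `m ⊗ (n ⊗ p) ↦ (m ⊗ n) ⊗ p`. -/
def assocInv : BalTensor r₁ lNP →ₗ[k] BalTensor rMN l₂ :=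
  lift (LinearMap.flip (lift (LinearMap.mk₂ k
      (fun n p => ((mk rMN l₂).flip p) ∘ₗ ((mk r₁ l₁).flip n))
      (by intros; ext; simp) (by intros; ext; simp) (by intros; ext; simp)
      (by intros; ext; simp)) (by intro j n p; ext m; simp [← mk_bal, ← hr])))
    (by
      intro i m x
      induction x using ind with
      | h0 => simp
      | hadd x y hx hy => simp only [map_add, hx, hy]
      | hmk n p => simp [hl, mk_bal])

theorem assocInv_mk (m : M) (n : N) (p : P) :
    assocInv hr hl (mk r₁ lNP m (mk r₂ l₂ n p)) = mk rMN l₂ (mk r₁ l₁ m n) p := by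
  simp [assocInv]

/-- The associativity isomorphism of relative tensor products. -/
def assoc : BalTensor rMN l₂ ≃ₗ[k] BalTensor r₁ lNP :=
  LinearEquiv.ofLinearMap (assocHom hr hl) (assocInv hr hl)
    (by
      apply hom_ext
      intro m x
      induction x using ind with
      | h0 => simp
      | hadd x y hx hy => simp only [map_add, hx, hy]
      | hmk n p => simp [assocHom_mk, assocInv_mk])
    (by
      apply hom_ext
      intro x p
      induction x using ind with
      | h0 => simp
      | hadd x y hx hy => simp only [map_add, LinearMap.add_apply, hx, hy]
      | hmk n p => simp [assocHom_mk, assocInv_mk])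

@[simp] theorem assoc_mk (m : M) (n : N) (p : P) :
    assoc hr hl (mk rMN l₂ (mk r₁ l₁ m n) p) = mk r₁ lNP m (mk r₂ l₂ n p) :=
  assocHom_mk hr hl m n p

@[simp] theorem assoc_symm_mk (m : M) (n : N) (p : P) :
    (assoc hr hl).symm (mk r₁ lNP m (mk r₂ l₂ n p)) = mk rMN l₂ (mk r₁ l₁ m n) p :=
  assocInv_mk hr hl m n p

end assoc

end BalTensor

end Bal

section Bimodules

variable (k A : Type u) [Field k] [Ring A] [Algebra k A]

/-- An `A`-`A`-bimodule on which `k` acts centrally. `left a x` is `a · x`, `right a x` is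
`x · a`. -/
structure Bim where
  carrier : Type u
  [addCommGroup : AddCommGroup carrier]
  [module : Module k carrier]
  left : A →ₗ[k] carrier →ₗ[k] carrier
  right : A →ₗ[k] carrier →ₗ[k] carrier
  left_one : ∀ x, left 1 x = x
  left_mul : ∀ a b x, left (a * b) x = left a (left b x)
  right_one : ∀ x, right 1 x = x
  right_mul : ∀ a b x, right (a * b) x = right b (right a x)
  left_right : ∀ a b x, left a (right b x) = right b (left a x)

variable {k A}

namespace Bim

attribute [instance] Bim.addCommGroup Bim.module

instance : CoeSort (Bim k A) (Type u) := ⟨Bim.carrier⟩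

/-- Homomorphisms of bimodules. -/
@[ext] structure Hom (M N : Bim k A) where
  lin : M →ₗ[k] N
  map_left : ∀ a x, lin (M.left a x) = N.left a (lin x)
  map_right : ∀ a x, lin (M.right a x) = N.right a (lin x)

instance : Category (Bim k A) where
  Hom M N := Hom M N
  id M := ⟨LinearMap.id, fun _ _ => rfl, fun _ _ => rfl⟩
  comp f g := ⟨g.lin ∘ₗ f.lin, fun a x => by simp [f.map_left, g.map_left],
    fun a x => by simp [f.map_right, g.map_right]⟩

/-- The underlying linear map of a homomorphism of bimodules. -/
def lin {M N : Bim k A} (f : M ⟶ N) : M →ₗ[k] N := Hom.lin f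

theorem lin_left {M N : Bim k A} (f : M ⟶ N) (a : A) (x : M) :
    lin f (M.left a x) = N.left a (lin f x) := Hom.map_left f a x

theorem lin_right {M N : Bim k A} (f : M ⟶ N) (a : A) (x : M) :
    lin f (M.right a x) = N.right a (lin f x) := Hom.map_right f a x

theorem hom_ext {M N : Bim k A} {f g : M ⟶ N} (h : ∀ x, lin f x = lin g x) : f = g :=
  Hom.ext (LinearMap.ext h)

@[simp] theorem lin_id (M : Bim k A) (x : M) : lin (𝟙 M) x = x := rfl

@[simp] theorem lin_comp {M N P : Bim k A} (f : M ⟶ N) (g : N ⟶ P) (x : M) :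
    lin (f ≫ g) x = lin g (lin f x) := rfl

/-- A homomorphism of bimodules from a linear map. -/
def ofLin {M N : Bim k A} (f : M →ₗ[k] N) (hl : ∀ a x, f (M.left a x) = N.left a (f x))
    (hr : ∀ a x, f (M.right a x) = N.right a (f x)) : M ⟶ N := ⟨f, hl, hr⟩

@[simp] theorem lin_ofLin {M N : Bim k A} (f : M →ₗ[k] N)
    (hl : ∀ a x, f (M.left a x) = N.left a (f x))
    (hr : ∀ a x, f (M.right a x) = N.right a (f x)) (x : M) : lin (ofLin f hl hr) x = f x := rfl

/-- An isomorphism of bimodules from a linear equivalence. -/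
def isoOfLin {M N : Bim k A} (f : M ≃ₗ[k] N) (hl : ∀ a x, f (M.left a x) = N.left a (f x))
    (hr : ∀ a x, f (M.right a x) = N.right a (f x)) : M ≅ N where
  hom := ofLin f.toLinearMap hl hr
  inv := ofLin f.symm.toLinearMap (fun a x => f.injective (by simp [hl]))
    (fun a x => f.injective (by simp [hr]))
  hom_inv_id := hom_ext (by simp)
  inv_hom_id := hom_ext (by simp)

@[simp] theorem lin_isoOfLin_hom {M N : Bim k A} (f : M ≃ₗ[k] N)
    (hl : ∀ a x, f (M.left a x) = N.left a (f x))
    (hr : ∀ a x, f (M.right a x) = N.right a (f x)) (x : M) :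
    lin (isoOfLin f hl hr).hom x = f x := rfl

@[simp] theorem lin_isoOfLin_inv {M N : Bim k A} (f : M ≃ₗ[k] N)
    (hl : ∀ a x, f (M.left a x) = N.left a (f x))
    (hr : ∀ a x, f (M.right a x) = N.right a (f x)) (x : N) :
    lin (isoOfLin f hl hr).inv x = f.symm x := rfl

variable (k A) in
/-- The algebra `A` as a bimodule over itself. -/
def unit : Bim k A where
  carrier := A
  left := LinearMap.mul k A
  right := (LinearMap.mul k A).flip
  left_one := by simp
  left_mul := by simp [mul_assoc]
  right_one := by simp
  right_mul := by simp [mul_assoc]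
  left_right := by simp [mul_assoc]

/-- The left action on the relative tensor product over `A`. -/
def tensorLeft (M N : Bim k A) :
    A →ₗ[k] BalTensor M.right N.left →ₗ[k] BalTensor M.right N.left where
  toFun a := BalTensor.map (M.left a) LinearMap.id (by simp [M.left_right]) (by simp)
  map_add' a b := BalTensor.hom_ext (by simp)
  map_smul' c a := BalTensor.hom_ext (by simp)

/-- The right action on the relative tensor product over `A`. -/
def tensorRight (M N : Bim k A) :
    A →ₗ[k] BalTensor M.right N.left →ₗ[k] BalTensor M.right N.left where
  toFun a := BalTensor.map LinearMap.id (N.right a) (by simp) (by simp [N.left_right])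
  map_add' a b := BalTensor.hom_ext (by simp)
  map_smul' c a := BalTensor.hom_ext (by simp)

@[simp] theorem tensorLeft_mk (M N : Bim k A) (a : A) (m : M) (n : N) :
    tensorLeft M N a (BalTensor.mk _ _ m n) = BalTensor.mk _ _ (M.left a m) n := by
  simp [tensorLeft]

@[simp] theorem tensorRight_mk (M N : Bim k A) (a : A) (m : M) (n : N) :
    tensorRight M N a (BalTensor.mk _ _ m n) = BalTensor.mk _ _ m (N.right a n) := by
  simp [tensorRight]

/-- The relative tensor product `M ⊗_A N` of bimodules. -/
def tensor (M N : Bim k A) : Bim k A where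
  carrier := BalTensor M.right N.left
  left := tensorLeft M N
  right := tensorRight M N
  left_one := LinearMap.congr_fun (f := tensorLeft M N 1) (g := LinearMap.id)
    (BalTensor.hom_ext (by simp [M.left_one]))
  left_mul a b := LinearMap.congr_fun (f := tensorLeft M N (a * b))
    (g := tensorLeft M N a ∘ₗ tensorLeft M N b) (BalTensor.hom_ext (by simp [M.left_mul]))
  right_one := LinearMap.congr_fun (f := tensorRight M N 1) (g := LinearMap.id)
    (BalTensor.hom_ext (by simp [N.right_one]))
  right_mul a b := LinearMap.congr_fun (f := tensorRight M N (a * b))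
    (g := tensorRight M N b ∘ₗ tensorRight M N a) (BalTensor.hom_ext (by simp [N.right_mul]))
  left_right a b := LinearMap.congr_fun (f := tensorLeft M N a ∘ₗ tensorRight M N b)
    (g := tensorRight M N b ∘ₗ tensorLeft M N a) (BalTensor.hom_ext (by simp))

/-- The class of `m ⊗ n` in `M ⊗_A N`. -/
def tmul (M N : Bim k A) : M →ₗ[k] N →ₗ[k] tensor M N := BalTensor.mk M.right N.left

theorem tmul_bal (M N : Bim k A) (a : A) (m : M) (n : N) :
    tmul M N (M.right a m) n = tmul M N m (N.left a n) := BalTensor.mk_bal a m n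

@[simp] theorem tensor_left_tmul (M N : Bim k A) (a : A) (m : M) (n : N) :
    (tensor M N).left a (tmul M N m n) = tmul M N (M.left a m) n := tensorLeft_mk M N a m n

@[simp] theorem tensor_right_tmul (M N : Bim k A) (a : A) (m : M) (n : N) :
    (tensor M N).right a (tmul M N m n) = tmul M N m (N.right a n) := tensorRight_mk M N a m n

theorem tensor_lin_ext {M N : Bim k A} {P : Type u} [AddCommGroup P] [Module k P]
    {f g : tensor M N →ₗ[k] P} (h : ∀ m n, f (tmul M N m n) = g (tmul M N m n)) : f = g :=
  BalTensor.hom_ext h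

theorem tensor_hom_ext {M N P : Bim k A} {f g : tensor M N ⟶ P}
    (h : ∀ m n, lin f (tmul M N m n) = lin g (tmul M N m n)) : f = g :=
  hom_ext (LinearMap.congr_fun (tensor_lin_ext h))

theorem tensor_lin_ext₃ {M N P : Bim k A} {Q : Type u} [AddCommGroup Q] [Module k Q]
    {f g : tensor (tensor M N) P →ₗ[k] Q}
    (h : ∀ m n p, f (tmul _ _ (tmul M N m n) p) = g (tmul _ _ (tmul M N m n) p)) : f = g := by
  apply tensor_lin_ext
  intro x p
  exact LinearMap.congr_fun (f := f ∘ₗ (tmul (tensor M N) P).flip p)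
    (g := g ∘ₗ (tmul (tensor M N) P).flip p) (tensor_lin_ext fun m n => h m n p) x

theorem tensor_hom_ext₃ {M N P Q : Bim k A} {f g : tensor (tensor M N) P ⟶ Q}
    (h : ∀ m n p, lin f (tmul _ _ (tmul M N m n) p) = lin g (tmul _ _ (tmul M N m n) p)) :
    f = g :=
  hom_ext (LinearMap.congr_fun (tensor_lin_ext₃ h))

theorem tensor_hom_ext₄ {M N P Q R : Bim k A} {f g : tensor (tensor (tensor M N) P) Q ⟶ R}
    (h : ∀ m n p q, lin f (tmul _ _ (tmul _ _ (tmul M N m n) p) q)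
      = lin g (tmul _ _ (tmul _ _ (tmul M N m n) p) q)) : f = g := by
  apply tensor_hom_ext
  intro x q
  exact LinearMap.congr_fun (f := lin f ∘ₗ (tmul _ Q).flip q) (g := lin g ∘ₗ (tmul _ Q).flip q)
    (tensor_lin_ext₃ fun m n p => h m n p q) x

/-- A homomorphism out of `M ⊗_A N` from a linear map compatible with the actions on
elements `m ⊗ n`. -/
def homOfTensor {M N P : Bim k A} (f : tensor M N →ₗ[k] P)
    (hl : ∀ a m n, f (tmul M N (M.left a m) n) = P.left a (f (tmul M N m n)))
    (hr : ∀ a m n, f (tmul M N m (N.right a n)) = P.right a (f (tmul M N m n))) :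
    tensor M N ⟶ P :=
  ofLin f
    (fun a => LinearMap.congr_fun (f := f ∘ₗ (tensor M N).left a) (g := P.left a ∘ₗ f)
      (tensor_lin_ext (by simp [hl])))
    (fun a => LinearMap.congr_fun (f := f ∘ₗ (tensor M N).right a) (g := P.right a ∘ₗ f)
      (tensor_lin_ext (by simp [hr])))

/-- The tensor product of two homomorphisms of bimodules. -/
def tensorMap {M N M' N' : Bim k A} (f : M ⟶ M') (g : N ⟶ N') : tensor M N ⟶ tensor M' N' :=
  homOfTensor (BalTensor.map (lin f) (lin g) (lin_right f) (lin_left g))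
    (fun a m n => by
      change BalTensor.map _ _ _ _ (BalTensor.mk _ _ _ _)
        = tensorLeft _ _ _ (BalTensor.map _ _ _ _ (BalTensor.mk _ _ _ _))
      simp [lin_left])
    (fun a m n => by
      change BalTensor.map _ _ _ _ (BalTensor.mk _ _ _ _)
        = tensorRight _ _ _ (BalTensor.map _ _ _ _ (BalTensor.mk _ _ _ _))
      simp [lin_right])

@[simp] theorem lin_tensorMap {M N M' N' : Bim k A} (f : M ⟶ M') (g : N ⟶ N') (m : M) (n : N) :
    lin (tensorMap f g) (tmul M N m n) = tmul M' N' (lin f m) (lin g n) :=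
  BalTensor.map_mk (lin f) (lin g) (lin_right f) (lin_left g) m n

/-- The linear equivalence `(M ⊗_A N) ⊗_A P ≃ M ⊗_A (N ⊗_A P)`. -/
def assocEquiv (M N P : Bim k A) : tensor (tensor M N) P ≃ₗ[k] tensor M (tensor N P) :=
  BalTensor.assoc (tensorRight_mk M N) (tensorLeft_mk N P)

theorem assocEquiv_tmul (M N P : Bim k A) (m : M) (n : N) (p : P) :
    assocEquiv M N P (tmul (tensor M N) P (tmul M N m n) p)
      = tmul M (tensor N P) m (tmul N P n p) :=
  BalTensor.assoc_mk (tensorRight_mk M N) (tensorLeft_mk N P) m n p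

/-- The associativity isomorphism of bimodules. -/
def associator (M N P : Bim k A) : tensor (tensor M N) P ≅ tensor M (tensor N P) :=
  isoOfLin (assocEquiv M N P)
    (fun a => LinearMap.congr_fun
      (f := (assocEquiv M N P).toLinearMap ∘ₗ (tensor (tensor M N) P).left a)
      (g := (tensor M (tensor N P)).left a ∘ₗ (assocEquiv M N P).toLinearMap)
      (tensor_lin_ext₃ fun m n p => by simp [assocEquiv_tmul]))
    (fun a => LinearMap.congr_fun
      (f := (assocEquiv M N P).toLinearMap ∘ₗ (tensor (tensor M N) P).right a)
      (g := (tensor M (tensor N P)).right a ∘ₗ (assocEquiv M N P).toLinearMap)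
      (tensor_lin_ext₃ fun m n p => by simp [assocEquiv_tmul]))

@[simp] theorem lin_associator (M N P : Bim k A) (m : M) (n : N) (p : P) :
    lin (associator M N P).hom (tmul (tensor M N) P (tmul M N m n) p)
      = tmul M (tensor N P) m (tmul N P n p) :=
  assocEquiv_tmul M N P m n p

/-- The isomorphism `A ⊗_A M ≅ M`, `a ⊗ m ↦ a · m`. -/
def leftUnitor (M : Bim k A) : tensor (unit k A) M ≅ M where
  hom := homOfTensor (BalTensor.lift M.left (fun a b m => M.left_mul b a m))
    (fun a b m => M.left_mul a b m) (fun a b m => M.left_right b a m)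
  inv := ofLin (tmul (unit k A) M (1 : A))
    (fun a x => (tmul_bal (unit k A) M a (1 : A) x).symm.trans
      ((congrArg (fun b => tmul (unit k A) M b x) ((one_mul a).trans (mul_one a).symm)).trans
        (tensor_left_tmul (unit k A) M a (1 : A) x).symm))
    (fun a x => (tensor_right_tmul (unit k A) M a (1 : A) x).symm)
  hom_inv_id := tensor_hom_ext fun a m =>
    (tmul_bal (unit k A) M a (1 : A) m).symm.trans
      (congrArg (fun b => tmul (unit k A) M b m) (one_mul (M := A) a))
  inv_hom_id := hom_ext fun m => M.left_one m

@[simp] theorem lin_leftUnitor (M : Bim k A) (a : A) (m : M) :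
    lin (leftUnitor M).hom (tmul (unit k A) M a m) = M.left a m := rfl

/-- The isomorphism `M ⊗_A A ≅ M`, `m ⊗ a ↦ m · a`. -/
def rightUnitor (M : Bim k A) : tensor M (unit k A) ≅ M where
  hom := homOfTensor (BalTensor.lift M.right.flip (fun a m b => (M.right_mul a b m).symm))
    (fun a m b => (M.left_right a b m).symm) (fun a m b => M.right_mul b a m)
  inv := ofLin ((tmul M (unit k A)).flip (1 : A))
    (fun a x => (tensor_left_tmul M (unit k A) a x (1 : A)).symm)
    (fun a x => (tmul_bal M (unit k A) a x (1 : A)).trans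
      ((congrArg (fun b => tmul M (unit k A) x b) ((mul_one a).trans (one_mul a).symm)).trans
        (tensor_right_tmul M (unit k A) a x (1 : A)).symm))
  hom_inv_id := tensor_hom_ext fun m a =>
    (tmul_bal M (unit k A) a m (1 : A)).trans
      (congrArg (fun b => tmul M (unit k A) m b) (mul_one (M := A) a))
  inv_hom_id := hom_ext fun m => M.right_one m

@[simp] theorem lin_rightUnitor (M : Bim k A) (m : M) (a : A) :
    lin (rightUnitor M).hom (tmul M (unit k A) m a) = M.right a m := rfl

instance : MonoidalCategoryStruct (Bim k A) where
  tensorObj := tensor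
  whiskerLeft M _ _ f := tensorMap (𝟙 M) f
  whiskerRight f N := tensorMap f (𝟙 N)
  tensorHom := tensorMap
  tensorUnit := unit k A
  associator := associator
  leftUnitor := leftUnitor
  rightUnitor := rightUnitor

instance : MonoidalCategory (Bim k A) :=
  MonoidalCategory.ofTensorHom
    (id_tensorHom_id := fun M N => tensor_hom_ext fun m n => lin_tensorMap (𝟙 M) (𝟙 N) m n)
    (tensorHom_comp_tensorHom := fun f₁ f₂ g₁ g₂ => tensor_hom_ext fun m n => by
      change lin (tensorMap g₁ g₂) (lin (tensorMap f₁ f₂) (tmul _ _ m n))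
        = lin (tensorMap (f₁ ≫ g₁) (f₂ ≫ g₂)) (tmul _ _ m n)
      simp)
    (id_tensorHom := fun _ _ _ _ => rfl)
    (tensorHom_id := fun _ _ => rfl)
    (associator_naturality := fun {X₁ X₂ X₃ Y₁ Y₂ Y₃} f₁ f₂ f₃ => tensor_hom_ext₃ fun m n p => by
      change lin (associator Y₁ Y₂ Y₃).hom
          (lin (tensorMap (tensorMap f₁ f₂) f₃) (tmul _ _ (tmul X₁ X₂ m n) p))
        = lin (tensorMap f₁ (tensorMap f₂ f₃))
          (lin (associator X₁ X₂ X₃).hom (tmul _ _ (tmul X₁ X₂ m n) p))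
      simp)
    (leftUnitor_naturality := fun {M N} f => tensor_hom_ext fun a m =>
      (lin_left f a m).symm)
    (rightUnitor_naturality := fun {M N} f => tensor_hom_ext fun m a =>
      (lin_right f a m).symm)
    (pentagon := fun W X Y Z => tensor_hom_ext₄ fun w x y z => by
      change lin (tensorMap (𝟙 W) (associator X Y Z).hom)
        (lin (associator W (tensor X Y) Z).hom (lin (tensorMap (associator W X Y).hom (𝟙 Z))
          (tmul _ _ (tmul _ _ (tmul W X w x) y) z)))
        = lin (associator W X (tensor Y Z)).hom (lin (associator (tensor W X) Y Z).hom
          (tmul _ _ (tmul _ _ (tmul W X w x) y) z))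
      simp)
    (triangle := fun M N => tensor_hom_ext₃ fun m a n => by
      change lin (tensorMap (𝟙 M) (leftUnitor N).hom) (lin (associator M (unit k A) N).hom
          (tmul _ _ (tmul M (unit k A) m a) n))
        = lin (tensorMap (rightUnitor M).hom (𝟙 N)) (tmul _ _ (tmul M (unit k A) m a) n)
      simp only [lin_associator, lin_tensorMap]
      exact (tmul_bal M N a m n).symm)

end Bim

end Bimodules

set_option linter.unusedSectionVars false

section Sweedler

variable {k H : Type u} [Field k] [Ring H] [Algebra k H] [Coalgebra k H]

/-- The slice `lid ∘ (φ ⊗ id)`. -/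
def slice {X : Type u} [AddCommGroup X] [Module k X] (φ : H →ₗ[k] k) : H ⊗[k] X →ₗ[k] X :=
  (TensorProduct.lid k X).toLinearMap ∘ₗ φ.rTensor X

@[simp] theorem slice_tmul {X : Type u} [AddCommGroup X] [Module k X] (φ : H →ₗ[k] k) (h : H)
    (x : X) : slice φ (h ⊗ₜ[k] x) = φ h • x := by simp [slice]

theorem targetMap_eq_slice (h : H) : targetMap k h
    = slice (Coalgebra.counit ∘ₗ (LinearMap.mul k H).flip h) (Coalgebra.comul (R := k) (1 : H)) := by
  change TensorProduct.lid k H _ = _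
  generalize Coalgebra.comul (R := k) (1 : H) = t
  induction t with
  | zero => simp
  | add a b ha hb => simp only [add_mul, map_add, ha, hb]
  | tmul a b => simp

theorem targetMap_mem (h : H) : targetMap k h ∈ target k H := ⟨h, rfl⟩

theorem slice_assoc_aux (φ : H →ₗ[k] k) (p q : H ⊗[k] H) :
    slice φ (TensorProduct.assoc k H H H
      ((p ⊗ₜ[k] (1 : H)) * (TensorProduct.assoc k H H H).symm ((1 : H) ⊗ₜ[k] q)))
      = (slice φ p ⊗ₜ[k] (1 : H)) * q := by
  induction p with
  | zero => simp
  | add a b ha hb => simp only [TensorProduct.add_tmul, add_mul, map_add, ha, hb]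
  | tmul a b =>
    induction q with
    | zero => simp
    | add c d hc hd => simp only [TensorProduct.tmul_add, mul_add, map_add, hc, hd]
    | tmul c d => simp [TensorProduct.smul_tmul']

theorem slice_assoc_aux' (φ : H →ₗ[k] k) (p q : H ⊗[k] H) :
    slice φ (TensorProduct.assoc k H H H
      ((TensorProduct.assoc k H H H).symm ((1 : H) ⊗ₜ[k] q) * (p ⊗ₜ[k] (1 : H))))
      = q * (slice φ p ⊗ₜ[k] (1 : H)) := by
  induction p with
  | zero => simp
  | add a b ha hb => simp only [TensorProduct.add_tmul, mul_add, map_add, ha, hb]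
  | tmul a b =>
    induction q with
    | zero => simp
    | add c d hc hd => simp only [TensorProduct.tmul_add, add_mul, map_add, hc, hd]
    | tmul c d => simp [← TensorProduct.smul_tmul']

theorem comul_slice (φ : H →ₗ[k] k) (t : H ⊗[k] H) :
    Coalgebra.comul (R := k) (slice φ t) = slice φ ((Coalgebra.comul (R := k)).lTensor H t) := by
  induction t with
  | zero => simp
  | add a b ha hb => simp only [map_add, ha, hb]
  | tmul a b => simp

variable [WeakHopfAlgebra k H]

theorem comul_target {z : H} (hz : z ∈ target k H) :
    Coalgebra.comul (R := k) z = (z ⊗ₜ[k] (1 : H)) * Coalgebra.comul (R := k) (1 : H) := by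
  obtain ⟨h, rfl⟩ := hz
  rw [targetMap_eq_slice, comul_slice, ← Coalgebra.coassoc_apply,
    WeakHopfAlgebra.comul_one_left, slice_assoc_aux]

theorem comul_target' {z : H} (hz : z ∈ target k H) :
    Coalgebra.comul (R := k) z = Coalgebra.comul (R := k) (1 : H) * (z ⊗ₜ[k] (1 : H)) := by
  obtain ⟨h, rfl⟩ := hz
  rw [targetMap_eq_slice, comul_slice, ← Coalgebra.coassoc_apply,
    WeakHopfAlgebra.comul_one_right, slice_assoc_aux']

theorem comul_one_mul (h : H) : Coalgebra.comul (R := k) (1 : H) * Coalgebra.comul (R := k) h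
    = Coalgebra.comul (R := k) h := by
  rw [← WeakHopfAlgebra.comul_mul, one_mul]

theorem comul_mul_one (h : H) : Coalgebra.comul (R := k) h * Coalgebra.comul (R := k) (1 : H)
    = Coalgebra.comul (R := k) h := by
  rw [← WeakHopfAlgebra.comul_mul, mul_one]

theorem comul_target_mul {z : H} (hz : z ∈ target k H) (h : H) :
    Coalgebra.comul (R := k) (z * h) = (z ⊗ₜ[k] (1 : H)) * Coalgebra.comul (R := k) h := by
  rw [WeakHopfAlgebra.comul_mul, comul_target hz, mul_assoc, comul_one_mul]

theorem comul_mul_target {z : H} (hz : z ∈ target k H) (h : H) :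
    Coalgebra.comul (R := k) (h * z) = Coalgebra.comul (R := k) h * (z ⊗ₜ[k] (1 : H)) := by
  rw [WeakHopfAlgebra.comul_mul, comul_target' hz, ← mul_assoc, comul_mul_one]

theorem slice_counit_comul (h : H) :
    slice Coalgebra.counit (Coalgebra.comul (R := k) h) = h := by
  simp [slice]

theorem slice_mul_left {X : Type u} [AddCommGroup X] [Module k X] (z : H) (t : H ⊗[k] X) :
    slice (Coalgebra.counit ∘ₗ LinearMap.mul k H z) t
      = slice Coalgebra.counit ((LinearMap.mul k H z).rTensor X t) := by
  simp [slice, LinearMap.rTensor_comp]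

theorem slice_mul_right {X : Type u} [AddCommGroup X] [Module k X] (z : H) (t : H ⊗[k] X) :
    slice (Coalgebra.counit ∘ₗ (LinearMap.mul k H).flip z) t
      = slice Coalgebra.counit (((LinearMap.mul k H).flip z).rTensor X t) := by
  simp [slice, LinearMap.rTensor_comp]

theorem rTensor_mul_left (z : H) (t : H ⊗[k] H) :
    (LinearMap.mul k H z).rTensor H t = (z ⊗ₜ[k] (1 : H)) * t := by
  induction t with
  | zero => simp
  | add a b ha hb => simp only [map_add, mul_add, ha, hb]
  | tmul a b => simp

theorem rTensor_mul_right (z : H) (t : H ⊗[k] H) :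
    ((LinearMap.mul k H).flip z).rTensor H t = t * (z ⊗ₜ[k] (1 : H)) := by
  induction t with
  | zero => simp
  | add a b ha hb => simp only [map_add, add_mul, ha, hb]
  | tmul a b => simp

theorem slice_left_comul {z : H} (hz : z ∈ target k H) (h : H) :
    slice (Coalgebra.counit ∘ₗ LinearMap.mul k H z) (Coalgebra.comul (R := k) h) = z * h := by
  rw [slice_mul_left, rTensor_mul_left, ← comul_target_mul hz, slice_counit_comul]

theorem slice_right_comul {z : H} (hz : z ∈ target k H) (h : H) :
    slice (Coalgebra.counit ∘ₗ (LinearMap.mul k H).flip z) (Coalgebra.comul (R := k) h)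
      = h * z := by
  rw [slice_mul_right, rTensor_mul_right, ← comul_mul_target hz, slice_counit_comul]

theorem counit_mul_target (g h : H) :
    Coalgebra.counit (R := k) (g * targetMap k h) = Coalgebra.counit (R := k) (g * h) := by
  have := WeakHopfAlgebra.counit_mul_right (k := k) g 1 h
  rw [mul_one] at this
  rw [this, targetMap_eq_slice]
  generalize Coalgebra.comul (R := k) (1 : H) = t
  induction t with
  | zero => simp
  | add a b ha hb => simp only [map_add, mul_add, ha, hb]
  | tmul a b => simp [counitPair, mul_comm]

theorem targetMap_mul_aux (t : H ⊗[k] H) :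
    LinearMap.mul' k H ((targetMap k).rTensor H t)
      = slice Coalgebra.counit (Coalgebra.comul (R := k) (1 : H) * t) := by
  induction t with
  | zero => simp
  | add a b ha hb => simp only [map_add, mul_add, ha, hb]
  | tmul x y =>
    rw [LinearMap.rTensor_tmul, LinearMap.mul'_apply, targetMap_eq_slice]
    generalize Coalgebra.comul (R := k) (1 : H) = t
    induction t with
    | zero => simp
    | add a b ha hb => simp only [map_add, add_mul, ha, hb]
    | tmul a b => simp

/-- The identity `ε_t(h₍₁₎) h₍₂₎ = h`. -/
theorem targetMap_mul_comul (h : H) :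
    LinearMap.mul' k H ((targetMap k).rTensor H (Coalgebra.comul (R := k) h)) = h := by
  rw [targetMap_mul_aux, comul_one_mul, slice_counit_comul]

theorem targetMap_one : targetMap k (1 : H) = 1 := by
  have h2 := targetMap_eq_slice (k := k) (1 : H)
  rw [h2, slice_mul_right, rTensor_mul_right, ← Algebra.TensorProduct.one_def, mul_one,
    slice_counit_comul]

theorem one_mem_target : (1 : H) ∈ target k H := ⟨1, targetMap_one⟩

theorem lTensor_targetMap_aux (p q : H ⊗[k] H) :
    ((TensorProduct.rid k H).toLinearMap ∘ₗ (Coalgebra.counit (R := k)).lTensor H).rTensor H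
      ((TensorProduct.assoc k H H H).symm ((1 : H) ⊗ₜ[k] q) * (p ⊗ₜ[k] (1 : H)))
      = TensorProduct.lift (LinearMap.mk₂ k
          (fun a b => a ⊗ₜ[k] slice (Coalgebra.counit ∘ₗ (LinearMap.mul k H).flip b) q)
          (by intros; simp [TensorProduct.add_tmul]) (by intros; simp [TensorProduct.smul_tmul'])
          (by intros; simp [slice, LinearMap.comp_add, LinearMap.rTensor_add,
            TensorProduct.tmul_add])
          (by intros; simp [slice, LinearMap.comp_smul, LinearMap.rTensor_smul])) p := by
  induction p with
  | zero => simp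
  | add a b ha hb => simp only [TensorProduct.add_tmul, mul_add, map_add, ha, hb]
  | tmul a b =>
    induction q with
    | zero => simp
    | add c d hc hd =>
      simp only [TensorProduct.tmul_add, add_mul, map_add, hc, hd]
      simp only [TensorProduct.lift.tmul, LinearMap.mk₂_apply]
      rfl
    | tmul c d => simp [TensorProduct.smul_tmul]

theorem lTensor_targetMap_comul_one :
    (targetMap k).lTensor H (Coalgebra.comul (R := k) (1 : H)) = Coalgebra.comul (R := k) 1 := by
  have h := lTensor_targetMap_aux (k := k) (Coalgebra.comul (R := k) (1 : H))
    (Coalgebra.comul (R := k) (1 : H))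
  rw [← WeakHopfAlgebra.comul_one_right, ← LinearMap.rTensor_comp_apply, LinearMap.comp_assoc,
    Coalgebra.lTensor_counit_comp_comul] at h
  have e : (TensorProduct.rid k H).toLinearMap ∘ₗ (TensorProduct.mk k H k).flip 1
      = LinearMap.id := by ext; simp
  rw [e, LinearMap.rTensor_id, LinearMap.id_apply] at h
  conv_rhs => rw [h]
  rw [LinearMap.lTensor, TensorProduct.map]
  congr 1
  congr 1
  ext a b
  simp [← targetMap_eq_slice]

theorem lTensor_targetMap_comul {z : H} (hz : z ∈ target k H) :
    (targetMap k).lTensor H (Coalgebra.comul (R := k) z) = Coalgebra.comul (R := k) z := by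
  rw [comul_target hz, ← rTensor_mul_left, ← LinearMap.comp_apply, LinearMap.lTensor_comp_rTensor,
    ← LinearMap.rTensor_comp_lTensor, LinearMap.comp_apply, lTensor_targetMap_comul_one]

end Sweedler

/-! Left comodules. -/

section Comodules

variable (k H : Type u) [Field k] [Ring H] [Algebra k H] [Coalgebra k H]

/-- A finite-dimensional left `H`-comodule. -/
structure CoRep where
  carrier : Type u
  [addCommGroup : AddCommGroup carrier]
  [module : Module k carrier]
  [finite : FiniteDimensional k carrier]
  coact : carrier →ₗ[k] H ⊗[k] carrier
  coassoc : ∀ x, TensorProduct.assoc k H H carrier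
    ((Coalgebra.comul (R := k) (A := H)).rTensor carrier (coact x)) = coact.lTensor H (coact x)
  counit_coact : ∀ x, (Coalgebra.counit (R := k) (A := H)).rTensor carrier (coact x) = 1 ⊗ₜ[k] x

variable {k H}

namespace CoRep

attribute [instance] CoRep.addCommGroup CoRep.module CoRep.finite

instance : CoeSort (CoRep k H) (Type u) := ⟨CoRep.carrier⟩

/-- Homomorphisms of comodules. -/
@[ext] structure Hom (X Y : CoRep k H) where
  lin : X →ₗ[k] Y
  coact_lin : ∀ x, Y.coact (lin x) = lin.lTensor H (X.coact x)

instance : Category (CoRep k H) where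
  Hom X Y := Hom X Y
  id X := ⟨LinearMap.id, fun x => by simp⟩
  comp f g := ⟨g.lin ∘ₗ f.lin, fun x => by
    simp [f.coact_lin, g.coact_lin, LinearMap.lTensor_comp]⟩

/-- The underlying linear map of a homomorphism of comodules. -/
def lin {X Y : CoRep k H} (f : X ⟶ Y) : X →ₗ[k] Y := Hom.lin f

theorem coact_lin {X Y : CoRep k H} (f : X ⟶ Y) (x : X) :
    Y.coact (lin f x) = (lin f).lTensor H (X.coact x) := Hom.coact_lin f x

theorem hom_ext {X Y : CoRep k H} {f g : X ⟶ Y} (h : ∀ x, lin f x = lin g x) : f = g :=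
  Hom.ext (LinearMap.ext h)

@[simp] theorem lin_id (X : CoRep k H) (x : X) : lin (𝟙 X) x = x := rfl

@[simp] theorem lin_comp {X Y Z : CoRep k H} (f : X ⟶ Y) (g : Y ⟶ Z) (x : X) :
    lin (f ≫ g) x = lin g (lin f x) := rfl

/-- A homomorphism of comodules from a linear map. -/
def ofLin {X Y : CoRep k H} (f : X →ₗ[k] Y)
    (h : ∀ x, Y.coact (f x) = f.lTensor H (X.coact x)) : X ⟶ Y := ⟨f, h⟩

@[simp] theorem lin_ofLin {X Y : CoRep k H} (f : X →ₗ[k] Y)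
    (h : ∀ x, Y.coact (f x) = f.lTensor H (X.coact x)) (x : X) : lin (ofLin f h) x = f x := rfl

/-- An isomorphism of comodules from a linear equivalence. -/
def isoOfLin {X Y : CoRep k H} (f : X ≃ₗ[k] Y)
    (h : ∀ x, Y.coact (f x) = f.toLinearMap.lTensor H (X.coact x)) : X ≅ Y where
  hom := ofLin f.toLinearMap h
  inv := ofLin f.symm.toLinearMap (fun y => by
    obtain ⟨x, rfl⟩ := f.surjective y
    rw [h, ← LinearMap.lTensor_comp_apply]
    simp)
  hom_inv_id := hom_ext (by simp)
  inv_hom_id := hom_ext (by simp)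

/-- The regular comodule `H`. -/
def regular (k H : Type u) [Field k] [Ring H] [Algebra k H] [Coalgebra k H]
    [FiniteDimensional k H] : CoRep k H where
  carrier := H
  coact := Coalgebra.comul
  coassoc := Coalgebra.coassoc_apply
  counit_coact := Coalgebra.rTensor_counit_comul

/-- The operators `z · x = ε(z x₍₋₁₎) x₍₀₎`; for `z` in the target algebra these form the left
`H^t`-module structure of a comodule. -/
def left (X : CoRep k H) : H →ₗ[k] X →ₗ[k] X where
  toFun z := slice (Coalgebra.counit ∘ₗ LinearMap.mul k H z) ∘ₗ X.coact
  map_add' z w := by ext x; simp [slice, LinearMap.comp_add, LinearMap.rTensor_add]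
  map_smul' c z := by ext x; simp [slice, LinearMap.comp_smul, LinearMap.rTensor_smul]

/-- The operators `x · z = ε(x₍₋₁₎ z) x₍₀₎`; for `z` in the target algebra these form the right
`H^t`-module structure of a comodule. -/
def right (X : CoRep k H) : H →ₗ[k] X →ₗ[k] X where
  toFun z := slice (Coalgebra.counit ∘ₗ (LinearMap.mul k H).flip z) ∘ₗ X.coact
  map_add' z w := by ext x; simp [slice, LinearMap.comp_add, LinearMap.rTensor_add]
  map_smul' c z := by ext x; simp [slice, LinearMap.comp_smul, LinearMap.rTensor_smul]

theorem left_apply (X : CoRep k H) (z : H) (x : X) :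
    X.left z x = slice (Coalgebra.counit ∘ₗ LinearMap.mul k H z) (X.coact x) := rfl

theorem right_apply (X : CoRep k H) (z : H) (x : X) :
    X.right z x = slice (Coalgebra.counit ∘ₗ (LinearMap.mul k H).flip z) (X.coact x) := rfl

theorem slice_lTensor {X Y : Type u} [AddCommGroup X] [Module k X] [AddCommGroup Y] [Module k Y]
    (φ : H →ₗ[k] k) (f : X →ₗ[k] Y) (t : H ⊗[k] X) :
    slice φ (f.lTensor H t) = f (slice φ t) := by
  induction t with
  | zero => simp
  | add a b ha hb => simp only [map_add, ha, hb]
  | tmul a b => simp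

theorem lin_left {X Y : CoRep k H} (f : X ⟶ Y) (z : H) (x : X) :
    lin f (X.left z x) = Y.left z (lin f x) := by
  rw [left_apply, left_apply, coact_lin, slice_lTensor]

theorem lin_right {X Y : CoRep k H} (f : X ⟶ Y) (z : H) (x : X) :
    lin f (X.right z x) = Y.right z (lin f x) := by
  rw [right_apply, right_apply, coact_lin, slice_lTensor]

theorem slice_counit_coact (X : CoRep k H) (x : X) : slice Coalgebra.counit (X.coact x) = x := by
  simp [slice, X.counit_coact]

theorem slice_assoc_rTensor {X : Type u} [AddCommGroup X] [Module k X] (φ : H →ₗ[k] k)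
    (g : H →ₗ[k] H ⊗[k] H) (t : H ⊗[k] X) :
    slice φ (TensorProduct.assoc k H H X (g.rTensor X t)) = (slice φ ∘ₗ g).rTensor X t := by
  induction t with
  | zero => simp
  | add a b ha hb => simp only [map_add, ha, hb]
  | tmul a x =>
    simp only [LinearMap.rTensor_tmul, LinearMap.comp_apply]
    generalize g a = s
    induction s with
    | zero => simp
    | add a b ha hb => simp only [map_add, TensorProduct.add_tmul, ha, hb]
    | tmul a b => simp [TensorProduct.smul_tmul']

theorem coact_slice (X : CoRep k H) (φ : H →ₗ[k] k) (x : X) :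
    X.coact (slice φ (X.coact x)) = (slice φ ∘ₗ Coalgebra.comul).rTensor X (X.coact x) := by
  rw [← slice_lTensor, ← X.coassoc, slice_assoc_rTensor]

section

variable [WeakHopfAlgebra k H]

theorem left_one (X : CoRep k H) (x : X) : X.left 1 x = x := by
  rw [left_apply, slice_mul_left]
  have : LinearMap.mul k H 1 = LinearMap.id := by ext; simp
  rw [this, LinearMap.rTensor_id, LinearMap.id_apply, slice_counit_coact]

theorem right_one (X : CoRep k H) (x : X) : X.right 1 x = x := by
  rw [right_apply, slice_mul_right]
  have : (LinearMap.mul k H).flip 1 = LinearMap.id := by ext; simp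
  rw [this, LinearMap.rTensor_id, LinearMap.id_apply, slice_counit_coact]

theorem coact_left (X : CoRep k H) {z : H} (hz : z ∈ target k H) (x : X) :
    X.coact (X.left z x) = (LinearMap.mul k H z).rTensor X (X.coact x) := by
  rw [left_apply, coact_slice]
  congr 2
  ext h
  exact slice_left_comul hz h

theorem coact_right (X : CoRep k H) {z : H} (hz : z ∈ target k H) (x : X) :
    X.coact (X.right z x) = ((LinearMap.mul k H).flip z).rTensor X (X.coact x) := by
  rw [right_apply, coact_slice]
  congr 2
  ext h
  exact slice_right_comul hz h

theorem left_left (X : CoRep k H) (w : H) {z : H} (hz : z ∈ target k H) (x : X) :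
    X.left w (X.left z x) = X.left (w * z) x := by
  rw [left_apply, coact_left X hz, left_apply, slice_mul_left, slice_mul_left,
    ← LinearMap.rTensor_comp_apply]
  congr 3
  ext h
  simp [mul_assoc]

theorem right_right (X : CoRep k H) (w : H) {z : H} (hz : z ∈ target k H) (x : X) :
    X.right w (X.right z x) = X.right (z * w) x := by
  rw [right_apply, coact_right X hz, right_apply, slice_mul_right, slice_mul_right,
    ← LinearMap.rTensor_comp_apply]
  congr 3
  ext h
  simp [mul_assoc]

theorem left_right (X : CoRep k H) {w z : H} (hw : w ∈ target k H) (hz : z ∈ target k H) (x : X) :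
    X.left w (X.right z x) = X.right z (X.left w x) := by
  rw [left_apply, coact_right X hz, right_apply, coact_left X hw, slice_mul_left, slice_mul_right,
    ← LinearMap.rTensor_comp_apply, ← LinearMap.rTensor_comp_apply]
  congr 3
  ext h
  simp [mul_assoc]

end

/-- For a bilinear map `B`, the map `(a ⊗ u, b ⊗ v) ↦ a b ⊗ B u v`. -/
def pair {U V W : Type u} [AddCommGroup U] [Module k U] [AddCommGroup V] [Module k V]
    [AddCommGroup W] [Module k W] (B : U →ₗ[k] V →ₗ[k] W) :
    H ⊗[k] U →ₗ[k] H ⊗[k] V →ₗ[k] H ⊗[k] W :=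
  TensorProduct.map₂ (LinearMap.mul k H) B

section pair

variable {U V W U' V' W' : Type u} [AddCommGroup U] [Module k U] [AddCommGroup V] [Module k V]
    [AddCommGroup W] [Module k W] [AddCommGroup U'] [Module k U'] [AddCommGroup V'] [Module k V']
    [AddCommGroup W'] [Module k W']

@[simp] theorem pair_tmul (B : U →ₗ[k] V →ₗ[k] W) (a b : H) (u : U) (v : V) :
    pair B (a ⊗ₜ[k] u) (b ⊗ₜ[k] v) = (a * b) ⊗ₜ[k] B u v := by
  simp [pair]

theorem pair_ind {p : H ⊗[k] U → H ⊗[k] V → Prop} (t : H ⊗[k] U) (s : H ⊗[k] V)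
    (h0 : ∀ s, p 0 s) (h0' : ∀ t, p t 0) (hadd : ∀ t t' s, p t s → p t' s → p (t + t') s)
    (hadd' : ∀ t s s', p t s → p t s' → p t (s + s'))
    (h : ∀ a u b v, p (a ⊗ₜ u) (b ⊗ₜ v)) : p t s := by
  induction t with
  | zero => exact h0 s
  | add t t' ht ht' => exact hadd _ _ _ ht ht'
  | tmul a u =>
    induction s with
    | zero => exact h0' _
    | add s s' hs hs' => exact hadd' _ _ _ hs hs'
    | tmul b v => exact h a u b v

theorem pair_natural {B : U →ₗ[k] V →ₗ[k] W} {B' : U' →ₗ[k] V' →ₗ[k] W'} (f : U →ₗ[k] U')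
    (g : V →ₗ[k] V') (e : W →ₗ[k] W') (h : ∀ u v, e (B u v) = B' (f u) (g v))
    (t : H ⊗[k] U) (s : H ⊗[k] V) :
    e.lTensor H (pair B t s) = pair B' (f.lTensor H t) (g.lTensor H s) := by
  induction t, s using pair_ind with
  | h0 s => simp
  | h0' t => simp
  | hadd t t' s h1 h2 => simp only [map_add, LinearMap.add_apply, h1, h2]
  | hadd' t s s' h1 h2 => simp only [map_add, h1, h2]
  | h a u b v => simp [h]

end pair

variable [WeakHopfAlgebra k H]

/-- The right action of the target algebra on a comodule. -/
abbrev rt (X : CoRep k H) (z : target k H) : X →ₗ[k] X := X.right z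

/-- The left action of the target algebra on a comodule. -/
abbrev lt (X : CoRep k H) (z : target k H) : X →ₗ[k] X := X.left z

/-- The coaction `x ⊗ y ↦ x₍₋₁₎ y₍₋₁₎ ⊗ (x₍₀₎ ⊗ y₍₀₎)` on `X ⊗_{H^t} Y`. -/
def tensorCoact (X Y : CoRep k H) : BalTensor X.rt Y.lt →ₗ[k] H ⊗[k] BalTensor X.rt Y.lt :=
  BalTensor.lift ((pair (BalTensor.mk X.rt Y.lt)).compl₁₂ X.coact Y.coact) (by
    intro z x y
    simp only [LinearMap.compl₁₂_apply, rt, lt, coact_left Y z.2, coact_right X z.2]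
    generalize X.coact x = t
    generalize Y.coact y = s
    induction t, s using pair_ind with
    | h0 s => simp
    | h0' t => simp
    | hadd t t' s h1 h2 => simp only [map_add, LinearMap.add_apply, h1, h2]
    | hadd' t s s' h1 h2 => simp only [map_add, h1, h2]
    | h a u b v => simp [mul_assoc])

@[simp] theorem tensorCoact_mk (X Y : CoRep k H) (x : X) (y : Y) :
    tensorCoact X Y (BalTensor.mk X.rt Y.lt x y)
      = pair (BalTensor.mk X.rt Y.lt) (X.coact x) (Y.coact y) := by
  simp [tensorCoact]

theorem counit_tensor_aux (X Y : CoRep k H) (x : X) (s : H ⊗[k] Y)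
    (t : H ⊗[k] X) (ht : ∀ z ∈ target k H,
      slice (Coalgebra.counit ∘ₗ (LinearMap.mul k H).flip z) t = X.right z x) :
    slice Coalgebra.counit (pair (BalTensor.mk X.rt Y.lt) t s)
      = BalTensor.mk X.rt Y.lt x
        (TensorProduct.lift (Y.left ∘ₗ targetMap k) s) := by
  induction s with
  | zero => simp
  | add a b ha hb => simp only [map_add, ha, hb]
  | tmul h y =>
    have e : slice Coalgebra.counit (pair (BalTensor.mk X.rt Y.lt) t (h ⊗ₜ[k] y))
        = BalTensor.mk X.rt Y.lt
          (slice (Coalgebra.counit ∘ₗ (LinearMap.mul k H).flip (targetMap k h)) t) y := by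
      clear ht
      induction t with
      | zero => simp
      | add a b ha hb => simp only [map_add, LinearMap.add_apply, ha, hb]
      | tmul a x => simp [counit_mul_target]
    rw [e, ht _ (targetMap_mem h)]
    exact BalTensor.mk_bal (r := X.rt) (l := Y.lt) ⟨_, targetMap_mem h⟩ x y

theorem left_targetMap_coact (Y : CoRep k H) (y : Y) :
    TensorProduct.lift (Y.left ∘ₗ targetMap k) (Y.coact y) = y := by
  have key : ∀ t : H ⊗[k] Y, TensorProduct.lift (Y.left ∘ₗ targetMap k) t
      = slice Coalgebra.counit ((LinearMap.mul' k H ∘ₗ (targetMap k).rTensor H).rTensor Y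
        ((TensorProduct.assoc k H H Y).symm (Y.coact.lTensor H t))) := by
    intro t
    induction t with
    | zero => simp
    | add a b ha hb => simp only [map_add, ha, hb]
    | tmul h y =>
      simp only [TensorProduct.lift.tmul, LinearMap.comp_apply, left_apply, LinearMap.lTensor_tmul]
      generalize Y.coact y = s
      induction s with
      | zero => simp
      | add a b ha hb => simp only [map_add, TensorProduct.tmul_add, ha, hb]
      | tmul a y => simp
  rw [key, ← Y.coassoc, LinearEquiv.symm_apply_apply, ← LinearMap.rTensor_comp_apply]
  have e : (LinearMap.mul' k H ∘ₗ (targetMap k).rTensor H) ∘ₗ Coalgebra.comul (R := k)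
      = LinearMap.id := by
    ext h
    exact targetMap_mul_comul h
  rw [e, LinearMap.rTensor_id, LinearMap.id_apply, slice_counit_coact]

theorem slice_tensorCoact (X Y : CoRep k H) (x : X) (y : Y) :
    slice Coalgebra.counit (tensorCoact X Y (BalTensor.mk X.rt Y.lt x y))
      = BalTensor.mk X.rt Y.lt x y := by
  rw [tensorCoact_mk, counit_tensor_aux X Y x _ _ (fun z _ => rfl),
    left_targetMap_coact]

theorem assoc_pair_aux {X Y W : Type u} [AddCommGroup X] [Module k X] [AddCommGroup Y]
    [Module k Y] [AddCommGroup W] [Module k W] (B : X →ₗ[k] Y →ₗ[k] W)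
    (t : H ⊗[k] X) (s : H ⊗[k] Y) :
    TensorProduct.assoc k H H W ((Coalgebra.comul (R := k) (A := H)).rTensor W (pair B t s))
      = pair (pair B)
        (TensorProduct.assoc k H H X ((Coalgebra.comul (R := k) (A := H)).rTensor X t))
        (TensorProduct.assoc k H H Y ((Coalgebra.comul (R := k) (A := H)).rTensor Y s)) := by
  induction t, s using pair_ind with
  | h0 s => simp
  | h0' t => simp
  | hadd t t' s h1 h2 => simp only [map_add, LinearMap.add_apply, h1, h2]
  | hadd' t s s' h1 h2 => simp only [map_add, h1, h2]
  | h a u b v =>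
    simp only [pair_tmul, LinearMap.rTensor_tmul, WeakHopfAlgebra.comul_mul]
    generalize Coalgebra.comul (R := k) a = p
    generalize Coalgebra.comul (R := k) b = q
    induction p, q using pair_ind with
    | h0 s => simp
    | h0' t => simp
    | hadd t t' s h1 h2 =>
      simp only [map_add, LinearMap.add_apply, add_mul, TensorProduct.add_tmul, h1, h2]
    | hadd' t s s' h1 h2 => simp only [map_add, mul_add, TensorProduct.add_tmul, h1, h2]
    | h a a' b b' => simp

/-- The tensor product `X ⊗_{H^t} Y` of comodules. -/
def tensor (X Y : CoRep k H) : CoRep k H where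
  carrier := BalTensor X.rt Y.lt
  coact := tensorCoact X Y
  coassoc := LinearMap.congr_fun
    (f := (TensorProduct.assoc k H H _).toLinearMap ∘ₗ
      (Coalgebra.comul (R := k) (A := H)).rTensor _ ∘ₗ tensorCoact X Y)
    (g := (tensorCoact X Y).lTensor H ∘ₗ tensorCoact X Y)
    (BalTensor.hom_ext fun x y => by
      simp only [LinearMap.comp_apply, LinearEquiv.coe_coe, tensorCoact_mk]
      rw [assoc_pair_aux, X.coassoc, Y.coassoc]
      symm
      exact pair_natural X.coact Y.coact (tensorCoact X Y) (by simp) _ _)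
  counit_coact := fun x => by
    have h := LinearMap.congr_fun
      (f := slice Coalgebra.counit ∘ₗ tensorCoact X Y) (g := LinearMap.id)
      (BalTensor.hom_ext fun x y => slice_tensorCoact X Y x y) x
    exact (TensorProduct.lid k _).injective (h.trans (by simp))

/-- The class of `x ⊗ y` in `X ⊗_{H^t} Y`. -/
def tmul (X Y : CoRep k H) : X →ₗ[k] Y →ₗ[k] tensor X Y := BalTensor.mk X.rt Y.lt

theorem tmul_bal (X Y : CoRep k H) {z : H} (hz : z ∈ target k H) (x : X) (y : Y) :
    tmul X Y (X.right z x) y = tmul X Y x (Y.left z y) :=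
  BalTensor.mk_bal (r := X.rt) (l := Y.lt) ⟨z, hz⟩ x y

theorem coact_tmul (X Y : CoRep k H) (x : X) (y : Y) :
    (tensor X Y).coact (tmul X Y x y) = pair (tmul X Y) (X.coact x) (Y.coact y) :=
  tensorCoact_mk X Y x y

theorem tensor_lin_ext {X Y : CoRep k H} {P : Type u} [AddCommGroup P] [Module k P]
    {f g : tensor X Y →ₗ[k] P} (h : ∀ x y, f (tmul X Y x y) = g (tmul X Y x y)) : f = g :=
  BalTensor.hom_ext h

theorem tensor_hom_ext {X Y P : CoRep k H} {f g : tensor X Y ⟶ P}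
    (h : ∀ x y, lin f (tmul X Y x y) = lin g (tmul X Y x y)) : f = g :=
  hom_ext (LinearMap.congr_fun (tensor_lin_ext h))

theorem tensor_lin_ext₃ {X Y Z : CoRep k H} {Q : Type u} [AddCommGroup Q] [Module k Q]
    {f g : tensor (tensor X Y) Z →ₗ[k] Q}
    (h : ∀ x y z, f (tmul _ _ (tmul X Y x y) z) = g (tmul _ _ (tmul X Y x y) z)) : f = g := by
  apply tensor_lin_ext
  intro x p
  exact LinearMap.congr_fun (f := f ∘ₗ (tmul (tensor X Y) Z).flip p)
    (g := g ∘ₗ (tmul (tensor X Y) Z).flip p) (tensor_lin_ext fun m n => h m n p) x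

theorem tensor_hom_ext₃ {X Y Z Q : CoRep k H} {f g : tensor (tensor X Y) Z ⟶ Q}
    (h : ∀ x y z, lin f (tmul _ _ (tmul X Y x y) z) = lin g (tmul _ _ (tmul X Y x y) z)) :
    f = g :=
  hom_ext (LinearMap.congr_fun (tensor_lin_ext₃ h))

theorem tensor_hom_ext₄ {X Y Z W R : CoRep k H} {f g : tensor (tensor (tensor X Y) Z) W ⟶ R}
    (h : ∀ x y z w, lin f (tmul _ _ (tmul _ _ (tmul X Y x y) z) w)
      = lin g (tmul _ _ (tmul _ _ (tmul X Y x y) z) w)) : f = g := by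
  apply tensor_hom_ext
  intro x q
  exact LinearMap.congr_fun (f := lin f ∘ₗ (tmul _ W).flip q) (g := lin g ∘ₗ (tmul _ W).flip q)
    (tensor_lin_ext₃ fun m n p => h m n p q) x

/-- A homomorphism out of `X ⊗_{H^t} Y` from a linear map that is colinear on elements
`x ⊗ y`. -/
def homOfTensor {X Y P : CoRep k H} (f : tensor X Y →ₗ[k] P)
    (h : ∀ x y, P.coact (f (tmul X Y x y))
      = f.lTensor H (pair (tmul X Y) (X.coact x) (Y.coact y))) : tensor X Y ⟶ P :=
  ofLin f (LinearMap.congr_fun (f := P.coact ∘ₗ f) (g := f.lTensor H ∘ₗ (tensor X Y).coact)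
    (tensor_lin_ext fun x y => by simp [h, coact_tmul]))

theorem left_tmul (X Y : CoRep k H) {z : H} (hz : z ∈ target k H) (x : X) (y : Y) :
    (tensor X Y).left z (tmul X Y x y) = tmul X Y (X.left z x) y := by
  rw [← slice_counit_coact (tensor X Y) (tmul X Y (X.left z x) y), left_apply, slice_mul_left,
    coact_tmul, coact_tmul, coact_left X hz]
  congr 1
  generalize X.coact x = t
  generalize Y.coact y = s
  induction t, s using pair_ind with
  | h0 s => simp
  | h0' t => simp
  | hadd t t' s h1 h2 => simp only [map_add, LinearMap.add_apply, h1, h2]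
  | hadd' t s s' h1 h2 => simp only [map_add, h1, h2]
  | h a u b v => simp [mul_assoc]

theorem right_tmul (X Y : CoRep k H) {z : H} (hz : z ∈ target k H) (x : X) (y : Y) :
    (tensor X Y).right z (tmul X Y x y) = tmul X Y x (Y.right z y) := by
  rw [← slice_counit_coact (tensor X Y) (tmul X Y x (Y.right z y)), right_apply, slice_mul_right,
    coact_tmul, coact_tmul, coact_right Y hz]
  congr 1
  generalize X.coact x = t
  generalize Y.coact y = s
  induction t, s using pair_ind with
  | h0 s => simp
  | h0' t => simp
  | hadd t t' s h1 h2 => simp only [map_add, LinearMap.add_apply, h1, h2]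
  | hadd' t s s' h1 h2 => simp only [map_add, h1, h2]
  | h a u b v => simp [mul_assoc]

/-- The linear map underlying the tensor product of two homomorphisms of comodules. -/
def tensorMapLin {X Y X' Y' : CoRep k H} (f : X ⟶ X') (g : Y ⟶ Y') :
    tensor X Y →ₗ[k] tensor X' Y' :=
  BalTensor.map (lin f) (lin g) (fun z : target k H => lin_right f z)
    (fun z : target k H => lin_left g z)

theorem tensorMapLin_tmul {X Y X' Y' : CoRep k H} (f : X ⟶ X') (g : Y ⟶ Y') (x : X) (y : Y) :
    tensorMapLin f g (tmul X Y x y) = tmul X' Y' (lin f x) (lin g y) :=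
  BalTensor.map_mk (lin f) (lin g) (fun z : target k H => lin_right f z)
    (fun z : target k H => lin_left g z) x y

/-- The tensor product of two homomorphisms of comodules. -/
def tensorMap {X Y X' Y' : CoRep k H} (f : X ⟶ X') (g : Y ⟶ Y') : tensor X Y ⟶ tensor X' Y' :=
  homOfTensor (tensorMapLin f g) (fun x y => by
    rw [pair_natural (lin f) (lin g) (tensorMapLin f g) (tensorMapLin_tmul f g),
      tensorMapLin_tmul, coact_tmul, coact_lin, coact_lin])

@[simp] theorem lin_tensorMap {X Y X' Y' : CoRep k H} (f : X ⟶ X') (g : Y ⟶ Y') (x : X) (y : Y) :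
    lin (tensorMap f g) (tmul X Y x y) = tmul X' Y' (lin f x) (lin g y) :=
  tensorMapLin_tmul f g x y

/-- The linear equivalence `(X ⊗ Y) ⊗ Z ≃ X ⊗ (Y ⊗ Z)` over `H^t`. -/
def assocEquiv (X Y Z : CoRep k H) : tensor (tensor X Y) Z ≃ₗ[k] tensor X (tensor Y Z) :=
  BalTensor.assoc (fun z : target k H => right_tmul X Y z.2) (fun z : target k H => left_tmul Y Z z.2)

theorem assocEquiv_tmul (X Y Z : CoRep k H) (x : X) (y : Y) (z : Z) :
    assocEquiv X Y Z (tmul (tensor X Y) Z (tmul X Y x y) z)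
      = tmul X (tensor Y Z) x (tmul Y Z y z) :=
  BalTensor.assoc_mk (fun z : target k H => right_tmul X Y z.2)
    (fun z : target k H => left_tmul Y Z z.2) x y z

/-- The associativity isomorphism of comodules. -/
def associator (X Y Z : CoRep k H) : tensor (tensor X Y) Z ≅ tensor X (tensor Y Z) :=
  isoOfLin (assocEquiv X Y Z) (LinearMap.congr_fun
    (f := (tensor X (tensor Y Z)).coact ∘ₗ (assocEquiv X Y Z).toLinearMap)
    (g := (assocEquiv X Y Z).toLinearMap.lTensor H ∘ₗ (tensor (tensor X Y) Z).coact)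
    (tensor_lin_ext₃ fun x y z => by
      simp only [LinearMap.comp_apply, LinearEquiv.coe_coe, assocEquiv_tmul, coact_tmul]
      generalize X.coact x = r
      generalize Y.coact y = s
      generalize Z.coact z = t
      induction r, s using pair_ind with
      | h0 s => simp
      | h0' t => simp
      | hadd t t' s h1 h2 => simp only [map_add, LinearMap.add_apply, h1, h2]
      | hadd' t s s' h1 h2 => simp only [map_add, LinearMap.add_apply, h1, h2]
      | h a u b v =>
        induction t with
        | zero => simp
        | add t t' h1 h2 => simp only [map_add, h1, h2]
        | tmul c w => simp [assocEquiv_tmul, mul_assoc]))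

@[simp] theorem lin_associator (X Y Z : CoRep k H) (x : X) (y : Y) (z : Z) :
    lin (associator X Y Z).hom (tmul (tensor X Y) Z (tmul X Y x y) z)
      = tmul X (tensor Y Z) x (tmul Y Z y z) :=
  assocEquiv_tmul X Y Z x y z

/-- The target counital map with values in the target algebra. -/
def toTarget (k H : Type u) [Field k] [Ring H] [Algebra k H] [Coalgebra k H] :
    H →ₗ[k] target k H :=
  (targetMap k).codRestrict (target k H) targetMap_mem

/-- The coaction `z ↦ z₍₁₎ ⊗ z₍₂₎` of the unit comodule `H^t`; the codomain of the comultiplication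
is restricted by means of the projection `ε_t` of `H` onto `H^t`. -/
def unitCoact (k H : Type u) [Field k] [Ring H] [Algebra k H] [Coalgebra k H] :
    target k H →ₗ[k] H ⊗[k] target k H :=
  (toTarget k H).lTensor H ∘ₗ Coalgebra.comul ∘ₗ (target k H).subtype

theorem lTensor_subtype_unitCoact (z : target k H) :
    (target k H).subtype.lTensor H (unitCoact k H z) = Coalgebra.comul (R := k) (z : H) := by
  rw [unitCoact, LinearMap.comp_apply, ← LinearMap.lTensor_comp_apply]
  exact lTensor_targetMap_comul z.2

theorem lTensor_subtype_injective {U : Type u} [AddCommGroup U] [Module k U]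
    {V : Type u} [AddCommGroup V] [Module k V] (f : V →ₗ[k] U) (hf : Function.Injective f) :
    Function.Injective (f.lTensor H) :=
  Module.Flat.lTensor_preserves_injective_linearMap f hf

/-- The unit comodule `H^t`, a left coideal of `H`. -/
def unit (k H : Type u) [Field k] [Ring H] [Algebra k H] [Coalgebra k H] [WeakHopfAlgebra k H]
    [FiniteDimensional k H] : CoRep k H where
  carrier := target k H
  coact := unitCoact k H
  coassoc z := by
    apply lTensor_subtype_injective ((target k H).subtype.lTensor H)
      (lTensor_subtype_injective _ (target k H).injective_subtype)
    rw [← LinearMap.lTensor_comp_apply]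
    have e : (target k H).subtype.lTensor H ∘ₗ unitCoact k H
        = Coalgebra.comul ∘ₗ (target k H).subtype :=
      LinearMap.ext lTensor_subtype_unitCoact
    rw [e, LinearMap.lTensor_comp_apply, lTensor_subtype_unitCoact, ← Coalgebra.coassoc_apply,
      ← lTensor_subtype_unitCoact]
    generalize unitCoact k H z = t
    induction t with
    | zero => simp
    | add a b ha hb => simp only [map_add, ha, hb]
    | tmul a w =>
      simp only [LinearMap.rTensor_tmul, LinearMap.lTensor_tmul]
      generalize Coalgebra.comul (R := k) a = s
      induction s with
      | zero => simp
      | add a b ha hb => simp only [map_add, TensorProduct.add_tmul, ha, hb]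
      | tmul a b => simp
  counit_coact z := by
    apply Module.Flat.lTensor_preserves_injective_linearMap (M := k) (target k H).subtype
      (target k H).injective_subtype
    rw [← LinearMap.comp_apply, LinearMap.lTensor_comp_rTensor, ← LinearMap.rTensor_comp_lTensor,
      LinearMap.comp_apply, lTensor_subtype_unitCoact]
    simp

section unit

variable [FiniteDimensional k H]

theorem unit_coe_left {z : H} (hz : z ∈ target k H) (w : target k H) :
    (target k H).subtype ((unit k H).left z w) = z * w :=
  (slice_lTensor _ (target k H).subtype _).symm.trans
    ((congrArg _ (lTensor_subtype_unitCoact w)).trans (slice_left_comul hz _))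

theorem unit_coe_right {z : H} (hz : z ∈ target k H) (w : target k H) :
    (target k H).subtype ((unit k H).right z w) = w * z :=
  (slice_lTensor _ (target k H).subtype _).symm.trans
    ((congrArg _ (lTensor_subtype_unitCoact w)).trans (slice_right_comul hz _))

/-- The element `1` of the unit comodule. -/
def unitOne (k H : Type u) [Field k] [Ring H] [Algebra k H] [Coalgebra k H] [WeakHopfAlgebra k H]
    [FiniteDimensional k H] : unit k H := (⟨1, one_mem_target⟩ : target k H)

theorem unit_right_one (z : target k H) : (unit k H).right z (unitOne k H) = z :=
  (target k H).injective_subtype ((unit_coe_right z.2 _).trans (one_mul _))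

theorem unit_left_one (z : target k H) : (unit k H).left z (unitOne k H) = z :=
  (target k H).injective_subtype ((unit_coe_left z.2 _).trans (mul_one _))

/-- The left action of the target algebra as a bilinear map on the unit comodule. -/
def leftB (X : CoRep k H) : unit k H →ₗ[k] X →ₗ[k] X := X.left ∘ₗ (target k H).subtype

/-- The right action of the target algebra as a bilinear map on the unit comodule. -/
def rightB (X : CoRep k H) : X →ₗ[k] unit k H →ₗ[k] X := (X.right ∘ₗ (target k H).subtype).flip

theorem leftB_apply (X : CoRep k H) (z : target k H) (x : X) : leftB X z x = X.left z x := rfl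

theorem rightB_apply (X : CoRep k H) (z : target k H) (x : X) : rightB X x z = X.right z x := rfl

theorem leftB_bal (X : CoRep k H) (z w : target k H) (x : X) :
    leftB X ((unit k H).right z w) x = leftB X w (X.left z x) := by
  change X.left ((target k H).subtype ((unit k H).right z w)) x = X.left w (X.left z x)
  rw [unit_coe_right z.2, left_left X _ z.2]

theorem rightB_bal (X : CoRep k H) (z w : target k H) (x : X) :
    rightB X (X.right z x) w = rightB X x ((unit k H).left z w) := by
  change X.right w (X.right z x) = X.right ((target k H).subtype ((unit k H).left z w)) x
  rw [unit_coe_left z.2, right_right X _ z.2]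

theorem pair_left_coact (X : CoRep k H) (p : H ⊗[k] H) (x : X) :
    pair X.left p (X.coact x) = ((TensorProduct.rid k H).toLinearMap ∘ₗ
      (Coalgebra.counit (R := k)).lTensor H ∘ₗ LinearMap.mulLeft k p ∘ₗ
        Coalgebra.comul).rTensor X (X.coact x) := by
  induction p with
  | zero => simp
  | add p q hp hq =>
    rw [map_add, LinearMap.add_apply, hp, hq, ← LinearMap.add_apply, ← LinearMap.rTensor_add]
    congr 2
    ext h
    simp [add_mul]
  | tmul a b =>
    have h1 : ∀ t : H ⊗[k] X, pair X.left (a ⊗ₜ[k] b) t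
        = (slice (Coalgebra.counit ∘ₗ LinearMap.mul k H b)).lTensor H
          ((LinearMap.mul k H a).rTensor _ (X.coact.lTensor H t)) := by
      intro t
      induction t with
      | zero => simp
      | add t s ht hs => simp only [map_add, ht, hs]
      | tmul h x => simp [left_apply]
    rw [h1, ← X.coassoc]
    generalize X.coact x = t
    induction t with
    | zero => simp
    | add t s ht hs => simp only [map_add, ht, hs]
    | tmul h x =>
      simp only [LinearMap.rTensor_tmul, LinearMap.comp_apply]
      generalize Coalgebra.comul (R := k) h = s
      induction s with
      | zero => simp
      | add t s ht hs => simp only [map_add, TensorProduct.add_tmul, ht, hs]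
      | tmul c d => simp [TensorProduct.smul_tmul]

theorem pair_right_coact (X : CoRep k H) (p : H ⊗[k] H) (x : X) :
    pair X.right.flip (X.coact x) p = ((TensorProduct.rid k H).toLinearMap ∘ₗ
      (Coalgebra.counit (R := k)).lTensor H ∘ₗ LinearMap.mulRight k p ∘ₗ
        Coalgebra.comul).rTensor X (X.coact x) := by
  induction p with
  | zero => simp
  | add p q hp hq =>
    rw [map_add, hp, hq, ← LinearMap.add_apply, ← LinearMap.rTensor_add]
    congr 2
    ext h
    simp [mul_add]
  | tmul a b =>
    have h1 : ∀ t : H ⊗[k] X, pair X.right.flip t (a ⊗ₜ[k] b)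
        = (slice (Coalgebra.counit ∘ₗ (LinearMap.mul k H).flip b)).lTensor H
          (((LinearMap.mul k H).flip a).rTensor _ (X.coact.lTensor H t)) := by
      intro t
      induction t with
      | zero => simp
      | add t s ht hs => simp only [map_add, LinearMap.add_apply, ht, hs]
      | tmul h x => simp [right_apply]
    rw [h1, ← X.coassoc]
    generalize X.coact x = t
    induction t with
    | zero => simp
    | add t s ht hs => simp only [map_add, ht, hs]
    | tmul h x =>
      simp only [LinearMap.rTensor_tmul, LinearMap.comp_apply]
      generalize Coalgebra.comul (R := k) h = s
      induction s with
      | zero => simp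
      | add t s ht hs => simp only [map_add, TensorProduct.add_tmul, ht, hs]
      | tmul c d => simp [TensorProduct.smul_tmul]

theorem lTensor_counit_comul' (h : H) : TensorProduct.rid k H
    ((Coalgebra.counit (R := k)).lTensor H (Coalgebra.comul (R := k) h)) = h := by
  simp

theorem coact_leftB (X : CoRep k H) (z : target k H) (x : X) :
    X.coact (leftB X z x) = pair (leftB X) (unitCoact k H z) (X.coact x) := by
  have h := pair_natural (H := H) (B := leftB X) (B' := X.left) (target k H).subtype
    LinearMap.id LinearMap.id (fun _ _ => rfl) (unitCoact k H z) (X.coact x)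
  simp only [LinearMap.lTensor_id, LinearMap.id_apply] at h
  refine Eq.trans ?_ (h.trans
    (congrArg (fun t => pair X.left t (X.coact x)) (lTensor_subtype_unitCoact z))).symm
  simp only [pair_left_coact]
  refine (coact_left X z.2 x).trans ?_
  congr 2
  ext h
  simp only [LinearMap.comp_apply, LinearMap.mulLeft_apply, ← WeakHopfAlgebra.comul_mul]
  exact (lTensor_counit_comul' _).symm

theorem coact_rightB (X : CoRep k H) (z : target k H) (x : X) :
    X.coact (rightB X x z) = pair (rightB X) (X.coact x) (unitCoact k H z) := by
  have h := pair_natural (H := H) (B := rightB X) (B' := X.right.flip)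
    LinearMap.id (target k H).subtype LinearMap.id (fun _ _ => rfl) (X.coact x) (unitCoact k H z)
  simp only [LinearMap.lTensor_id, LinearMap.id_apply] at h
  refine Eq.trans ?_ (h.trans
    (congrArg (fun t => pair X.right.flip (X.coact x) t) (lTensor_subtype_unitCoact z))).symm
  simp only [pair_right_coact]
  refine (coact_right X z.2 x).trans ?_
  congr 2
  ext h
  simp only [LinearMap.comp_apply, LinearMap.mulRight_apply, ← WeakHopfAlgebra.comul_mul]
  exact (lTensor_counit_comul' _).symm

/-- The map `z ⊗ x ↦ z · x`. -/
def leftUnitorLin (X : CoRep k H) : tensor (unit k H) X →ₗ[k] X :=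
  BalTensor.lift (leftB X) (fun z w x => leftB_bal X z w x)

theorem leftUnitorLin_tmul (X : CoRep k H) (z : unit k H) (x : X) :
    leftUnitorLin X (tmul (unit k H) X z x) = leftB X z x :=
  BalTensor.lift_mk (leftB X) (fun z w x => leftB_bal X z w x) z x

/-- The map `x ⊗ z ↦ x · z`. -/
def rightUnitorLin (X : CoRep k H) : tensor X (unit k H) →ₗ[k] X :=
  BalTensor.lift (rightB X) (fun z x w => rightB_bal X z w x)

theorem rightUnitorLin_tmul (X : CoRep k H) (z : unit k H) (x : X) :
    rightUnitorLin X (tmul X (unit k H) x z) = rightB X x z :=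
  BalTensor.lift_mk (rightB X) (fun z x w => rightB_bal X z w x) x z

theorem leftB_one (X : CoRep k H) (x : X) : leftB X (unitOne k H) x = x := left_one X x

theorem rightB_one (X : CoRep k H) (x : X) : rightB X x (unitOne k H) = x := right_one X x

theorem one_tmul_leftB (X : CoRep k H) (z : unit k H) (x : X) :
    tmul (unit k H) X (unitOne k H) (leftB X z x) = tmul (unit k H) X z x :=
  (tmul_bal (unit k H) X (Subtype.prop (show target k H from z)) (unitOne k H) x).symm.trans
    (congrArg (fun w => tmul (unit k H) X w x) (unit_right_one z))

theorem rightB_tmul_one (X : CoRep k H) (z : unit k H) (x : X) :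
    tmul X (unit k H) (rightB X x z) (unitOne k H) = tmul X (unit k H) x z :=
  (tmul_bal X (unit k H) (Subtype.prop (show target k H from z)) x (unitOne k H)).trans
    (congrArg (fun w => tmul X (unit k H) x w) (unit_left_one z))

/-- The isomorphism `H^t ⊗ X ≅ X`, `z ⊗ x ↦ z · x`. -/
def leftUnitor (X : CoRep k H) : tensor (unit k H) X ≅ X :=
  isoOfLin (LinearEquiv.ofLinearMap (leftUnitorLin X) (tmul (unit k H) X (unitOne k H))
    (LinearMap.ext fun x => (leftUnitorLin_tmul X _ x).trans (leftB_one X x))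
    (tensor_lin_ext fun z x => (congrArg _ (leftUnitorLin_tmul X z x)).trans
      (one_tmul_leftB X z x)))
    (LinearMap.congr_fun (f := X.coact ∘ₗ leftUnitorLin X)
      (g := (leftUnitorLin X).lTensor H ∘ₗ (tensor (unit k H) X).coact)
      (tensor_lin_ext fun z x => by
        simp only [LinearMap.comp_apply, coact_tmul, leftUnitorLin_tmul]
        refine (coact_leftB X z x).trans ?_
        have h := pair_natural (H := H) (B := tmul (unit k H) X) (B' := leftB X)
          LinearMap.id LinearMap.id (leftUnitorLin X) (leftUnitorLin_tmul X) (unitCoact k H z)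
          (X.coact x)
        simp only [LinearMap.lTensor_id, LinearMap.id_apply] at h
        exact h.symm))

theorem lin_leftUnitor (X : CoRep k H) (z : unit k H) (x : X) :
    lin (leftUnitor X).hom (tmul (unit k H) X z x) = leftB X z x := leftUnitorLin_tmul X z x

/-- The isomorphism `X ⊗ H^t ≅ X`, `x ⊗ z ↦ x · z`. -/
def rightUnitor (X : CoRep k H) : tensor X (unit k H) ≅ X :=
  isoOfLin (LinearEquiv.ofLinearMap (rightUnitorLin X) ((tmul X (unit k H)).flip (unitOne k H))
    (LinearMap.ext fun x => (rightUnitorLin_tmul X _ x).trans (rightB_one X x))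
    (tensor_lin_ext fun x z => (congrArg ((tmul X (unit k H)).flip (unitOne k H))
      (rightUnitorLin_tmul X z x)).trans
      (rightB_tmul_one X z x)))
    (LinearMap.congr_fun (f := X.coact ∘ₗ rightUnitorLin X)
      (g := (rightUnitorLin X).lTensor H ∘ₗ (tensor X (unit k H)).coact)
      (tensor_lin_ext fun x z => by
        simp only [LinearMap.comp_apply, coact_tmul, rightUnitorLin_tmul]
        refine (coact_rightB X z x).trans ?_
        have h := pair_natural (H := H) (B := tmul X (unit k H)) (B' := rightB X)
          LinearMap.id LinearMap.id (rightUnitorLin X) (fun x z => rightUnitorLin_tmul X z x)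
          (X.coact x) (unitCoact k H z)
        simp only [LinearMap.lTensor_id, LinearMap.id_apply] at h
        exact h.symm))

theorem lin_rightUnitor (X : CoRep k H) (z : unit k H) (x : X) :
    lin (rightUnitor X).hom (tmul X (unit k H) x z) = rightB X x z := rightUnitorLin_tmul X z x

instance : MonoidalCategoryStruct (CoRep k H) where
  tensorObj := tensor
  whiskerLeft X _ _ f := tensorMap (𝟙 X) f
  whiskerRight f Y := tensorMap f (𝟙 Y)
  tensorHom := tensorMap
  tensorUnit := unit k H
  associator := associator
  leftUnitor := leftUnitor
  rightUnitor := rightUnitor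

instance : MonoidalCategory (CoRep k H) :=
  MonoidalCategory.ofTensorHom
    (id_tensorHom_id := fun M N => tensor_hom_ext fun m n => lin_tensorMap (𝟙 M) (𝟙 N) m n)
    (tensorHom_comp_tensorHom := fun f₁ f₂ g₁ g₂ => tensor_hom_ext fun m n => by
      change lin (tensorMap g₁ g₂) (lin (tensorMap f₁ f₂) (tmul _ _ m n))
        = lin (tensorMap (f₁ ≫ g₁) (f₂ ≫ g₂)) (tmul _ _ m n)
      simp)
    (id_tensorHom := fun _ _ _ _ => rfl)
    (tensorHom_id := fun _ _ => rfl)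
    (associator_naturality := fun {X₁ X₂ X₃ Y₁ Y₂ Y₃} f₁ f₂ f₃ => tensor_hom_ext₃ fun m n p => by
      change lin (associator Y₁ Y₂ Y₃).hom
          (lin (tensorMap (tensorMap f₁ f₂) f₃) (tmul _ _ (tmul X₁ X₂ m n) p))
        = lin (tensorMap f₁ (tensorMap f₂ f₃))
          (lin (associator X₁ X₂ X₃).hom (tmul _ _ (tmul X₁ X₂ m n) p))
      simp)
    (leftUnitor_naturality := fun {M N} f => tensor_hom_ext fun z m => by
      change lin (leftUnitor N).hom (lin (tensorMap (𝟙 (unit k H)) f) (tmul (unit k H) M z m))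
        = lin f (lin (leftUnitor M).hom (tmul (unit k H) M z m))
      rw [lin_tensorMap, lin_leftUnitor, lin_leftUnitor]
      exact (lin_left f _ m).symm)
    (rightUnitor_naturality := fun {M N} f => tensor_hom_ext fun m z => by
      change lin (rightUnitor N).hom (lin (tensorMap f (𝟙 (unit k H))) (tmul M (unit k H) m z))
        = lin f (lin (rightUnitor M).hom (tmul M (unit k H) m z))
      rw [lin_tensorMap, lin_rightUnitor, lin_rightUnitor]
      exact (lin_right f _ m).symm)
    (pentagon := fun W X Y Z => tensor_hom_ext₄ fun w x y z => by
      change lin (tensorMap (𝟙 W) (associator X Y Z).hom)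
        (lin (associator W (tensor X Y) Z).hom (lin (tensorMap (associator W X Y).hom (𝟙 Z))
          (tmul _ _ (tmul _ _ (tmul W X w x) y) z)))
        = lin (associator W X (tensor Y Z)).hom (lin (associator (tensor W X) Y Z).hom
          (tmul _ _ (tmul _ _ (tmul W X w x) y) z))
      simp)
    (triangle := fun M N => tensor_hom_ext₃ fun m z n => by
      change lin (tensorMap (𝟙 M) (leftUnitor N).hom) (lin (associator M (unit k H) N).hom
          (tmul _ _ (tmul M (unit k H) m z) n))
        = lin (tensorMap (rightUnitor M).hom (𝟙 N)) (tmul _ _ (tmul M (unit k H) m z) n)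
      simp only [lin_associator, lin_tensorMap, lin_leftUnitor, lin_rightUnitor]
      exact (tmul_bal M N (Subtype.prop (show target k H from z)) m n).symm)

end unit

end CoRep

end Comodules

section Actions

variable (k H A : Type u) [Field k] [Ring H] [Algebra k H] [Coalgebra k H] [WeakHopfAlgebra k H]
  [FiniteDimensional k H] [Ring A] [Algebra k A]

/-- The weak fiber functor `F_H : coRep(H) → Vec`: it forgets the coaction. -/
def weakFiber : CoRep k H ⥤ ModuleCat.{u} k where
  obj X := ModuleCat.of k X
  map f := ModuleCat.ofHom (CoRep.lin f)

variable {k H} in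
theorem CoRep.smul_leftB_one (X : CoRep k H) (c : k) (x : X) :
    CoRep.leftB X (c • CoRep.unitOne k H) x = c • x := by
  rw [map_smul, LinearMap.smul_apply, CoRep.leftB_one]

variable {k H} in
theorem CoRep.smul_rightB_one (X : CoRep k H) (c : k) (x : X) :
    CoRep.rightB X x (c • CoRep.unitOne k H) = c • x := by
  rw [map_smul, CoRep.rightB_one]

/-- The lax monoidal structure of the weak fiber functor, given by the quotient maps
`X ⊗ Y → X ⊗_{H^t} Y` and the unit `k → H^t` of the target algebra. -/
instance : (weakFiber k H).LaxMonoidal where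
  ε := ModuleCat.ofHom (LinearMap.toSpanSingleton k (CoRep.unit k H) (CoRep.unitOne k H))
  μ X Y := ModuleCat.ofHom (TensorProduct.lift (CoRep.tmul X Y))
  μ_natural_left f Z := by
    apply ModuleCat.hom_ext
    apply TensorProduct.ext'
    intro x y
    exact (CoRep.lin_tensorMap f (𝟙 Z) x y).symm
  μ_natural_right Z f := by
    apply ModuleCat.hom_ext
    apply TensorProduct.ext'
    intro x y
    exact (CoRep.lin_tensorMap (𝟙 Z) f x y).symm
  associativity X Y Z := by
    apply ModuleCat.hom_ext
    apply TensorProduct.ext_threefold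
    intro x y z
    exact CoRep.lin_associator X Y Z x y z
  left_unitality X := by
    apply ModuleCat.hom_ext
    apply TensorProduct.ext'
    intro c x
    exact ((CoRep.lin_leftUnitor X (c • CoRep.unitOne k H) x).trans
      (CoRep.smul_leftB_one X c x)).symm
  right_unitality X := by
    apply ModuleCat.hom_ext
    apply TensorProduct.ext'
    intro x c
    exact ((CoRep.lin_rightUnitor X (c • CoRep.unitOne k H) x).trans
      (CoRep.smul_rightB_one X c x)).symm

/-- A based action of `coRep(H)` on `A`: a monoidal functor to `A`-`A`-bimodules together with
finite-dimensional subspaces `base X` of the bimodules `F(X)`, containing the unit of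
`A ≅ F(1)`, and preserved by morphisms and by the tensor structure of the functor. -/
structure BasedAction where
  functor : CoRep k H ⥤ Bim k A
  [monoidal : functor.Monoidal]
  base : ∀ X : CoRep k H, Submodule k (functor.obj X)
  finite_base : ∀ X, FiniteDimensional k (base X)
  one_mem : Bim.lin (Functor.LaxMonoidal.ε functor) (1 : A) ∈ base (𝟙_ (CoRep k H))
  map_mem : ∀ {X Y : CoRep k H} (f : X ⟶ Y), ∀ v ∈ base X, Bim.lin (functor.map f) v ∈ base Y
  tensor_mem : ∀ (X Y : CoRep k H), ∀ v ∈ base X, ∀ w ∈ base Y,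
    Bim.lin (Functor.LaxMonoidal.μ functor X Y)
      (Bim.tmul (functor.obj X) (functor.obj Y) v w) ∈ base (X ⊗ Y)

attribute [instance] BasedAction.monoidal

variable {k H A}

namespace BasedAction

variable (B : BasedAction k H A)

/-- The functor `X ↦ base X` induced by a based action. -/
def induced : CoRep k H ⥤ ModuleCat.{u} k where
  obj X := ModuleCat.of k (B.base X)
  map f := ModuleCat.ofHom ((Bim.lin (B.functor.map f)).restrict (B.map_mem f))
  map_id X := by
    apply ModuleCat.hom_ext
    ext v
    change Bim.lin (B.functor.map (𝟙 X)) v = v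
    rw [B.functor.map_id, Bim.lin_id]
  map_comp f g := by
    apply ModuleCat.hom_ext
    ext v
    change Bim.lin (B.functor.map (f ≫ g)) v = _
    rw [B.functor.map_comp, Bim.lin_comp]
    rfl

/-- The element `1` of `base 1`. -/
def baseOne : B.base (𝟙_ (CoRep k H)) := ⟨_, B.one_mem⟩

/-- The multiplication maps `base X × base Y → base (X ⊗ Y)`. -/
def baseMul (X Y : CoRep k H) : B.base X →ₗ[k] B.base Y →ₗ[k] B.base (X ⊗ Y) :=
  LinearMap.mk₂ k (fun v w => ⟨_, B.tensor_mem X Y v v.2 w w.2⟩)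
    (by intros; ext; simp) (by intros; ext; simp) (by intros; ext; simp) (by intros; ext; simp)

theorem coe_baseMul (X Y : CoRep k H) (v : B.base X) (w : B.base Y) :
    (B.baseMul X Y v w : B.functor.obj (X ⊗ Y))
      = Bim.lin (Functor.LaxMonoidal.μ B.functor X Y)
        (Bim.tmul (B.functor.obj X) (B.functor.obj Y) v w) := rfl

theorem map_leftUnitor_smul (X : CoRep k H) (c : k) (v : B.functor.obj X) :
    Bim.lin (B.functor.map (λ_ X).hom) (Bim.lin (Functor.LaxMonoidal.μ B.functor (𝟙_ _) X)
      (Bim.tmul (B.functor.obj (𝟙_ _)) (B.functor.obj X)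
        (c • Bim.lin (Functor.LaxMonoidal.ε B.functor) (1 : A)) v)) = c • v := by
  have h := congrArg (fun g => Bim.lin g (Bim.tmul (Bim.unit k A) (B.functor.obj X) (1 : A) v))
    (Functor.LaxMonoidal.left_unitality B.functor X)
  have e := congrArg (fun t => Bim.lin (B.functor.map (λ_ X).hom)
    (Bim.lin (Functor.LaxMonoidal.μ B.functor (𝟙_ _) X) t))
    (Bim.lin_tensorMap (Functor.LaxMonoidal.ε B.functor) (𝟙 (B.functor.obj X)) (1 : A) v)
  have h' := (e.symm.trans h.symm).trans ((B.functor.obj X).left_one v)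
  simp only [map_smul, LinearMap.smul_apply]
  exact congrArg (c • ·) h'

theorem map_rightUnitor_smul (X : CoRep k H) (c : k) (v : B.functor.obj X) :
    Bim.lin (B.functor.map (ρ_ X).hom) (Bim.lin (Functor.LaxMonoidal.μ B.functor X (𝟙_ _))
      (Bim.tmul (B.functor.obj X) (B.functor.obj (𝟙_ _)) v
        (c • Bim.lin (Functor.LaxMonoidal.ε B.functor) (1 : A)))) = c • v := by
  have h := congrArg (fun g => Bim.lin g (Bim.tmul (B.functor.obj X) (Bim.unit k A) v (1 : A)))
    (Functor.LaxMonoidal.right_unitality B.functor X)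
  have e := congrArg (fun t => Bim.lin (B.functor.map (ρ_ X).hom)
    (Bim.lin (Functor.LaxMonoidal.μ B.functor X (𝟙_ _)) t))
    (Bim.lin_tensorMap (𝟙 (B.functor.obj X)) (Functor.LaxMonoidal.ε B.functor) v (1 : A))
  have h' := (e.symm.trans h.symm).trans ((B.functor.obj X).right_one v)
  simp only [map_smul]
  exact congrArg (c • ·) h'

/-- The lax monoidal structure of the functor induced by a based action. -/
instance : B.induced.LaxMonoidal where
  ε := ModuleCat.ofHom (LinearMap.toSpanSingleton k (B.base (𝟙_ (CoRep k H))) B.baseOne)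
  μ X Y := ModuleCat.ofHom (TensorProduct.lift (B.baseMul X Y))
  μ_natural_left {X Y} f Z := by
    apply ModuleCat.hom_ext
    apply TensorProduct.ext'
    intro v w
    apply Subtype.ext
    have h := congrArg (fun g => Bim.lin g (Bim.tmul _ _ v.1 w.1))
      (Functor.LaxMonoidal.μ_natural_left B.functor f Z)
    exact (congrArg (Bim.lin (Functor.LaxMonoidal.μ B.functor Y Z))
      (Bim.lin_tensorMap (B.functor.map f) (𝟙 _) v.1 w.1)).symm.trans h
  μ_natural_right {X Y} Z f := by
    apply ModuleCat.hom_ext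
    apply TensorProduct.ext'
    intro v w
    apply Subtype.ext
    have h := congrArg (fun g => Bim.lin g (Bim.tmul _ _ v.1 w.1))
      (Functor.LaxMonoidal.μ_natural_right B.functor Z f)
    exact (congrArg (Bim.lin (Functor.LaxMonoidal.μ B.functor Z Y))
      (Bim.lin_tensorMap (𝟙 _) (B.functor.map f) v.1 w.1)).symm.trans h
  associativity X Y Z := by
    apply ModuleCat.hom_ext
    apply TensorProduct.ext_threefold
    intro u v w
    apply Subtype.ext
    have h := congrArg (fun g => Bim.lin g (Bim.tmul _ _ (Bim.tmul _ _ u.1 v.1) w.1))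
      (Functor.LaxMonoidal.associativity B.functor X Y Z)
    have e1 := congrArg (fun t => Bim.lin (B.functor.map (α_ X Y Z).hom)
        (Bim.lin (Functor.LaxMonoidal.μ B.functor (X ⊗ Y) Z) t))
      (Bim.lin_tensorMap (Functor.LaxMonoidal.μ B.functor X Y) (𝟙 (B.functor.obj Z))
        (Bim.tmul _ _ u.1 v.1) w.1)
    have e2 := congrArg (fun t => Bim.lin (Functor.LaxMonoidal.μ B.functor X (Y ⊗ Z))
        (Bim.lin (Bim.tensorMap (𝟙 (B.functor.obj X)) (Functor.LaxMonoidal.μ B.functor Y Z)) t))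
      (Bim.lin_associator _ _ _ u.1 v.1 w.1)
    have e3 := congrArg (Bim.lin (Functor.LaxMonoidal.μ B.functor X (Y ⊗ Z)))
      (Bim.lin_tensorMap (𝟙 (B.functor.obj X)) (Functor.LaxMonoidal.μ B.functor Y Z) u.1
        (Bim.tmul _ _ v.1 w.1))
    exact e1.symm.trans (h.trans (e2.trans e3))
  left_unitality X := by
    apply ModuleCat.hom_ext
    apply TensorProduct.ext'
    intro c v
    apply Subtype.ext
    exact ((B.map_leftUnitor_smul X c v.1).trans rfl).symm
  right_unitality X := by
    apply ModuleCat.hom_ext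
    apply TensorProduct.ext'
    intro v c
    apply Subtype.ext
    exact ((B.map_rightUnitor_smul X c v.1).trans rfl).symm

/-- A based action is over a lax monoidal functor `G` if its induced functor is monoidally
naturally isomorphic to `G`. -/
def IsOver (G : CoRep k H ⥤ ModuleCat.{u} k) [G.LaxMonoidal] : Prop :=
  ∃ θ : G ≅ B.induced, NatTrans.IsMonoidal θ.hom

/-- Two based actions are equivalent if there is a monoidal natural isomorphism between them
that identifies the base spaces. -/
def Equivalent (B C : BasedAction k H A) : Prop :=
  ∃ e : B.functor ≅ C.functor, NatTrans.IsMonoidal e.hom ∧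
    ∀ X, (B.base X).map (Bim.lin (e.hom.app X)) = C.base X

theorem equivalent_equivalence : Equivalence (Equivalent (k := k) (H := H) (A := A)) where
  refl B := ⟨Iso.refl _, inferInstanceAs (NatTrans.IsMonoidal (𝟙 B.functor)), fun X => by
    ext v
    constructor
    · rintro ⟨w, hw, rfl⟩
      exact hw
    · intro hv
      exact ⟨v, hv, rfl⟩⟩
  symm := by
    rintro B C ⟨e, he, h⟩
    refine ⟨e.symm, inferInstanceAs (NatTrans.IsMonoidal e.inv), fun X => ?_⟩
    rw [← h X]
    ext v
    constructor
    · rintro ⟨_, ⟨w, hw, rfl⟩, rfl⟩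
      change Bim.lin (e.inv.app X) (Bim.lin (e.hom.app X) w) ∈ _
      rw [← Bim.lin_comp, e.hom_inv_id_app, Bim.lin_id]
      exact hw
    · intro hv
      refine ⟨_, ⟨v, hv, rfl⟩, ?_⟩
      change Bim.lin (e.inv.app X) (Bim.lin (e.hom.app X) v) = v
      rw [← Bim.lin_comp, e.hom_inv_id_app, Bim.lin_id]
  trans := by
    rintro B C D ⟨e, he, h⟩ ⟨f, hf, h'⟩
    refine ⟨e.trans f, inferInstanceAs (NatTrans.IsMonoidal (e.hom ≫ f.hom)), fun X => ?_⟩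
    rw [← h' X, ← h X, ← Submodule.map_comp]
    rfl

variable (k H A) in
/-- Equivalence of based actions over the weak fiber functor. -/
instance overSetoid : Setoid {B : BasedAction k H A // B.IsOver (weakFiber k H)} where
  r B C := B.1.Equivalent C.1
  iseqv := ⟨fun B => equivalent_equivalence.refl B.1, fun h => equivalent_equivalence.symm h,
    fun h h' => equivalent_equivalence.trans h h'⟩

end BasedAction

variable (k H A) in
/-- A left `H`-module algebra structure on `A`; `act h a` is `h · a`. -/
structure ModuleAlgebra where
  act : H →ₗ[k] A →ₗ[k] A
  one_act : ∀ a, act 1 a = a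
  mul_act : ∀ g h a, act (g * h) a = act g (act h a)
  act_mul : ∀ h a b, act h (a * b) = LinearMap.mul' k A
    (TensorProduct.map (act.flip a) (act.flip b) (Coalgebra.comul h))
  act_one : ∀ h, act h 1 = act (targetMap k h) 1

namespace ModuleAlgebra

/-- The condition that `H^t → A`, `z ↦ z · 1`, is injective. -/
def TargetInjective (M : ModuleAlgebra k H A) : Prop :=
  Set.InjOn (fun z : H => M.act z 1) (target k H)

/-- The right action `a · z = a (z · 1)` of the target algebra on `A`. -/
def rt (M : ModuleAlgebra k H A) (z : target k H) : A →ₗ[k] A :=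
  LinearMap.mulRight k (M.act z 1)

/-- The relative tensor product `A ⊗_{H^t} X`. -/
abbrev Ind (M : ModuleAlgebra k H A) (X : CoRep k H) : Type u := BalTensor M.rt X.lt

/-- The class of `a ⊗ x` in `A ⊗_{H^t} X`. -/
def tmul (M : ModuleAlgebra k H A) (X : CoRep k H) : A →ₗ[k] X →ₗ[k] M.Ind X :=
  BalTensor.mk M.rt X.lt

/-- The half braiding `x ↦ x₍₋₁₎ · a ⊗ x₍₀₎` in `A ⊗_{H^t} X`. -/
def halfBraid (M : ModuleAlgebra k H A) (X : CoRep k H) (a : A) : X →ₗ[k] M.Ind X :=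
  TensorProduct.lift (M.tmul X ∘ₗ M.act.flip a) ∘ₗ X.coact

/-- The based action `B` is induced by the module algebra structure `M`: the bimodule `F(X)` is
`A ⊗_{H^t} X` as a left `A`-module, with `base X` the image of `1 ⊗ X`, the identification
`X ≅ base X` being monoidal and natural in `X`, and the right action of `A` is
`x · a = (x₍₋₁₎ · a) x₍₀₎`. -/
def Induces (M : ModuleAlgebra k H A) (B : BasedAction k H A) : Prop :=
  ∃ θ : weakFiber k H ≅ B.induced, NatTrans.IsMonoidal θ.hom ∧
    ∀ X : CoRep k H, ∃ (j : X →ₗ[k] B.base X) (e : M.Ind X ≃ₗ[k] B.functor.obj X),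
      θ.hom.app X = ModuleCat.ofHom j ∧
      (∀ a x, e (M.tmul X a x) = (B.functor.obj X).left a (j x)) ∧
      (∀ a x, (B.functor.obj X).right a (j x) = e (M.halfBraid X a x))

end ModuleAlgebra

variable (k H) in
/-- A `J`-twisted algebra automorphism of `H`: an algebra isomorphism `α` that is the component
at the comodule `H` of a monoidal natural automorphism of the weak fiber functor. Since the
multiplication `m : H ⊗_{H^t} H → H` composed with the tensor structure
`J : H ⊗ H → H ⊗_{H^t} H` is the product of `H`, the condition
`m ∘ J ∘ (α ⊗ α) = α ∘ m ∘ J` says that `α` is multiplicative. -/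
def IsJTwisted (α : H ≃ₐ[k] H) : Prop :=
  ∃ η : weakFiber k H ≅ weakFiber k H, NatTrans.IsMonoidal η.hom ∧
    η.hom.app (CoRep.regular k H) = ModuleCat.ofHom (α.toLinearMap : H →ₗ[k] H)

/-- Two module algebra structures on `A` agree up to a `J`-twisted algebra isomorphism of `H` if
some `J`-twisted automorphism `α` of `H` carries the commutation relation
`h a = (h₍₁₎ · a) h₍₂₎` of the first one to that of the second one:
`(α(h)₍₁₎ · a) ⊗ α(h)₍₂₎ = (h₍₁₎ · a) ⊗ α(h₍₂₎)` in `A ⊗_{H^t} H`, with the second action on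
the left-hand side and the first action on the right-hand side. -/
def ModuleAlgebra.JTwisted (M N : ModuleAlgebra k H A) : Prop :=
  ∃ α : H ≃ₐ[k] H, IsJTwisted k H α ∧ ∀ (h : H) (a : A),
    N.halfBraid (CoRep.regular k H) a (α h) = TensorProduct.lift
      ((N.tmul (CoRep.regular k H)).compl₁₂ (M.act.flip a) α.toLinearMap)
      (Coalgebra.comul (R := k) h)

end Actions

end WeakHopf

end

noncomputable section

open CategoryTheory MonoidalCategory
open scoped TensorProduct

namespace WeakHopf

set_option linter.unusedSectionVars false

/-! A module algebra structure and a based action over `F_H` encode one and the same commutation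
rule. If `H` acts on `A`, put `F(X) = A ⊗_{H^t} X` with right action `(1 ⊗ x) a = x₍₋₁₎·a ⊗ x₍₀₎`.
The axioms on `h·(ab)`, on `h·1` and on `(gh)·a` become, in this order, associativity of the right
action, its unit law, and its compatibility with the tensor product of comodules. Bimodule maps out
of `F(X)` are determined on the elements `1 ⊗ x` (`Bim.Gen.hom_ext`), so the coherence of `F`
reduces to that of `coRep(H)`. The base spaces `1 ⊗ X` are faithful copies of `X` because `H^t` has
a separability idempotent (`mk_one_injective`).

Conversely, a trivialisation of a based action over `F_H` is a `Frame`: natural, monoidal maps `J :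
X → F(X)`. The antipode is anticomultiplicative (`comul_antipode`), so every comodule has a dual,
and applying `F` to a zigzag identity (`CoRep.zigzag`) expands each `u` in `F(X)` as a combination
`∑ a_j J(x_j)` with coordinates linear in `u` (`Frame.sum_coord`). This makes it possible to define
left `A`-linear maps on `F(X)`, in particular `Frame.retract : F(H) → A` with `J(h) ↦ ε_t(h)·1`, and
the action is `h·a = retract (J(h) a)`. Matrix coefficients are comodule maps `X → H`, so the
commutation rule passes from the regular comodule to every `X` (`Frame.right_lin`), and `a ⊗ x ↦ a
J(x)` is an isomorphism (`Frame.realizes_moduleAlgebra`). The rule on the regular comodule alone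
already determines the action (`Frame.eq_moduleAlgebra`).

What remains is the choice of frame. Two frames with the same base spaces differ by a monoidal
natural automorphism of `F_H`; its component `α` at `H` is an algebra automorphism, by naturality
for the multiplication of `H` and for the inclusion `H^t → H`. The relation defining `JTwisted` is
the commutation rule of the first structure read in the second frame composed with `α`
(`Realizes.halfBraid_eq_iff`). Hence `M` and `N` agree up to a twist exactly when `M` induces the
action built from `N` (`jTwisted_iff`), and the rest is formal. -/

theorem assoc_mul {k H : Type u} [Field k] [Ring H] [Algebra k H] (x y : (H ⊗[k] H) ⊗[k] H) :
    TensorProduct.assoc k H H H (x * y)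
      = TensorProduct.assoc k H H H x * TensorProduct.assoc k H H H y :=
  map_mul (Algebra.TensorProduct.assoc k k k H H H) x y

/-! ### Counital identities in a weak Hopf algebra. -/

section Identities

variable {k H : Type u} [Field k] [Ring H] [Algebra k H] [Coalgebra k H]

theorem sourceMap_eq_rid (h : H) : sourceMap k h = TensorProduct.rid k H
    ((Coalgebra.counit ∘ₗ LinearMap.mulLeft k h).lTensor H (Coalgebra.comul (R := k) (1 : H))) := by
  change TensorProduct.rid k H _ = _
  generalize Coalgebra.comul (R := k) (1 : H) = t
  induction t with
  | zero => simp
  | add a b ha hb => simp only [mul_add, map_add, ha, hb]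
  | tmul a b => simp

theorem targetMap_of_mem [WeakHopfAlgebra k H] {z : H} (hz : z ∈ target k H) :
    targetMap k z = z := by
  rw [targetMap_eq_slice, slice_right_comul hz, one_mul]

variable [WeakHopfAlgebra k H]

theorem targetMap_idem (h : H) : targetMap k (targetMap k h) = targetMap k h :=
  targetMap_of_mem (targetMap_mem h)

/-- Whenever `Δ(x) = Δ(1)(x ⊗ 1)`, applying the counit to the first leg gives `ε_t(x) = x`; the
product inherits this property from its factors. -/
theorem target_mul_mem {z w : H} (hz : z ∈ target k H) (hw : w ∈ target k H) :
    z * w ∈ target k H := by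
  refine ⟨z * w, ?_⟩
  rw [targetMap_eq_slice, slice_mul_right, rTensor_mul_right]
  have h : Coalgebra.comul (R := k) (z * w)
      = Coalgebra.comul (R := k) (1 : H) * ((z * w) ⊗ₜ[k] (1 : H)) := by
    rw [comul_mul_target hw, comul_target' hz, mul_assoc, Algebra.TensorProduct.tmul_mul_tmul,
      one_mul]
  rw [← h, slice_counit_comul]

/-- The map `ε_t` sees its argument only through the functionals `ε(a ·)`, and these do not
distinguish `g ε_t(h)` from `gh` by `counit_mul_target`. Left `H^t`-linearity of `ε_t` follows, and
so, later, does the multiplicativity of the reconstructed action. -/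
theorem targetMap_mul_targetMap (g h : H) :
    targetMap k (g * targetMap k h) = targetMap k (g * h) := by
  rw [targetMap_eq_slice (g * targetMap k h), targetMap_eq_slice (g * h)]
  exact congrArg (fun φ => slice φ (Coalgebra.comul (R := k) (1 : H)))
    (LinearMap.ext fun a => by simp [← mul_assoc, counit_mul_target])

theorem targetMap_target_mul {z : H} (hz : z ∈ target k H) (h : H) :
    targetMap k (z * h) = z * targetMap k h := by
  rw [← targetMap_mul_targetMap, targetMap_of_mem (target_mul_mem hz (targetMap_mem h))]

/-- Weak multiplicativity of the counit splits `ε(g h₍₁₎)` as `ε(g 1₍₁₎) ε(1₍₂₎ h₍₁₎)`. Since `1₍₂₎`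
may be taken in `H^t`, the factor `ε(1₍₂₎ h₍₁₎) h₍₂₎` collapses to `1₍₂₎ h`. -/
theorem slice_counit_mulLeft_comul (g h : H) :
    slice (Coalgebra.counit ∘ₗ LinearMap.mulLeft k g) (Coalgebra.comul (R := k) h)
      = slice (Coalgebra.counit ∘ₗ LinearMap.mulLeft k g) (Coalgebra.comul (R := k) (1 : H)) * h := by
  let T : H ⊗[k] H →ₗ[k] H ⊗[k] H →ₗ[k] H := TensorProduct.lift (LinearMap.mk₂ k
    (fun a b => (Coalgebra.counit (R := k) (g * a)) •
      slice (Coalgebra.counit ∘ₗ LinearMap.mul k H b))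
    (by intros; simp [mul_add, add_smul]) (by intros; simp [mul_smul])
    (by intros; ext; simp [add_smul]) (by intros; ext; simp [smul_smul, mul_left_comm, mul_comm]))
  have h1 : ∀ t : H ⊗[k] H, slice (Coalgebra.counit ∘ₗ LinearMap.mulLeft k g) t
      = T (Coalgebra.comul (R := k) 1) t := by
    intro t
    induction t with
    | zero => simp
    | add a b ha hb => simp only [map_add, ha, hb]
    | tmul a b =>
      have h2 := WeakHopfAlgebra.counit_mul_left (k := k) g 1 a
      rw [mul_one] at h2
      simp only [slice_tmul, LinearMap.comp_apply, LinearMap.mulLeft_apply, h2]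
      generalize Coalgebra.comul (R := k) (1 : H) = p
      induction p with
      | zero => simp
      | add a b ha hb => simp only [map_add, LinearMap.add_apply, add_smul, ha, hb]
      | tmul c d => simp [T, counitPair, mul_smul]
  rw [h1, ← lTensor_targetMap_comul_one]
  generalize Coalgebra.comul (R := k) (1 : H) = p
  induction p with
  | zero => simp
  | add a b ha hb => simp only [map_add, LinearMap.add_apply, add_mul, ha, hb]
  | tmul a b => simp [T, slice_left_comul (targetMap_mem b)]

/-- The identity `ε_t(h₍₁₎) ⊗ h₍₂₎ = ε_t(1₍₁₎) ⊗ 1₍₂₎ h`. -/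
theorem rTensor_targetMap_comul (h : H) :
    (targetMap k).rTensor H (Coalgebra.comul (R := k) h)
      = (targetMap k).rTensor H (Coalgebra.comul (R := k) (1 : H)) * ((1 : H) ⊗ₜ[k] h) := by
  -- For `p = Δ(1)` the operator below is `ε_t ⊗ id`. It tests the first leg only through
  -- functionals `ε(g ·)`, so it is enough to compare the two tensors under these, which is
  -- `slice_counit_mulLeft_comul`.
  have key : ∀ p t s : H ⊗[k] H, (∀ g, slice (Coalgebra.counit ∘ₗ LinearMap.mulLeft k g) t
      = slice (Coalgebra.counit ∘ₗ LinearMap.mulLeft k g) s) →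
      (slice (X := H) (k := k) Coalgebra.counit ∘ₗ LinearMap.mulLeft k p ∘ₗ
        (TensorProduct.mk k H H).flip 1).rTensor H t
      = (slice (X := H) (k := k) Coalgebra.counit ∘ₗ LinearMap.mulLeft k p ∘ₗ
        (TensorProduct.mk k H H).flip 1).rTensor H s := by
    intro p t s hts
    induction p with
    | zero => simp
    | add a b ha hb =>
      have e : ∀ a b : H ⊗[k] H, LinearMap.mulLeft k (a + b)
        = LinearMap.mulLeft k a + LinearMap.mulLeft k b := fun a b => by ext; simp [add_mul]
      simp only [e, LinearMap.add_comp, LinearMap.comp_add, LinearMap.rTensor_add,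
        LinearMap.add_apply, ha, hb]
    | tmul a b =>
      have e : ∀ t : H ⊗[k] H, (slice (X := H) (k := k) Coalgebra.counit ∘ₗ
          LinearMap.mulLeft k (a ⊗ₜ[k] b) ∘ₗ (TensorProduct.mk k H H).flip 1).rTensor H t
          = b ⊗ₜ[k] slice (Coalgebra.counit ∘ₗ LinearMap.mulLeft k a) t := by
        intro t
        induction t with
        | zero => simp
        | add a b ha hb => simp only [map_add, TensorProduct.tmul_add, ha, hb]
        | tmul c d => simp [TensorProduct.smul_tmul]
      rw [e, e, hts]
  have e : targetMap k (H := H) = slice (X := H) (k := k) Coalgebra.counit ∘ₗ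
      LinearMap.mulLeft k (Coalgebra.comul (R := k) 1) ∘ₗ (TensorProduct.mk k H H).flip 1 := by
    ext x
    rw [targetMap_eq_slice, slice_mul_right, rTensor_mul_right]
    rfl
  have h2 : (targetMap k).rTensor H (Coalgebra.comul (R := k) (1 : H)) * ((1 : H) ⊗ₜ[k] h)
      = (targetMap k).rTensor H (Coalgebra.comul (R := k) (1 : H) * ((1 : H) ⊗ₜ[k] h)) := by
    generalize Coalgebra.comul (R := k) (1 : H) = t
    induction t with
    | zero => simp
    | add a b ha hb => simp only [map_add, add_mul, ha, hb]
    | tmul c d => simp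
  rw [h2, e]
  apply key
  intro g
  rw [slice_counit_mulLeft_comul]
  generalize Coalgebra.comul (R := k) (1 : H) = t
  induction t with
  | zero => simp
  | add a b ha hb => simp only [map_add, add_mul, ha, hb]
  | tmul c d => simp

/-- Evaluating `(ε_t ⊗ id)Δ(z)` by `rTensor_targetMap_comul` and by `Δ(z) = (z ⊗ 1)Δ(1)` gives the
two sides. Thus `e = ε_t(1₍₁₎) ⊗ 1₍₂₎` is a Casimir element; with `ε_t(1₍₁₎) 1₍₂₎ = 1` it serves as
a separability idempotent of `H^t`. -/
theorem rTensor_targetMap_mul {z : H} (hz : z ∈ target k H) :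
    (z ⊗ₜ[k] (1 : H)) * (targetMap k).rTensor H (Coalgebra.comul (R := k) (1 : H))
      = (targetMap k).rTensor H (Coalgebra.comul (R := k) (1 : H)) * ((1 : H) ⊗ₜ[k] z) := by
  rw [← rTensor_targetMap_comul, comul_target hz]
  generalize Coalgebra.comul (R := k) (1 : H) = t
  induction t with
  | zero => simp
  | add a b ha hb => simp only [map_add, mul_add, ha, hb]
  | tmul c d => simp [targetMap_target_mul hz]

/-- The identity `h₍₁₎ ⊗ ε_t(h₍₂₎) = 1₍₁₎ h ⊗ 1₍₂₎`. -/
theorem lTensor_targetMap_comul_eq (h : H) :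
    (targetMap k).lTensor H (Coalgebra.comul (R := k) h)
      = Coalgebra.comul (R := k) (1 : H) * (h ⊗ₜ[k] (1 : H)) := by
  -- This writes `h₍₁₎ ⊗ ε_t(h₍₂₎)` as the counit applied to the middle leg of `(1 ⊗ Δ(1))(Δ(h) ⊗
  -- 1)`. That element is `(Δ ⊗ id)(Δ(1)(h ⊗ 1))`, so the counit undoes the outer comultiplication.
  have h1 := lTensor_targetMap_aux (k := k) (Coalgebra.comul (R := k) h)
    (Coalgebra.comul (R := k) (1 : H))
  have e2 : (TensorProduct.assoc k H H H).symm ((1 : H) ⊗ₜ[k] Coalgebra.comul (R := k) (1 : H))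
      * (Coalgebra.comul (R := k) h ⊗ₜ[k] (1 : H))
      = (Coalgebra.comul (R := k) (A := H)).rTensor H
        (Coalgebra.comul (R := k) (1 : H) * (h ⊗ₜ[k] (1 : H))) := by
    have e3 : (Coalgebra.comul (R := k) (A := H)).rTensor H
        (Coalgebra.comul (R := k) (1 : H) * (h ⊗ₜ[k] (1 : H)))
        = (Coalgebra.comul (R := k) (A := H)).rTensor H (Coalgebra.comul (R := k) (1 : H))
          * (Coalgebra.comul (R := k) h ⊗ₜ[k] (1 : H)) := by
      generalize Coalgebra.comul (R := k) (1 : H) = t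
      induction t with
      | zero => simp
      | add a b ha hb => simp only [map_add, add_mul, ha, hb]
      | tmul c d => simp [WeakHopfAlgebra.comul_mul]
    rw [e3, WeakHopfAlgebra.comul_one_right, mul_assoc, Algebra.TensorProduct.tmul_mul_tmul,
      comul_one_mul, one_mul]
  rw [e2, ← LinearMap.rTensor_comp_apply, LinearMap.comp_assoc,
    Coalgebra.lTensor_counit_comp_comul] at h1
  have e : (TensorProduct.rid k H).toLinearMap ∘ₗ (TensorProduct.mk k H k).flip 1
      = LinearMap.id := by ext; simp
  rw [e, LinearMap.rTensor_id, LinearMap.id_apply] at h1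
  rw [h1, LinearMap.lTensor, TensorProduct.map]
  congr 1
  congr 1
  ext a b
  simp [← targetMap_eq_slice]

/-- The identity `ε_s(h₍₁₎) ⊗ h₍₂₎ = 1₍₁₎ ⊗ h 1₍₂₎`. -/
theorem rTensor_sourceMap_comul (h : H) :
    (sourceMap k).rTensor H (Coalgebra.comul (R := k) h)
      = ((1 : H) ⊗ₜ[k] h) * Coalgebra.comul (R := k) (1 : H) := by
  have aux : ∀ p q : H ⊗[k] H,
      ((TensorProduct.lid k H).toLinearMap ∘ₗ (Coalgebra.counit (R := k)).rTensor H).lTensor H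
        (TensorProduct.assoc k H H H ((TensorProduct.assoc k H H H).symm ((1 : H) ⊗ₜ[k] q)
          * (p ⊗ₜ[k] (1 : H))))
      = ((TensorProduct.rid k H).toLinearMap ∘ₗ (Coalgebra.counit (R := k)).lTensor H ∘ₗ
          LinearMap.mulRight k p ∘ₗ TensorProduct.mk k H H 1).rTensor H q := by
    intro p q
    induction q with
    | zero => simp
    | add a b ha hb => simp only [TensorProduct.tmul_add, add_mul, map_add, ha, hb]
    | tmul a b =>
      induction p with
      | zero => simp
      | add c d hc hd =>
        simp only [TensorProduct.add_tmul, mul_add, map_add, hc, hd, LinearMap.rTensor_tmul,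
          LinearMap.comp_apply, LinearMap.mulRight_apply]
      | tmul c d => simp [TensorProduct.smul_tmul']
  have h1 := aux (Coalgebra.comul (R := k) (1 : H)) (Coalgebra.comul (R := k) h)
  have e : ((1 : H) ⊗ₜ[k] Coalgebra.comul (R := k) h)
      = ((1 : H) ⊗ₜ[k] Coalgebra.comul (R := k) h) * ((1 : H) ⊗ₜ[k] Coalgebra.comul (R := k) 1) := by
    rw [Algebra.TensorProduct.tmul_mul_tmul, comul_mul_one, one_mul]
  have e' : TensorProduct.assoc k H H H
      ((TensorProduct.assoc k H H H).symm ((1 : H) ⊗ₜ[k] Coalgebra.comul (R := k) h)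
        * (Coalgebra.comul (R := k) (1 : H) ⊗ₜ[k] (1 : H)))
      = (Coalgebra.comul (R := k) (A := H)).lTensor H
        (((1 : H) ⊗ₜ[k] h) * Coalgebra.comul (R := k) (1 : H)) := by
    have h2 := congrArg (TensorProduct.assoc k H H H) (WeakHopfAlgebra.comul_one_right (k := k) (H := H))
    rw [Coalgebra.coassoc_apply, assoc_mul, LinearEquiv.apply_symm_apply] at h2
    rw [assoc_mul, LinearEquiv.apply_symm_apply, e, mul_assoc, ← h2]
    generalize Coalgebra.comul (R := k) (1 : H) = t
    induction t with
    | zero => simp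
    | add a b ha hb => simp only [map_add, mul_add, ha, hb]
    | tmul c d => simp [WeakHopfAlgebra.comul_mul]
  rw [e', ← LinearMap.lTensor_comp_apply, LinearMap.comp_assoc,
    Coalgebra.rTensor_counit_comp_comul] at h1
  have e3 : (TensorProduct.lid k H).toLinearMap ∘ₗ (TensorProduct.mk k k H) 1
      = LinearMap.id := by ext; simp
  rw [e3, LinearMap.lTensor_id, LinearMap.id_apply] at h1
  exact h1.symm

/-- Comultiplying `1₍₁₎ ε(h 1₍₂₎)` involves `(Δ ⊗ id)Δ(1)`, which factors as `(1 ⊗ Δ(1))(Δ(1) ⊗ 1)`;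
the functional `ε(h ·)` meets only the first factor. -/
theorem comul_sourceMap (h : H) : Coalgebra.comul (R := k) (sourceMap k h)
    = ((1 : H) ⊗ₜ[k] sourceMap k h) * Coalgebra.comul (R := k) (1 : H) := by
  have h1 : ∀ t : H ⊗[k] H, Coalgebra.comul (R := k)
      (TensorProduct.rid k H ((Coalgebra.counit (R := k)).lTensor H ((1 ⊗ₜ[k] h) * t)))
      = TensorProduct.rid k _ ((Coalgebra.counit (R := k)).lTensor (H ⊗[k] H)
        ((1 ⊗ₜ[k] h) * (Coalgebra.comul (R := k)).rTensor H t)) := by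
    intro t
    induction t with
    | zero => simp
    | add a b ha hb => simp only [map_add, mul_add, ha, hb]
    | tmul c d => simp
  have h2 : ∀ p q : H ⊗[k] H, TensorProduct.rid k _ ((Coalgebra.counit (R := k)).lTensor (H ⊗[k] H)
        ((1 ⊗ₜ[k] h) * ((TensorProduct.assoc k H H H).symm ((1 : H) ⊗ₜ[k] q)
          * (p ⊗ₜ[k] (1 : H)))))
      = ((1 : H) ⊗ₜ[k] TensorProduct.rid k H
          ((Coalgebra.counit (R := k)).lTensor H ((1 ⊗ₜ[k] h) * q))) * p := by
    intro p q
    induction q with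
    | zero => simp
    | add a b ha hb => simp only [TensorProduct.tmul_add, add_mul, mul_add, map_add, ha, hb]
    | tmul a b =>
      induction p with
      | zero => simp
      | add c d hc hd => simp only [TensorProduct.add_tmul, mul_add, map_add, hc, hd]
      | tmul c d => simp
  exact (h1 _).trans ((congrArg _ (congrArg _ (congrArg _ WeakHopfAlgebra.comul_one_right))).trans
    (h2 _ _))

/-- The element `z ⊗ 1` commutes with `Δ(1)`, both products being `Δ(z)`, and `ε_s(h)` is obtained
from `Δ(1)` by applying a functional to the second leg. -/
theorem target_mul_sourceMap {z : H} (hz : z ∈ target k H) (h : H) :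
    z * sourceMap k h = sourceMap k h * z := by
  have e := (comul_target hz).symm.trans (comul_target' hz)
  have h1 : ∀ t : H ⊗[k] H, z * TensorProduct.rid k H
      ((Coalgebra.counit ∘ₗ LinearMap.mulLeft k h).lTensor H t) = TensorProduct.rid k H
      ((Coalgebra.counit ∘ₗ LinearMap.mulLeft k h).lTensor H ((z ⊗ₜ[k] (1 : H)) * t)) := by
    intro t
    induction t with
    | zero => simp
    | add a b ha hb => simp only [map_add, mul_add, ha, hb]
    | tmul c d => simp
  have h2 : ∀ t : H ⊗[k] H, TensorProduct.rid k H
      ((Coalgebra.counit ∘ₗ LinearMap.mulLeft k h).lTensor H t) * z = TensorProduct.rid k H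
      ((Coalgebra.counit ∘ₗ LinearMap.mulLeft k h).lTensor H (t * (z ⊗ₜ[k] (1 : H)))) := by
    intro t
    induction t with
    | zero => simp
    | add a b ha hb => simp only [map_add, add_mul, ha, hb]
    | tmul c d => simp
  rw [sourceMap_eq_rid, h1, h2, e]

theorem counit_sourceMap_mul (h g : H) :
    Coalgebra.counit (R := k) (sourceMap k h * g) = Coalgebra.counit (R := k) (h * g) := by
  have h1 := WeakHopfAlgebra.counit_mul_right (k := k) h 1 g
  rw [mul_one] at h1
  rw [h1, sourceMap_eq_rid]
  generalize Coalgebra.comul (R := k) (1 : H) = t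
  induction t with
  | zero => simp
  | add a b ha hb => simp only [map_add, add_mul, ha, hb]
  | tmul c d => simp [counitPair]

/-- Expanding both counital maps over two copies `a ⊗ b`, `c ⊗ d` of `Δ(1)`, the coefficient of `a ⊗
d` is `ε(c h₍₂₎) ε(h₍₁₎ b)` on one side and `ε(c h₍₁₎) ε(h₍₂₎ b)` on the other. The two forms of
weak multiplicativity make both equal to `ε(c h b)`. -/
theorem map_sourceMap_targetMap_comul (h : H) :
    TensorProduct.map (sourceMap k) (targetMap k) (Coalgebra.comul (R := k) h)
      = TensorProduct.map (sourceMap k) (targetMap k)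
        (TensorProduct.comm k H H (Coalgebra.comul (R := k) h)) := by
  have aux : ∀ p q : H ⊗[k] H, 
      TensorProduct.map ((TensorProduct.rid k H).toLinearMap ∘ₗ
          (Coalgebra.counit (R := k)).lTensor H ∘ₗ LinearMap.mulRight k p ∘ₗ TensorProduct.mk k H H 1)
        (slice (X := H) (k := k) Coalgebra.counit ∘ₗ LinearMap.mulLeft k q ∘ₗ
          (TensorProduct.mk k H H).flip 1) (Coalgebra.comul (R := k) h)
      = TensorProduct.map ((TensorProduct.rid k H).toLinearMap ∘ₗ
          (Coalgebra.counit (R := k)).lTensor H ∘ₗ LinearMap.mulRight k p ∘ₗ TensorProduct.mk k H H 1)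
        (slice (X := H) (k := k) Coalgebra.counit ∘ₗ LinearMap.mulLeft k q ∘ₗ
          (TensorProduct.mk k H H).flip 1)
        (TensorProduct.comm k H H (Coalgebra.comul (R := k) h)) := by
    intro p q
    have er : ∀ a b : H ⊗[k] H, LinearMap.mulRight k (a + b)
        = LinearMap.mulRight k a + LinearMap.mulRight k b := fun a b => by ext; simp [mul_add]
    have el : ∀ a b : H ⊗[k] H, LinearMap.mulLeft k (a + b)
        = LinearMap.mulLeft k a + LinearMap.mulLeft k b := fun a b => by ext; simp [add_mul]
    induction p with
    | zero => simp
    | add a b ha hb =>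
      simp only [er, LinearMap.add_comp, LinearMap.comp_add, TensorProduct.map_add_left,
        LinearMap.add_apply, ha, hb]
    | tmul a b =>
      induction q with
      | zero => simp
      | add c d hc hd =>
        simp only [el, LinearMap.add_comp, LinearMap.comp_add, TensorProduct.map_add_right,
          LinearMap.add_apply, hc, hd]
      | tmul c d =>
        have e1 : ∀ t : H ⊗[k] H, TensorProduct.map ((TensorProduct.rid k H).toLinearMap ∘ₗ
          (Coalgebra.counit (R := k)).lTensor H ∘ₗ LinearMap.mulRight k (a ⊗ₜ[k] b) ∘ₗ
            TensorProduct.mk k H H 1)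
          (slice (X := H) (k := k) Coalgebra.counit ∘ₗ LinearMap.mulLeft k (c ⊗ₜ[k] d) ∘ₗ
          (TensorProduct.mk k H H).flip 1) t
          = counitPair k H c b (TensorProduct.comm k H H t) • (a ⊗ₜ[k] d) := by
          intro t
          induction t with
          | zero => simp
          | add x y hx hy => simp only [map_add, add_smul, hx, hy]
          | tmul x y => simp [counitPair, TensorProduct.smul_tmul', TensorProduct.tmul_smul, smul_smul]
        rw [e1, e1, ← WeakHopfAlgebra.counit_mul_right]
        have e2 : ∀ t : H ⊗[k] H,
            TensorProduct.comm k H H (TensorProduct.comm k H H t) = t := fun t => by simp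
        rw [e2, ← WeakHopfAlgebra.counit_mul_left]
  have e : targetMap k (H := H) = slice (X := H) (k := k) Coalgebra.counit ∘ₗ
      LinearMap.mulLeft k (Coalgebra.comul (R := k) 1) ∘ₗ (TensorProduct.mk k H H).flip 1 := by
    ext x
    rw [targetMap_eq_slice, slice_mul_right, rTensor_mul_right]
    rfl
  rw [e]
  exact aux _ _

end Identities

/-! ### Anticomultiplicativity of the antipode, by convolution. -/

section Antipode

variable {k H : Type u} [Field k] [Ring H] [Algebra k H] [Coalgebra k H]

open WithConv

/-- `f ↦ f ⊗ 1` from `Hom(H, H)` to the convolution algebra `Hom(H, H ⊗ H)`. -/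
def convLeft (f : H →ₗ[k] H) : WithConv (H →ₗ[k] H ⊗[k] H) :=
  toConv ((Algebra.TensorProduct.includeLeft : H →ₐ[k] H ⊗[k] H).toLinearMap ∘ₗ f)

/-- `f ↦ 1 ⊗ f` from `Hom(H, H)` to the convolution algebra `Hom(H, H ⊗ H)`. -/
def convRight (f : H →ₗ[k] H) : WithConv (H →ₗ[k] H ⊗[k] H) :=
  toConv ((Algebra.TensorProduct.includeRight : H →ₐ[k] H ⊗[k] H).toLinearMap ∘ₗ f)

theorem convLeft_mul (f g : H →ₗ[k] H) :
    convLeft f * convLeft g = convLeft (toConv f * toConv g).ofConv :=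
  ofConv_injective (LinearMap.algHom_comp_convMul_distrib _ (toConv f) (toConv g)).symm

theorem convRight_mul (f g : H →ₗ[k] H) :
    convRight f * convRight g = convRight (toConv f * toConv g).ofConv :=
  ofConv_injective (LinearMap.algHom_comp_convMul_distrib _ (toConv f) (toConv g)).symm

theorem convLeft_mul_convRight (f g : H →ₗ[k] H) :
    convLeft f * convRight g = toConv (TensorProduct.map f g ∘ₗ Coalgebra.comul) := by
  apply ofConv_injective
  ext h
  change LinearMap.mul' k _ (TensorProduct.map _ _ (Coalgebra.comul (R := k) h))
    = TensorProduct.map f g (Coalgebra.comul (R := k) h)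
  generalize Coalgebra.comul (R := k) h = t
  induction t with
  | zero => simp
  | add a b ha hb => simp only [map_add, ha, hb]
  | tmul a b => simp [convLeft, convRight]

theorem convRight_mul_convLeft (f g : H →ₗ[k] H) :
    convRight g * convLeft f = toConv (TensorProduct.map f g ∘ₗ
      (TensorProduct.comm k H H).toLinearMap ∘ₗ Coalgebra.comul) := by
  apply ofConv_injective
  ext h
  change LinearMap.mul' k _ (TensorProduct.map _ _ (Coalgebra.comul (R := k) h))
    = TensorProduct.map f g (TensorProduct.comm k H H (Coalgebra.comul (R := k) h))
  generalize Coalgebra.comul (R := k) h = t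
  induction t with
  | zero => simp
  | add a b ha hb => simp only [map_add, ha, hb]
  | tmul a b => simp [convLeft, convRight]

theorem mulLeft_comp_conv_mul (t : H ⊗[k] H) (f : H →ₗ[k] H ⊗[k] H)
    (g : WithConv (H →ₗ[k] H ⊗[k] H)) :
    toConv (LinearMap.mulLeft k t ∘ₗ f) * g
      = toConv (LinearMap.mulLeft k t ∘ₗ (toConv f * g).ofConv) := by
  apply ofConv_injective
  ext h
  change LinearMap.mul' k _ (TensorProduct.map _ _ (Coalgebra.comul (R := k) h))
    = t * LinearMap.mul' k _ (TensorProduct.map _ _ (Coalgebra.comul (R := k) h))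
  generalize Coalgebra.comul (R := k) h = t
  induction t with
  | zero => simp
  | add a b ha hb => simp only [map_add, mul_add, ha, hb]
  | tmul a b => simp [mul_assoc]

theorem conv_mul_mulRight_comp (t : H ⊗[k] H) (f : WithConv (H →ₗ[k] H ⊗[k] H))
    (g : H →ₗ[k] H ⊗[k] H) :
    f * toConv (LinearMap.mulRight k t ∘ₗ g)
      = toConv (LinearMap.mulRight k t ∘ₗ (f * toConv g).ofConv) := by
  apply ofConv_injective
  ext h
  change LinearMap.mul' k _ (TensorProduct.map _ _ (Coalgebra.comul (R := k) h))
    = LinearMap.mul' k _ (TensorProduct.map _ _ (Coalgebra.comul (R := k) h)) * t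
  generalize Coalgebra.comul (R := k) h = t
  induction t with
  | zero => simp
  | add a b ha hb => simp only [map_add, add_mul, ha, hb]
  | tmul a b => simp [mul_assoc]

variable [WeakHopfAlgebra k H]

theorem comul_comp_conv_mul (f g : H →ₗ[k] H) :
    toConv (Coalgebra.comul (R := k) ∘ₗ f) * toConv (Coalgebra.comul (R := k) ∘ₗ g)
      = toConv (Coalgebra.comul (R := k) ∘ₗ (toConv f * toConv g).ofConv) := by
  apply ofConv_injective
  ext h
  change LinearMap.mul' k _ (TensorProduct.map _ _ (Coalgebra.comul (R := k) h))
    = Coalgebra.comul (LinearMap.mul' k _ (TensorProduct.map _ _ (Coalgebra.comul (R := k) h)))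
  generalize Coalgebra.comul (R := k) h = t
  induction t with
  | zero => simp
  | add a b ha hb => simp only [map_add, ha, hb]
  | tmul a b => simp [WeakHopfAlgebra.comul_mul]

variable (k H) in
/-- The antipode. -/
abbrev S : H →ₗ[k] H := WeakHopfAlgebra.antipode

theorem conv_id_S : toConv LinearMap.id * toConv (S k H) = toConv (targetMap k) :=
  ofConv_injective (LinearMap.ext fun h => WeakHopfAlgebra.mul_antipode_right h)

theorem conv_S_id : toConv (S k H) * toConv LinearMap.id = toConv (sourceMap k) :=
  ofConv_injective (LinearMap.ext fun h => WeakHopfAlgebra.mul_antipode_left h)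

theorem conv_S_target : toConv (S k H) * toConv (targetMap k) = toConv (S k H) := by
  rw [← conv_id_S]
  exact ofConv_injective (LinearMap.ext fun h => WeakHopfAlgebra.antipode_mul_antipode h)

theorem conv_S_targetMap (h : H) : LinearMap.mul' k H (TensorProduct.map (S k H) (targetMap k)
    (Coalgebra.comul (R := k) h)) = S k H h :=
  LinearMap.congr_fun (congrArg ofConv (conv_S_target (k := k) (H := H))) h

/-- Write `S(h) = S(h₍₁₎) ε_t(h₍₂₎)`; the counit absorbs `ε_t`, leaving `ε(z ε_s(h))`. Now `z`
commutes with `ε_s(h)`, and the counit absorbs `ε_s` in turn. This is what turns the left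
`H^t`-action on a dual comodule into the transpose of the right action on the comodule. -/
theorem counit_target_mul_antipode {z : H} (hz : z ∈ target k H) (h : H) :
    Coalgebra.counit (R := k) (z * S k H h) = Coalgebra.counit (R := k) (h * z) := by
  have e : ∀ t : H ⊗[k] H, Coalgebra.counit (R := k)
      (z * LinearMap.mul' k H (TensorProduct.map (S k H) (targetMap k) t))
      = Coalgebra.counit (R := k) (z * LinearMap.mul' k H ((S k H).rTensor H t)) := by
    intro t
    induction t with
    | zero => simp
    | add a b ha hb => simp only [map_add, mul_add, ha, hb]
    | tmul a b => simp [← mul_assoc, counit_mul_target]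
  rw [← conv_S_targetMap, e, WeakHopfAlgebra.mul_antipode_left, target_mul_sourceMap hz,
    counit_sourceMap_mul]

theorem counit_antipode (h : H) :
    Coalgebra.counit (R := k) (S k H h) = Coalgebra.counit (R := k) h := by
  simpa using counit_target_mul_antipode (k := k) one_mem_target h

/-- In Sweedler notation, `h₍₁₎ S(h₍₃₎) ⊗ ε_t(h₍₂₎)` becomes `1₍₁₎ h₍₁₎ S(h₍₂₎) ⊗ 1₍₂₎`, that is
`Δ(1)(ε_t(h) ⊗ 1)`. Besides its use for the antipode, the identity expresses the colinearity of
evaluation on a dual comodule. -/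
theorem convLeft_id_mul_convRight_targetMap :
    convLeft LinearMap.id * convRight (targetMap k (H := H)) * convLeft (S k H)
      = toConv (Coalgebra.comul ∘ₗ targetMap k) := by
  have h1 : convLeft LinearMap.id * convRight (targetMap k (H := H))
      = toConv (LinearMap.mulLeft k (Coalgebra.comul (R := k) 1) ∘ₗ
        (convLeft (k := k) (H := H) LinearMap.id).ofConv) := by
    rw [convLeft_mul_convRight]
    exact ofConv_injective (LinearMap.ext lTensor_targetMap_comul_eq)
  rw [h1, mulLeft_comp_conv_mul, toConv_ofConv, convLeft_mul, conv_id_S]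
  exact ofConv_injective (LinearMap.ext fun h => (comul_target' (targetMap_mem h)).symm)

theorem convRight_S_mul_convLeft_sourceMap :
    convRight (S k H) * (convLeft (sourceMap k (H := H)) * convRight LinearMap.id)
      = toConv (Coalgebra.comul ∘ₗ sourceMap k) := by
  have h1 : convLeft (sourceMap k (H := H)) * convRight LinearMap.id
      = toConv (LinearMap.mulRight k (Coalgebra.comul (R := k) 1) ∘ₗ
        (convRight (k := k) (H := H) LinearMap.id).ofConv) := by
    rw [convLeft_mul_convRight]
    exact ofConv_injective (LinearMap.ext rTensor_sourceMap_comul)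
  rw [h1, conv_mul_mulRight_comp, toConv_ofConv, convRight_mul, conv_S_id]
  exact ofConv_injective (LinearMap.ext fun h => (comul_sourceMap h).symm)

/-- In the convolution algebra `Hom(H, H ⊗ H)` both sides are generalised inverses of `Δ = (id ⊗ 1)
* (1 ⊗ id)` with the same one-sided products with `Δ`, namely `Δ ∘ ε_s` and `Δ ∘ ε_t`; this forces
them to agree. The only commutation needed in simplifying the outcome is that of `ε_s ⊗ 1` with `1 ⊗
ε_t`, supplied by `map_sourceMap_targetMap_comul`. -/
theorem toConv_comul_comp_antipode :
    toConv (Coalgebra.comul ∘ₗ S k H) = convRight (S k H) * convLeft (S k H) := by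
  have hab : toConv (Coalgebra.comul (R := k) (A := H) ∘ₗ LinearMap.id)
      = convLeft LinearMap.id * convRight LinearMap.id := by
    rw [convLeft_mul_convRight, TensorProduct.map_id]
    rfl
  have hS : toConv (S k H) * toConv LinearMap.id * toConv (S k H) = toConv (S k H) := by
    rw [mul_assoc, conv_id_S, conv_S_target]
  have hst : convLeft (sourceMap k (H := H)) * convRight (targetMap k)
      = convRight (targetMap k) * convLeft (sourceMap k) := by
    rw [convLeft_mul_convRight, convRight_mul_convLeft]
    exact ofConv_injective (LinearMap.ext map_sourceMap_targetMap_comul)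
  have ht : convRight LinearMap.id * convRight (S k H) = convRight (targetMap k) := by
    rw [convRight_mul, conv_id_S]
  have hs : convLeft (S k H) * convLeft LinearMap.id = convLeft (sourceMap k) := by
    rw [convLeft_mul, conv_S_id]
  have hl : convLeft (S k H) * convLeft LinearMap.id * convLeft (S k H) = convLeft (S k H) := by
    rw [convLeft_mul, convLeft_mul, toConv_ofConv, hS]
  have hr : convRight (S k H) * convRight LinearMap.id * convRight (S k H) = convRight (S k H) := by
    rw [convRight_mul, convRight_mul, toConv_ofConv, hS]
  calc toConv (Coalgebra.comul ∘ₗ S k H)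
      = toConv (Coalgebra.comul ∘ₗ S k H) * toConv (Coalgebra.comul ∘ₗ LinearMap.id)
        * toConv (Coalgebra.comul ∘ₗ S k H) := by
        rw [comul_comp_conv_mul, comul_comp_conv_mul, toConv_ofConv, hS]
    _ = toConv (Coalgebra.comul ∘ₗ sourceMap k) * toConv (Coalgebra.comul ∘ₗ S k H) := by
        rw [comul_comp_conv_mul, conv_S_id]
    _ = convRight (S k H) * convLeft (S k H) * toConv (Coalgebra.comul ∘ₗ LinearMap.id)
        * toConv (Coalgebra.comul ∘ₗ S k H) := by
        rw [← convRight_S_mul_convLeft_sourceMap, hab, ← hs]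
        simp only [mul_assoc]
    _ = convRight (S k H) * convLeft (S k H) * toConv (Coalgebra.comul ∘ₗ targetMap k) := by
        rw [mul_assoc, comul_comp_conv_mul, conv_id_S]
    _ = convRight (S k H) * (convLeft (sourceMap k) * convRight (targetMap k))
        * convLeft (S k H) := by
        rw [← convLeft_id_mul_convRight_targetMap, ← hs]
        simp only [mul_assoc]
    _ = (convRight (S k H) * convRight LinearMap.id * convRight (S k H))
        * (convLeft (S k H) * convLeft LinearMap.id * convLeft (S k H)) := by
        rw [hst, ← ht, ← hs]
        simp only [mul_assoc]
    _ = _ := by rw [hl, hr]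

/-- The antipode is anticomultiplicative. -/
theorem comul_antipode (h : H) : Coalgebra.comul (R := k) (S k H h)
    = TensorProduct.map (S k H) (S k H)
      (TensorProduct.comm k H H (Coalgebra.comul (R := k) h)) := by
  have e := toConv_comul_comp_antipode (k := k) (H := H)
  rw [convRight_mul_convLeft] at e
  exact LinearMap.congr_fun (toConv_injective e) h

end Antipode

/-! ### Dual comodules, evaluation, coevaluation and a zigzag identity. -/

section Dual

variable {k H : Type u} [Field k] [Ring H] [Algebra k H] [Coalgebra k H]

namespace CoRep

/-- A finite basis of a comodule. -/
def basis (X : CoRep k H) : Module.Basis (Fin (Module.finrank k X)) k X := Module.finBasis k X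

/-- The comodule map `x ↦ x₍₋₁₎ f(x₍₀₎)` to the regular comodule, as a linear map. -/
def coeffLin (X : CoRep k H) (f : X →ₗ[k] k) : X →ₗ[k] H :=
  (TensorProduct.rid k H).toLinearMap ∘ₗ f.lTensor H ∘ₗ X.coact

/-- Coassociativity of the coaction says that matrix coefficients are colinear into the regular
comodule. Naturality along these maps will reduce statements on all comodules to the regular one. -/
theorem comul_coeffLin (X : CoRep k H) (f : X →ₗ[k] k) (x : X) :
    Coalgebra.comul (R := k) (X.coeffLin f x) = (X.coeffLin f).lTensor H (X.coact x) := by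
  rw [coeffLin, LinearMap.lTensor_comp_apply, LinearMap.lTensor_comp_apply, ← X.coassoc]
  simp only [LinearMap.comp_apply]
  generalize X.coact x = t
  induction t with
  | zero => simp
  | add a b ha hb => simp only [map_add, ha, hb]
  | tmul h x =>
    simp only [LinearMap.rTensor_tmul, LinearMap.lTensor_tmul]
    simp only [LinearEquiv.coe_coe, TensorProduct.rid_tmul, map_smul]
    generalize Coalgebra.comul (R := k) h = s
    induction s with
    | zero => simp
    | add a b ha hb => simp only [map_add, TensorProduct.add_tmul, smul_add, ha, hb]
    | tmul a b => simp

/-- The matrix coefficients of a comodule with respect to `basis`. -/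
def coeff (X : CoRep k H) (i j : Fin (Module.finrank k X)) : H :=
  X.coeffLin (X.basis.coord j) (X.basis i)

theorem coact_eq_sum (X : CoRep k H) (x : X) :
    X.coact x = ∑ j, X.coeffLin (X.basis.coord j) x ⊗ₜ[k] X.basis j := by
  simp only [coeffLin, LinearMap.comp_apply]
  generalize X.coact x = t
  induction t with
  | zero => simp
  | add a b ha hb => simp only [map_add, TensorProduct.add_tmul, Finset.sum_add_distrib, ← ha, ← hb]
  | tmul h x =>
    conv_lhs => rw [← X.basis.sum_repr x, TensorProduct.tmul_sum]
    refine Finset.sum_congr rfl fun i _ => ?_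
    rw [← TensorProduct.smul_tmul]
    simp

theorem coact_basis (X : CoRep k H) (i) :
    X.coact (X.basis i) = ∑ j, X.coeff i j ⊗ₜ[k] X.basis j :=
  X.coact_eq_sum _

theorem comul_coeff (X : CoRep k H) (i j) :
    Coalgebra.comul (R := k) (X.coeff i j) = ∑ l, X.coeff i l ⊗ₜ[k] X.coeff l j := by
  rw [coeff, comul_coeffLin, coact_basis]
  simp [coeff]

theorem counit_coeff (X : CoRep k H) (i j) :
    Coalgebra.counit (R := k) (X.coeff i j) = if i = j then 1 else 0 := by
  have h : ∀ t : H ⊗[k] X, Coalgebra.counit (R := k)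
      (TensorProduct.rid k H ((X.basis.coord j).lTensor H t))
      = X.basis.coord j (slice Coalgebra.counit t) := by
    intro t
    induction t with
    | zero => simp
    | add a b ha hb => simp only [map_add, ha, hb]
    | tmul a b => simp [mul_comm]
  refine (h _).trans ?_
  rw [slice_counit_coact]
  simp [Module.Basis.coord_apply, Finsupp.single_apply]

theorem right_basis (X : CoRep k H) (z : H) (i) :
    X.right z (X.basis i) = ∑ l, Coalgebra.counit (R := k) (X.coeff i l * z) • X.basis l := by
  rw [right_apply, coact_basis]
  simp

variable [WeakHopfAlgebra k H]

/-- The dual comodule, with coaction given by the antipode. -/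
def dual (X : CoRep k H) : CoRep k H where
  carrier := Fin (Module.finrank k X) → k
  coact := (Pi.basisFun k _).constr k fun j => ∑ i, S k H (X.coeff i j) ⊗ₜ[k] Pi.basisFun k _ i
  coassoc := LinearMap.congr_fun (f := (TensorProduct.assoc k H H _).toLinearMap ∘ₗ
      (Coalgebra.comul (R := k) (A := H)).rTensor _ ∘ₗ (Pi.basisFun k _).constr k fun j =>
        ∑ i, S k H (X.coeff i j) ⊗ₜ[k] Pi.basisFun k _ i)
    (g := (((Pi.basisFun k _).constr k fun j =>
        ∑ i, S k H (X.coeff i j) ⊗ₜ[k] Pi.basisFun k _ i).lTensor H) ∘ₗ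
        (Pi.basisFun k _).constr k fun j => ∑ i, S k H (X.coeff i j) ⊗ₜ[k] Pi.basisFun k _ i)
    ((Pi.basisFun k _).ext fun j => by
      simp only [LinearMap.comp_apply, Module.Basis.constr_basis, map_sum, LinearMap.rTensor_tmul,
        LinearMap.lTensor_tmul, comul_antipode, comul_coeff, TensorProduct.comm_tmul,
        TensorProduct.map_tmul, TensorProduct.sum_tmul, TensorProduct.tmul_sum]
      rw [Finset.sum_comm]
      simp)
  counit_coact := LinearMap.congr_fun (f := (Coalgebra.counit (R := k) (A := H)).rTensor _ ∘ₗ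
      (Pi.basisFun k _).constr k fun j => ∑ i, S k H (X.coeff i j) ⊗ₜ[k] Pi.basisFun k _ i)
    (g := TensorProduct.mk k k _ 1)
    ((Pi.basisFun k _).ext fun j => by
      simp only [LinearMap.comp_apply, Module.Basis.constr_basis, map_sum, LinearMap.rTensor_tmul,
        counit_antipode, counit_coeff, TensorProduct.ite_tmul]
      simp)

/-- The basis of the dual comodule that is dual to `basis`. -/
def dualBasis (X : CoRep k H) : Module.Basis (Fin (Module.finrank k X)) k X.dual :=
  show Module.Basis _ k X.dual from
    (Pi.basisFun k (Fin (Module.finrank k X)) : Module.Basis _ k (Fin (Module.finrank k X) → k))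

theorem coact_dualBasis (X : CoRep k H) (j) :
    X.dual.coact (X.dualBasis j) = ∑ i, S k H (X.coeff i j) ⊗ₜ[k] X.dualBasis i :=
  (Pi.basisFun k (Fin (Module.finrank k X))).constr_basis k
    (fun j => ∑ i, S k H (X.coeff i j) ⊗ₜ[k] Pi.basisFun k _ i) j

theorem left_dualBasis (X : CoRep k H) {z : H} (hz : z ∈ target k H) (j) :
    X.dual.left z (X.dualBasis j)
      = ∑ l, Coalgebra.counit (R := k) (X.coeff l j * z) • X.dualBasis l := by
  rw [left_apply, coact_dualBasis]
  simp [counit_target_mul_antipode hz]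

/-- Apply `ε_t` to `ε(h₍₁₎ z) h₍₂₎ = h z` with `h` a matrix coefficient. This computes one side of
the balancing condition of evaluation; the next lemma brings the other side to the same value. -/
theorem sum_targetMap_coeff_right (X : CoRep k H) {z : H} (hz : z ∈ target k H) (i j) :
    ∑ l, Coalgebra.counit (R := k) (X.coeff i l * z) • targetMap k (X.coeff l j)
      = targetMap k (X.coeff i j * z) := by
  have h := slice_right_comul hz (X.coeff i j)
  rw [comul_coeff] at h
  rw [← h]
  simp

/-- By `rTensor_targetMap_comul`, multiplying `h` on the right by `z` only multiplies the second leg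
of `ε_t(h₍₁₎) ⊗ h₍₂₎` by `z`; the counit on that leg finishes. -/
theorem sum_targetMap_coeff_left (X : CoRep k H) (z : H) (i j) :
    ∑ l, Coalgebra.counit (R := k) (X.coeff l j * z) • targetMap k (X.coeff i l)
      = targetMap k (X.coeff i j * z) := by
  have h : (targetMap k).rTensor H (Coalgebra.comul (R := k) (X.coeff i j * z))
      = (targetMap k).rTensor H (Coalgebra.comul (R := k) (X.coeff i j)) * ((1 : H) ⊗ₜ[k] z) := by
    rw [rTensor_targetMap_comul, rTensor_targetMap_comul (X.coeff i j), mul_assoc,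
      Algebra.TensorProduct.tmul_mul_tmul, one_mul]
  have h2 := congrArg (fun t => TensorProduct.rid k H ((Coalgebra.counit (R := k)).lTensor H t)) h
  have e : ∀ t : H ⊗[k] H, TensorProduct.rid k H ((Coalgebra.counit (R := k)).lTensor H
      ((targetMap k).rTensor H t)) = targetMap k (TensorProduct.rid k H
        ((Coalgebra.counit (R := k)).lTensor H t)) := by
    intro t
    induction t with
    | zero => simp
    | add a b ha hb => simp only [map_add, ha, hb]
    | tmul a b => simp
  simp only [e, Coalgebra.lTensor_counit_comul, TensorProduct.rid_tmul, one_smul, comul_coeff] at h2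
  rw [h2]
  simp [Finset.sum_mul]

/-- This is `convLeft_id_mul_convRight_targetMap` on matrix coefficients. The right-hand side is the
diagonal coaction on `X ⊗ X^*` followed by evaluation. -/
theorem comul_targetMap_coeff (X : CoRep k H) (i j) :
    Coalgebra.comul (R := k) (targetMap k (X.coeff i j))
      = ∑ r, ∑ l, (X.coeff i l * S k H (X.coeff r j)) ⊗ₜ[k] targetMap k (X.coeff l r) := by
  have h := LinearMap.congr_fun (congrArg WithConv.ofConv
    (convLeft_id_mul_convRight_targetMap (k := k) (H := H))) (X.coeff i j)
  refine h.symm.trans ?_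
  rw [convLeft_mul_convRight]
  change LinearMap.mul' k _ (TensorProduct.map _ _ (Coalgebra.comul (R := k) (X.coeff i j))) = _
  simp [comul_coeff, convLeft, Finset.sum_mul]

/-- The canonical element of `X^* ⊗ X`. -/
def coevOne (X : CoRep k H) : tensor X.dual X := ∑ j, tmul X.dual X (X.dualBasis j) (X.basis j)

/-- The antipode axiom turns the coaction of the canonical element into a sum with coefficients
`ε_s(c_il)`. Acting by `1₍₂₎` on the dual basis produces `1₍₁₎ ε(c_il 1₍₂₎)`, the same coefficients.
It follows that `z ↦ z · coevOne` is colinear on `H^t`. -/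
theorem coact_coevOne (X : CoRep k H) : (tensor X.dual X).coact X.coevOne
    = ((tensor X.dual X).left.flip X.coevOne).lTensor H (Coalgebra.comul (R := k) 1) := by
  have h1 : (tensor X.dual X).coact X.coevOne
      = ∑ i, ∑ l, sourceMap k (X.coeff i l) ⊗ₜ[k] tmul X.dual X (X.dualBasis i) (X.basis l) := by
    have h2 : ∀ i l, sourceMap k (X.coeff i l) = ∑ j, S k H (X.coeff i j) * X.coeff j l := by
      intro i l
      rw [← WeakHopfAlgebra.mul_antipode_left, comul_coeff]
      simp
    simp only [coevOne, map_sum, coact_tmul, coact_dualBasis, coact_basis, LinearMap.sum_apply,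
      pair_tmul, h2, TensorProduct.sum_tmul]
    rw [Finset.sum_comm]
    conv_lhs => enter [2, l]; rw [Finset.sum_comm]
    exact Finset.sum_comm
  -- The formula for the left action on the dual basis holds for elements of `H^t` only, hence the
  -- inserted `ε_t`; it is harmless at `p = Δ(1)`.
  have h3 : ∀ p : H ⊗[k] H, ((tensor X.dual X).left.flip X.coevOne).lTensor H
      ((targetMap k).lTensor H p) = ∑ i, ∑ l, TensorProduct.rid k H
        ((Coalgebra.counit ∘ₗ LinearMap.mulLeft k (X.coeff i l)).lTensor H
          ((targetMap k).lTensor H p)) ⊗ₜ[k] tmul X.dual X (X.dualBasis i) (X.basis l) := by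
    intro p
    induction p with
    | zero => simp
    | add a b ha hb =>
      simp only [map_add, TensorProduct.add_tmul, Finset.sum_add_distrib, ha, hb]
    | tmul a b =>
      simp only [LinearMap.lTensor_tmul, LinearMap.flip_apply, coevOne, map_sum,
        left_tmul _ _ (targetMap_mem b), left_dualBasis X (targetMap_mem b), LinearMap.sum_apply,
        map_smul, LinearMap.smul_apply, TensorProduct.rid_tmul, LinearMap.comp_apply,
        LinearMap.mulLeft_apply, TensorProduct.tmul_sum, TensorProduct.smul_tmul]
      rw [Finset.sum_comm]
  rw [h1, ← lTensor_targetMap_comul_one, h3, lTensor_targetMap_comul_one]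
  simp only [← sourceMap_eq_rid]

theorem rTensor_mul_comul_one {V : Type u} [AddCommGroup V] [Module k V] (f : H →ₗ[k] V) {z : H}
    (hz : z ∈ target k H) :
    (LinearMap.mul k H z).rTensor V (f.lTensor H (Coalgebra.comul (R := k) 1))
      = f.lTensor H (Coalgebra.comul (R := k) z) := by
  rw [comul_target hz, ← rTensor_mul_left]
  exact LinearMap.congr_fun ((LinearMap.rTensor_comp_lTensor _ _ _).trans
    (LinearMap.lTensor_comp_rTensor _ _ _).symm) _

variable [FiniteDimensional k H]

/-- The evaluation pairing as a bilinear map. -/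
def evBilin (X : CoRep k H) : X →ₗ[k] X.dual →ₗ[k] unit k H :=
  X.basis.constr k fun i => X.dualBasis.constr k fun j => toTarget k H (X.coeff i j)

theorem evBilin_basis (X : CoRep k H) (i j) :
    X.evBilin (X.basis i) (X.dualBasis j) = toTarget k H (X.coeff i j) := by
  rw [evBilin, Module.Basis.constr_basis]
  exact Module.Basis.constr_basis _ k _ j

theorem evBilin_bal (X : CoRep k H) {z : H} (hz : z ∈ target k H) (x : X) (y : X.dual) :
    X.evBilin (X.right z x) y = X.evBilin x (X.dual.left z y) := by
  suffices X.evBilin ∘ₗ X.right z = X.evBilin.compl₂ (X.dual.left z) from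
    LinearMap.congr_fun₂ this x y
  refine X.basis.ext fun i => X.dualBasis.ext fun j => ?_
  apply (target k H).injective_subtype
  simp only [LinearMap.comp_apply, LinearMap.compl₂_apply, right_basis, left_dualBasis X hz,
    map_sum, map_smul, LinearMap.sum_apply, LinearMap.smul_apply, evBilin_basis]
  exact ((map_sum (target k H).subtype _ _).trans (sum_targetMap_coeff_right X hz i j)).trans
    ((map_sum (target k H).subtype _ _).trans (sum_targetMap_coeff_left X z i j)).symm

theorem coact_evBilin (X : CoRep k H) (f : tensor X X.dual →ₗ[k] unit k H)
    (hf : ∀ x y, f (tmul X X.dual x y) = X.evBilin x y) (x : X) (y : X.dual) :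
    (unit k H).coact (X.evBilin x y)
      = f.lTensor H (pair (tmul X X.dual) (X.coact x) (X.dual.coact y)) := by
  suffices h : X.evBilin.compr₂ (unit k H).coact
      = ((pair (tmul X X.dual)).compl₁₂ X.coact X.dual.coact).compr₂ (f.lTensor H) from
    LinearMap.congr_fun₂ h x y
  refine X.basis.ext fun i => X.dualBasis.ext fun j => ?_
  apply lTensor_subtype_injective _ (target k H).injective_subtype
  simp only [LinearMap.compr₂_apply, LinearMap.compl₁₂_apply, evBilin_basis, coact_basis,
    coact_dualBasis, map_sum, LinearMap.sum_apply, pair_tmul, LinearMap.lTensor_tmul, hf]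
  refine (lTensor_subtype_unitCoact _).trans ((comul_targetMap_coeff X i j).trans ?_)
  refine Eq.trans ?_ (map_sum ((target k H).subtype.lTensor H) (fun r => ∑ l,
    (X.coeff i l * S k H (X.coeff r j)) ⊗ₜ[k] toTarget k H (X.coeff l r)) Finset.univ).symm
  exact Finset.sum_congr rfl fun r _ => (map_sum ((target k H).subtype.lTensor H) (fun l =>
    (X.coeff i l * S k H (X.coeff r j)) ⊗ₜ[k] toTarget k H (X.coeff l r)) Finset.univ).symm

/-- The evaluation `X ⊗ X^* → 1`. -/
def ev (X : CoRep k H) : tensor X X.dual ⟶ unit k H :=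
  homOfTensor (BalTensor.lift X.evBilin (fun z x y => evBilin_bal X z.2 x y)) (fun x y =>
    (congrArg (unit k H).coact (BalTensor.lift_mk _ _ x y)).trans
      (coact_evBilin X _ (BalTensor.lift_mk X.evBilin (fun z x y => evBilin_bal X z.2 x y)) x y))

theorem lin_ev (X : CoRep k H) (x : X) (y : X.dual) :
    lin (ev X) (tmul X X.dual x y) = X.evBilin x y :=
  BalTensor.lift_mk X.evBilin (fun z x y => evBilin_bal X z.2 x y) x y

/-- On a basis vector this is `ε_t(x₍₋₁₎) · x₍₀₎ = x`, and it is the whole content of the zigzag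
identity. -/
theorem sum_left_evBilin (X : CoRep k H) (x : X) :
    ∑ j, leftB X (X.evBilin x (X.dualBasis j)) (X.basis j) = x := by
  suffices h : ∑ j, (leftB X).flip (X.basis j) ∘ₗ X.evBilin.flip (X.dualBasis j)
      = LinearMap.id by
    simpa using LinearMap.congr_fun h x
  refine X.basis.ext fun i => ?_
  simp only [LinearMap.sum_apply, LinearMap.comp_apply, LinearMap.flip_apply, evBilin_basis]
  have h := left_targetMap_coact X (X.basis i)
  rw [coact_basis] at h
  simp only [map_sum, TensorProduct.lift.tmul] at h
  exact h

theorem lTensor_leftB_flip (X : CoRep k H) (x : X) (z : target k H) :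
    ((leftB X).flip x).lTensor H (unitCoact k H z)
      = (X.left.flip x).lTensor H (Coalgebra.comul (R := k) (z : H)) :=
  (LinearMap.lTensor_comp_apply H (X.left.flip x) (target k H).subtype _).trans
    (congrArg ((X.left.flip x).lTensor H) (lTensor_subtype_unitCoact z))

/-- The coevaluation `1 → X^* ⊗ X`. -/
def coev (X : CoRep k H) : unit k H ⟶ tensor X.dual X :=
  ofLin ((leftB (tensor X.dual X)).flip X.coevOne) (fun z => by
    refine (coact_left (tensor X.dual X) (Subtype.prop (show target k H from z))
      X.coevOne).trans ?_
    rw [coact_coevOne]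
    exact (rTensor_mul_comul_one _ (Subtype.prop (show target k H from z))).trans
      (lTensor_leftB_flip (tensor X.dual X) X.coevOne z).symm)

theorem lin_coev_one (X : CoRep k H) : lin (coev X) (unitOne k H) = X.coevOne :=
  leftB_one (tensor X.dual X) X.coevOne

/-- The zigzag identity for `X`. -/
theorem zigzag (X : CoRep k H) : (rightUnitor X).inv ≫ tensorMap (𝟙 X) (coev X) ≫
    (associator X X.dual X).inv ≫ tensorMap (ev X) (𝟙 X) ≫ (leftUnitor X).hom = 𝟙 X := by
  apply hom_ext
  intro x
  change lin (leftUnitor X).hom (lin (tensorMap (ev X) (𝟙 X)) ((assocEquiv X X.dual X).symm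
    (lin (tensorMap (𝟙 X) (coev X)) (tmul X (unit k H) x (unitOne k H))))) = x
  have h : ∀ y w, (assocEquiv X X.dual X).symm (tmul X (tensor X.dual X) x (tmul X.dual X y w))
      = tmul (tensor X X.dual) X (tmul X X.dual x y) w := fun y w => by
    rw [← assocEquiv_tmul, LinearEquiv.symm_apply_apply]
  rw [lin_tensorMap, lin_coev_one, coevOne]
  simp only [map_sum, h, lin_tensorMap, lin_leftUnitor, lin_id, lin_ev]
  exact sum_left_evBilin X x

end CoRep

end Dual

/-! ### Generating families of bimodules. -/

section Generation

variable {k A : Type u} [Field k] [Ring A] [Algebra k A]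

namespace Bim

/-- A family of elements generates a bimodule as a left module. -/
def Gen {α : Type u} {M : Bim k A} (p : α → M) : Prop :=
  Submodule.span k {y | ∃ a x, M.left a (p x) = y} = ⊤

variable {α β γ : Type u} {M N P : Bim k A} {p : α → M} {q : β → N}

theorem Gen.ind (hp : Gen p) {C : M → Prop} (y : M) (zero : C 0)
    (add : ∀ x y, C x → C y → C (x + y)) (left : ∀ a x, C (M.left a (p x))) : C y := by
  have hy : y ∈ Submodule.span k {y | ∃ a x, M.left a (p x) = y} := by
    rw [show Submodule.span k {y | ∃ a x, M.left a (p x) = y} = ⊤ from hp]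
    trivial
  -- The property is not assumed stable under scalars, so the span induction carries an arbitrary
  -- scalar, which is absorbed into the coefficient `a`.
  have h : ∀ c : k, C (c • y) := by
    induction hy using Submodule.span_induction with
    | mem y h =>
      obtain ⟨a, x, rfl⟩ := h
      intro c
      rw [← LinearMap.smul_apply, ← map_smul]
      exact left _ _
    | zero => simpa using zero
    | add x y _ _ hx hy => exact fun c => by rw [smul_add]; exact add _ _ (hx c) (hy c)
    | smul c y _ h => exact fun c' => by rw [smul_smul]; exact h _
  simpa using h 1

theorem Gen.hom_ext (hp : Gen p) {f g : M ⟶ N} (h : ∀ x, lin f (p x) = lin g (p x)) : f = g :=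
  Bim.hom_ext fun y => hp.ind (C := fun y => lin f y = lin g y) y (by simp)
    (fun x y hx hy => by simp only [map_add, hx, hy])
    (fun a x => by simp only [lin_left, h])

theorem Gen.of_forall (h : ∀ y, y ∈ Submodule.span k {y | ∃ a x, M.left a (p x) = y}) : Gen p :=
  (Submodule.eq_top_iff').2 h

/-- In `m ⊗ b q` the coefficient `b` crosses to `m b ⊗ q`, and `m b` is expanded again over the
first family, so all coefficients end up on the far left. -/
theorem Gen.tensor (hp : Gen p) (hq : Gen q) :
    Gen (M := Bim.tensor M N) fun z : α × β => tmul M N (p z.1) (q z.2) := by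
  apply Gen.of_forall
  intro y
  refine BalTensor.ind (p := fun y => y ∈ Submodule.span k
    {y | ∃ a, ∃ z : α × β, (Bim.tensor M N).left a (tmul M N (p z.1) (q z.2)) = y}) y
    (Submodule.zero_mem _) (fun x y => Submodule.add_mem _) fun m n => ?_
  change tmul M N m n ∈ _
  refine hq.ind (C := fun n => tmul M N m n ∈ _) n ?_ ?_ ?_
  · rw [map_zero]; exact Submodule.zero_mem _
  · intro x y hx hy; rw [map_add]; exact Submodule.add_mem _ hx hy
  · intro b y
    rw [← tmul_bal]
    refine hp.ind (C := fun m => tmul M N m (q y) ∈ _) _ ?_ ?_ ?_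
    · rw [map_zero]; exact Submodule.zero_mem _
    · intro x y hx hy; rw [map_add]; exact Submodule.add_mem _ hx hy
    · intro a x
      rw [← tensor_left_tmul]
      exact Submodule.subset_span ⟨a, (x, y), rfl⟩

theorem Gen.unit : Gen (M := Bim.unit k A) fun _ : PUnit => (1 : A) := by
  apply Gen.of_forall
  intro y
  exact Submodule.subset_span ⟨y, PUnit.unit, mul_one (M := A) y⟩

end Bim

end Generation

/-! ### Embedding a comodule in its induced module. -/

section Separability

variable {k H A : Type u} [Field k] [Ring H] [Algebra k H] [Coalgebra k H] [WeakHopfAlgebra k H]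
  [Ring A] [Algebra k A]

/-- If `H^t` embeds in `A`, then every comodule `X` embeds in `A ⊗_{H^t} X`, because `H^t` is
separable. -/
theorem mk_one_injective (ι : H →ₗ[k] A) (hinj : Set.InjOn ι (target k H))
    (hmul : ∀ z ∈ target k H, ∀ w ∈ target k H, ι (z * w) = ι z * ι w)
    (X : CoRep k H) :
    Function.Injective (BalTensor.mk (fun z : target k H => LinearMap.mulRight k (ι z)) X.lt 1) := by
  -- A `k`-linear retraction of `A` onto `H^t`; it is not `H^t`-linear, and the next definitions
  -- average it with the separability element.
  obtain ⟨ρ, hρ⟩ := LinearMap.exists_leftInverse_of_injective (ι ∘ₗ (target k H).subtype)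
    (LinearMap.ker_eq_bot.2 fun z w h => Subtype.ext (hinj z.2 w.2 h))
  have hρ' : ∀ z ∈ target k H, (ρ (ι z) : H) = z := fun z hz =>
    congrArg Subtype.val (LinearMap.congr_fun hρ ⟨z, hz⟩)
  let Θ : A →ₗ[k] H ⊗[k] H →ₗ[k] H := LinearMap.mk₂ k
    (fun a t => LinearMap.mul' k H (((target k H).subtype ∘ₗ ρ ∘ₗ LinearMap.mulLeft k a ∘ₗ ι).rTensor
      H t)) (by
      intro a b t
      induction t with
      | zero => simp
      | add x y hx hy => simp only [map_add, hx, hy]; abel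
      | tmul x y => simp [add_mul]) (by
      intro c a t
      induction t with
      | zero => simp
      | add x y hx hy => simp only [map_add, hx, hy, smul_add]
      | tmul x y => simp) (by intros; simp) (by intros; simp)
  let e := (targetMap k).rTensor H (Coalgebra.comul (R := k) (1 : H))
  -- The averaged retraction `a ↦ ρ(a ι(e₁)) e₂` is right `H^t`-linear, since `(z ⊗ 1) e = e (1 ⊗
  -- z)`.
  have hbal : ∀ z ∈ target k H, ∀ a, Θ (a * ι z) e = Θ a e * z := by
    intro z hz a
    have h2 : ∀ t : H ⊗[k] H, Θ a (t * ((1 : H) ⊗ₜ[k] z)) = Θ a t * z := by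
      intro t
      induction t with
      | zero => simp
      | add x y hx hy => simp only [add_mul, map_add, hx, hy]
      | tmul x y => simp [Θ, mul_assoc]
    have h3 : ∀ t : H ⊗[k] H, Θ (a * ι z) ((targetMap k).rTensor H t)
        = Θ a ((z ⊗ₜ[k] (1 : H)) * (targetMap k).rTensor H t) := by
      intro t
      induction t with
      | zero => simp
      | add x y hx hy => simp only [mul_add, map_add, hx, hy]
      | tmul x y => simp [Θ, hmul z hz _ (targetMap_mem x)]
    rw [← h2, ← rTensor_targetMap_mul hz, ← h3]
  have hone : Θ 1 e = 1 := by
    have h2 : ∀ t : H ⊗[k] H, Θ 1 ((targetMap k).rTensor H t)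
        = LinearMap.mul' k H ((targetMap k).rTensor H t) := by
      intro t
      induction t with
      | zero => simp
      | add x y hx hy => simp only [map_add, hx, hy]
      | tmul x y => simp [Θ, hρ' _ (targetMap_mem x)]
    rw [h2, targetMap_mul_comul]
  -- A left inverse of `x ↦ 1 ⊗ x`: send `a ⊗ x` to the averaged retraction of `a` acting on `x`. It
  -- is well defined by `hbal`, and `hone` gives the inverse property.
  let G : BalTensor (fun z : target k H => LinearMap.mulRight k (ι z)) X.lt →ₗ[k] X :=
    BalTensor.lift (X.left ∘ₗ Θ.flip e) (by
      intro z a x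
      change X.left (Θ (a * ι z) e) x = X.left (Θ a e) (X.left z x)
      rw [hbal z z.2, X.left_left _ z.2])
  intro x y hxy
  have h : ∀ x, G (BalTensor.mk _ X.lt 1 x) = x := fun x => by
    rw [BalTensor.lift_mk]
    change X.left (Θ 1 e) x = x
    rw [hone, X.left_one]
  rw [← h x, ← h y, hxy]

end Separability

/-! ### The bimodule `A ⊗_{H^t} X` of a module algebra. -/

section Induction

variable {k H A : Type u} [Field k] [Ring H] [Algebra k H] [Coalgebra k H] [WeakHopfAlgebra k H]
  [FiniteDimensional k H] [Ring A] [Algebra k A]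

namespace ModuleAlgebra

variable (M : ModuleAlgebra k H A)

/-- As `Δ(z) = Δ(1)(z ⊗ 1)`, the module algebra axiom gives `(1₍₁₎·(z·b))(1₍₂₎·a)`, which is
`1·((z·b)a)`. With `b = 1`, the action of `H^t` is left multiplication by `z·1`, and hence `z ↦ z·1`
is multiplicative on `H^t`. -/
theorem act_target_mul {z : H} (hz : z ∈ target k H) (b a : A) :
    M.act z (b * a) = M.act z b * a := by
  rw [M.act_mul, comul_target' hz]
  have h : ∀ t : H ⊗[k] H, LinearMap.mul' k A (TensorProduct.map (M.act.flip b) (M.act.flip a)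
      (t * (z ⊗ₜ[k] (1 : H)))) = LinearMap.mul' k A
        (TensorProduct.map (M.act.flip (M.act z b)) (M.act.flip a) t) := by
    intro t
    induction t with
    | zero => simp
    | add x y hx hy => simp only [add_mul, map_add, hx, hy]
    | tmul x y => simp [M.mul_act]
  rw [h, ← M.act_mul, M.one_act]

theorem act_target {z : H} (hz : z ∈ target k H) (a : A) : M.act z a = M.act z 1 * a := by
  rw [← M.act_target_mul hz, one_mul]

theorem tmul_bal (X : CoRep k H) {z : H} (hz : z ∈ target k H) (a : A) (x : X) :
    M.tmul X (a * M.act z 1) x = M.tmul X a (X.left z x) :=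
  BalTensor.mk_bal (r := M.rt) (l := X.lt) ⟨z, hz⟩ a x

theorem ind_ext {X : CoRep k H} {P : Type u} [AddCommGroup P] [Module k P]
    {f g : M.Ind X →ₗ[k] P} (h : ∀ a x, f (M.tmul X a x) = g (M.tmul X a x)) : f = g :=
  BalTensor.hom_ext h

theorem indLeft_bal (X : CoRep k H) (a : A) (z : target k H) (b : A) (x : X) :
    (M.tmul X ∘ₗ LinearMap.mulLeft k a) (M.rt z b) x
      = (M.tmul X ∘ₗ LinearMap.mulLeft k a) b (X.lt z x) := by
  change M.tmul X (a * (b * M.act z 1)) x = M.tmul X (a * b) (X.left z x)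
  rw [← mul_assoc, M.tmul_bal X z.2]

/-- The left action of `A` on `A ⊗_{H^t} X`. -/
def indLeft (X : CoRep k H) : A →ₗ[k] M.Ind X →ₗ[k] M.Ind X :=
  LinearMap.mk₂ k (fun a => BalTensor.lift (M.tmul X ∘ₗ LinearMap.mulLeft k a) (M.indLeft_bal X a))
    (fun a b => LinearMap.congr_fun (f := BalTensor.lift _ (M.indLeft_bal X (a + b)))
      (g := BalTensor.lift _ (M.indLeft_bal X a) + BalTensor.lift _ (M.indLeft_bal X b))
      (BalTensor.hom_ext fun c x => by
        simp only [BalTensor.lift_mk, LinearMap.add_apply, LinearMap.comp_apply,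
          LinearMap.mulLeft_apply, add_mul, map_add]))
    (fun c a => LinearMap.congr_fun (f := BalTensor.lift _ (M.indLeft_bal X (c • a)))
      (g := c • BalTensor.lift _ (M.indLeft_bal X a))
      (BalTensor.hom_ext fun b x => by
        simp only [BalTensor.lift_mk, LinearMap.smul_apply, LinearMap.comp_apply,
          LinearMap.mulLeft_apply, smul_mul_assoc, map_smul]))
    (fun a => map_add _) (fun c a => map_smul _ c)

@[simp] theorem indLeft_tmul (X : CoRep k H) (a b : A) (x : X) :
    M.indLeft X a (M.tmul X b x) = M.tmul X (a * b) x :=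
  BalTensor.lift_mk _ (M.indLeft_bal X a) b x

theorem indLeft_mul (X : CoRep k H) (a b : A) (u : M.Ind X) :
    M.indLeft X (a * b) u = M.indLeft X a (M.indLeft X b u) :=
  LinearMap.congr_fun (f := M.indLeft X (a * b)) (g := M.indLeft X a ∘ₗ M.indLeft X b)
    (M.ind_ext (by simp [mul_assoc])) u

theorem indLeft_one (X : CoRep k H) (u : M.Ind X) : M.indLeft X 1 u = u :=
  LinearMap.congr_fun (f := M.indLeft X 1) (g := LinearMap.id) (M.ind_ext (by simp)) u

/-- The coaction is left `H^t`-linear in its first leg, and `z·(h·b) = (z·1)(h·b)`. This is exactly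
what makes the right action descend to the balanced tensor product. -/
theorem halfBraid_left (X : CoRep k H) {z : H} (hz : z ∈ target k H) (b : A) (x : X) :
    M.halfBraid X b (X.left z x) = M.indLeft X (M.act z 1) (M.halfBraid X b x) := by
  simp only [halfBraid, LinearMap.comp_apply, X.coact_left hz]
  generalize X.coact x = t
  induction t with
  | zero => simp
  | add x y hx hy => simp only [map_add, hx, hy]
  | tmul h x => simp [M.mul_act, ← M.act_target hz]

/-- Replace `h·1` by `ε_t(h)·1`, move it across the tensor sign, and use `ε_t(x₍₋₁₎)·x₍₀₎ = x`. This
is the unit law of the right action. -/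
theorem halfBraid_one (X : CoRep k H) (x : X) : M.halfBraid X 1 x = M.tmul X 1 x := by
  have h : ∀ t : H ⊗[k] X, TensorProduct.lift (M.tmul X ∘ₗ M.act.flip 1) t
      = M.tmul X 1 (TensorProduct.lift (X.left ∘ₗ targetMap k) t) := by
    intro t
    induction t with
    | zero => simp
    | add x y hx hy => simp only [map_add, hx, hy]
    | tmul h x =>
      simp only [TensorProduct.lift.tmul, LinearMap.comp_apply, LinearMap.flip_apply]
      rw [M.act_one, ← M.tmul_bal X (targetMap_mem h), one_mul]
  rw [halfBraid, LinearMap.comp_apply, h, X.left_targetMap_coact]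

/-- Here `x₍₋₁₎·(z·1) = (x₍₋₁₎ z)·1`, and `x₍₋₁₎ z ⊗ x₍₀₎` is the coaction of `x·z`. So on `1 ⊗ x`
the right action of `H^t` through `A` is the one that the comodule carries, which allows tensor
products over `A` and over `H^t` to be compared. -/
theorem halfBraid_act_one (X : CoRep k H) {z : H} (hz : z ∈ target k H) (x : X) :
    M.halfBraid X (M.act z 1) x = M.tmul X 1 (X.right z x) := by
  rw [← halfBraid_one]
  simp only [halfBraid, LinearMap.comp_apply, X.coact_right hz]
  generalize X.coact x = t
  induction t with
  | zero => simp
  | add x y hx hy => simp only [map_add, hx, hy]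
  | tmul h x => simp [M.mul_act]

theorem halfBraid_add (X : CoRep k H) (a b : A) (x : X) :
    M.halfBraid X (a + b) x = M.halfBraid X a x + M.halfBraid X b x := by
  simp only [halfBraid, LinearMap.comp_apply]
  generalize X.coact x = t
  induction t with
  | zero => simp
  | add x y hx hy => rw [map_add _ x y, map_add _ x y, map_add _ x y, hx, hy]; abel
  | tmul h x => simp

theorem halfBraid_smul (X : CoRep k H) (c : k) (a : A) (x : X) :
    M.halfBraid X (c • a) x = c • M.halfBraid X a x := by
  simp only [halfBraid, LinearMap.comp_apply]
  generalize X.coact x = t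
  induction t with
  | zero => simp
  | add x y hx hy => simp only [map_add, smul_add, hx, hy]
  | tmul h x => simp

theorem indRight_bal (X : CoRep k H) (b : A) (z : target k H) (a : A) (x : X) :
    (M.indLeft X).compl₂ (M.halfBraid X b) (M.rt z a) x
      = (M.indLeft X).compl₂ (M.halfBraid X b) a (X.lt z x) := by
  simp only [LinearMap.compl₂_apply, CoRep.lt, M.halfBraid_left X z.2, rt,
      LinearMap.mulRight_apply, indLeft_mul]

/-- The right action of `A` on `A ⊗_{H^t} X`. -/
def indRight (X : CoRep k H) : A →ₗ[k] M.Ind X →ₗ[k] M.Ind X :=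
  LinearMap.mk₂ k
    (fun b => BalTensor.lift ((M.indLeft X).compl₂ (M.halfBraid X b)) (M.indRight_bal X b))
    (fun a b => LinearMap.congr_fun (f := BalTensor.lift _ (M.indRight_bal X (a + b)))
      (g := BalTensor.lift _ (M.indRight_bal X a) + BalTensor.lift _ (M.indRight_bal X b))
      (BalTensor.hom_ext fun c x => by
        simp only [BalTensor.lift_mk, LinearMap.add_apply, LinearMap.compl₂_apply,
          halfBraid_add, map_add]))
    (fun c a => LinearMap.congr_fun (f := BalTensor.lift _ (M.indRight_bal X (c • a)))
      (g := c • BalTensor.lift _ (M.indRight_bal X a))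
      (BalTensor.hom_ext fun b x => by
        simp only [BalTensor.lift_mk, LinearMap.smul_apply, LinearMap.compl₂_apply,
          halfBraid_smul, map_smul]))
    (fun a => map_add _) (fun c a => map_smul _ c)

@[simp] theorem indRight_tmul (X : CoRep k H) (b a : A) (x : X) :
    M.indRight X b (M.tmul X a x) = M.indLeft X a (M.halfBraid X b x) :=
  BalTensor.lift_mk _ (M.indRight_bal X b) a x

theorem indRight_indLeft (X : CoRep k H) (a b : A) (u : M.Ind X) :
    M.indLeft X a (M.indRight X b u) = M.indRight X b (M.indLeft X a u) :=
  LinearMap.congr_fun (f := M.indLeft X a ∘ₗ M.indRight X b)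
    (g := M.indRight X b ∘ₗ M.indLeft X a) (M.ind_ext (by simp [indLeft_mul])) u

/-- Acting by `b` and then by `c` uses the coaction twice. Coassociativity turns this into one
coaction followed by `Δ`, and `(h₍₁₎·b)(h₍₂₎·c) = h·(bc)` recombines the coefficients. -/
theorem indRight_halfBraid (X : CoRep k H) (b c : A) (x : X) :
    M.indRight X c (M.halfBraid X b x) = M.halfBraid X (b * c) x := by
  let Λ : H ⊗[k] (H ⊗[k] X) →ₗ[k] M.Ind X := TensorProduct.lift
    ((M.indLeft X ∘ₗ M.act.flip b).compl₂ (TensorProduct.lift (M.tmul X ∘ₗ M.act.flip c)))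
  have h1 : ∀ t : H ⊗[k] X, M.indRight X c (TensorProduct.lift (M.tmul X ∘ₗ M.act.flip b) t)
      = Λ (X.coact.lTensor H t) := by
    intro t
    induction t with
    | zero => simp
    | add x y hx hy => simp only [map_add, hx, hy]
    | tmul h x => simp [Λ, halfBraid]
  have h2 : ∀ t : H ⊗[k] X, Λ (TensorProduct.assoc k H H X ((Coalgebra.comul (R := k)).rTensor X t))
      = TensorProduct.lift (M.tmul X ∘ₗ M.act.flip (b * c)) t := by
    intro t
    induction t with
    | zero => simp
    | add x y hx hy => simp only [map_add, hx, hy]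
    | tmul h x =>
      simp only [LinearMap.rTensor_tmul, TensorProduct.lift.tmul, LinearMap.comp_apply,
        LinearMap.flip_apply, M.act_mul]
      generalize Coalgebra.comul (R := k) h = s
      induction s with
      | zero => simp
      | add x y hx hy => simp only [map_add, TensorProduct.add_tmul, LinearMap.add_apply, hx, hy]
      | tmul h g => simp [Λ]
  rw [halfBraid, LinearMap.comp_apply, h1, ← X.coassoc, h2]
  rfl

/-- The bimodule `A ⊗_{H^t} X`. -/
def indBim (X : CoRep k H) : Bim k A where
  carrier := M.Ind X
  left := M.indLeft X
  right := M.indRight X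
  left_one := M.indLeft_one X
  left_mul := M.indLeft_mul X
  right_one := LinearMap.congr_fun (f := M.indRight X 1) (g := LinearMap.id)
    (M.ind_ext fun a x => by simp [halfBraid_one])
  right_mul a b := LinearMap.congr_fun (f := M.indRight X (a * b))
    (g := M.indRight X b ∘ₗ M.indRight X a) (M.ind_ext fun c x => by
      simp [← indRight_indLeft, indRight_halfBraid])
  left_right a b := M.indRight_indLeft X a b

/-- The element `a ⊗ x` of the bimodule `A ⊗_{H^t} X`. -/
def bmul (X : CoRep k H) : A →ₗ[k] X →ₗ[k] M.indBim X := M.tmul X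

theorem left_bmul (X : CoRep k H) (a b : A) (x : X) :
    (M.indBim X).left a (M.bmul X b x) = M.bmul X (a * b) x := M.indLeft_tmul X a b x

theorem left_bmul_one (X : CoRep k H) (a : A) (x : X) :
    (M.indBim X).left a (M.bmul X 1 x) = M.bmul X a x := by
  rw [left_bmul, mul_one]

theorem bmul_bal (X : CoRep k H) {z : H} (hz : z ∈ target k H) (a : A) (x : X) :
    M.bmul X (a * M.act z 1) x = M.bmul X a (X.left z x) := M.tmul_bal X hz a x

theorem right_act_one_bmul (X : CoRep k H) {z : H} (hz : z ∈ target k H) (a : A) (x : X) :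
    (M.indBim X).right (M.act z 1) (M.bmul X a x) = M.bmul X a (X.right z x) :=
  (M.indRight_tmul X _ a x).trans ((congrArg (M.indLeft X a) (M.halfBraid_act_one X hz x)).trans
    ((M.indLeft_tmul X a 1 _).trans (by rw [mul_one]; rfl)))

theorem right_bmul (X : CoRep k H) (a b : A) (x : X) :
    (M.indBim X).right b (M.bmul X a x) = (M.indBim X).left a (M.halfBraid X b x) :=
  M.indRight_tmul X b a x

theorem gen_bmul (X : CoRep k H) : Bim.Gen (M := M.indBim X) (M.bmul X 1) := by
  apply Bim.Gen.of_forall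
  intro y
  refine BalTensor.ind (p := fun y => y ∈ Submodule.span k
    {y | ∃ a x, (M.indBim X).left a (M.bmul X 1 x) = y}) y
    (Submodule.zero_mem _) (fun x y => Submodule.add_mem _) fun a x => ?_
  exact Submodule.subset_span ⟨a, x, M.left_bmul_one X a x⟩

theorem ind_hom_ext {X : CoRep k H} {N : Bim k A} {f g : M.indBim X ⟶ N}
    (h : ∀ x, Bim.lin f (M.bmul X 1 x) = Bim.lin g (M.bmul X 1 x)) : f = g :=
  (M.gen_bmul X).hom_ext h

/-- A homomorphism out of `A ⊗_{H^t} X` from a balanced map on `X`. -/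
def indLift {X : CoRep k H} {N : Bim k A} (f : X →ₗ[k] N)
    (hl : ∀ z ∈ target k H, ∀ x, f (X.left z x) = N.left (M.act z 1) (f x))
    (hr : ∀ a x, N.right a (f x) = TensorProduct.lift ((N.left ∘ₗ M.act.flip a).compl₂ f)
      (X.coact x)) : M.indBim X ⟶ N :=
  have hb : ∀ (z : target k H) a x, (N.left.compl₂ f) (M.rt z a) x = (N.left.compl₂ f) a (X.lt z x) :=
    fun z a x => by
      simp only [LinearMap.compl₂_apply, CoRep.lt, hl z z.2, rt, LinearMap.mulRight_apply,
        N.left_mul]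
  have h1 : ∀ a x, BalTensor.lift (N.left.compl₂ f) hb (M.tmul X a x) = N.left a (f x) :=
    BalTensor.lift_mk _ hb
  have hL : ∀ a u, BalTensor.lift (N.left.compl₂ f) hb (M.indLeft X a u)
      = N.left a (BalTensor.lift (N.left.compl₂ f) hb u) := fun a => LinearMap.congr_fun
    (f := BalTensor.lift (N.left.compl₂ f) hb ∘ₗ M.indLeft X a)
    (g := N.left a ∘ₗ BalTensor.lift (N.left.compl₂ f) hb)
    (M.ind_ext fun b x => by
      simp only [LinearMap.comp_apply, indLeft_tmul, h1, N.left_mul])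
  have h2 : ∀ a x, BalTensor.lift (N.left.compl₂ f) hb (M.halfBraid X a x) = N.right a (f x) := by
    intro a x
    rw [hr, halfBraid, LinearMap.comp_apply]
    generalize X.coact x = t
    induction t with
    | zero => simp
    | add x y hx hy => simp only [map_add, hx, hy]
    | tmul h x => simp [h1]
  Bim.ofLin (M := M.indBim X) (BalTensor.lift (N.left.compl₂ f) hb) hL
    (fun a => LinearMap.congr_fun
      (f := BalTensor.lift (N.left.compl₂ f) hb ∘ₗ M.indRight X a)
      (g := N.right a ∘ₗ BalTensor.lift (N.left.compl₂ f) hb)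
      (M.ind_ext fun b x => by
        simp only [LinearMap.comp_apply, indRight_tmul, hL, h1, h2, N.left_right]))

end ModuleAlgebra

end Induction

/-! ### Tensor and unit isomorphisms for induced bimodules. -/

section InductionMonoidal

variable {k H A : Type u} [Field k] [Ring H] [Algebra k H] [Coalgebra k H] [WeakHopfAlgebra k H]
  [FiniteDimensional k H] [Ring A] [Algebra k A]

namespace ModuleAlgebra

variable (M : ModuleAlgebra k H A)

@[simp] theorem lin_indLift {X : CoRep k H} {N : Bim k A} (f : X →ₗ[k] N)
    (hl : ∀ z ∈ target k H, ∀ x, f (X.left z x) = N.left (M.act z 1) (f x))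
    (hr : ∀ a x, N.right a (f x) = TensorProduct.lift ((N.left ∘ₗ M.act.flip a).compl₂ f)
      (X.coact x)) (a : A) (x : X) :
    Bim.lin (M.indLift f hl hr) (M.bmul X a x) = N.left a (f x) :=
  BalTensor.lift_mk (r := M.rt) (l := X.lt) (N.left.compl₂ f) (fun z a x => by
      simp only [LinearMap.compl₂_apply, CoRep.lt, hl z z.2, rt, LinearMap.mulRight_apply,
        N.left_mul]) a x

theorem right_bmul_one (X : CoRep k H) (a : A) (x : X) :
    (M.indBim X).right a (M.bmul X 1 x)
      = TensorProduct.lift (((M.indBim X).left ∘ₗ M.act.flip a).compl₂ (M.bmul X 1))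
        (X.coact x) := by
  refine (M.right_bmul X 1 a x).trans (((M.indBim X).left_one _).trans ?_)
  change TensorProduct.lift (M.tmul X ∘ₗ M.act.flip a) (X.coact x) = _
  generalize X.coact x = t
  induction t with
  | zero => exact (map_zero _).trans (map_zero _).symm
  | add x y hx hy => rw [map_add _ x y, map_add _ x y, hx, hy]; rfl
  | tmul h x => exact (M.left_bmul_one X _ x).symm

/-- The homomorphism of bimodules induced by a homomorphism of comodules. -/
def indMap {X Y : CoRep k H} (f : X ⟶ Y) : M.indBim X ⟶ M.indBim Y :=
  M.indLift (M.bmul Y 1 ∘ₗ CoRep.lin f)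
    (fun z hz x => by
      rw [LinearMap.comp_apply, LinearMap.comp_apply, CoRep.lin_left, ← M.bmul_bal Y hz, left_bmul,
        one_mul, mul_one])
    (fun a x => by
      rw [LinearMap.comp_apply, right_bmul_one, CoRep.coact_lin]
      generalize X.coact x = t
      induction t with
      | zero => simp
      | add x y hx hy => rw [map_add _ x y, map_add _ x y, map_add _ _ _, hx, hy]
      | tmul h x => rfl)

@[simp] theorem lin_indMap {X Y : CoRep k H} (f : X ⟶ Y) (a : A) (x : X) :
    Bim.lin (M.indMap f) (M.bmul X a x) = M.bmul Y a (CoRep.lin f x) :=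
  (M.lin_indLift _ _ _ a x).trans (M.left_bmul_one Y a _)

/-- The functor `X ↦ A ⊗_{H^t} X`. -/
def indFunctor : CoRep k H ⥤ Bim k A where
  obj := M.indBim
  map := M.indMap
  map_id X := M.ind_hom_ext fun x => M.lin_indMap _ 1 x
  map_comp f g := M.ind_hom_ext fun x => by simp

theorem insR_bal (X Y : CoRep k H) (y : Y) (z : target k H) (a : A) (x : X) :
    ((M.tmul (CoRep.tensor X Y)).compl₂ ((CoRep.tmul X Y).flip y)) (M.rt z a) x
      = ((M.tmul (CoRep.tensor X Y)).compl₂ ((CoRep.tmul X Y).flip y)) a (X.lt z x) := by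
  change M.tmul _ (a * M.act z 1) (CoRep.tmul X Y x y)
    = M.tmul _ a (CoRep.tmul X Y (X.left z x) y)
  rw [M.tmul_bal _ z.2, CoRep.left_tmul X Y z.2]

/-- The map `y ⊗ (a ⊗ x) ↦ a ⊗ (x ⊗ y)`. -/
def insR (X Y : CoRep k H) : Y →ₗ[k] M.Ind X →ₗ[k] M.Ind (CoRep.tensor X Y) :=
  LinearMap.mk₂ k (fun y => BalTensor.lift _ (M.insR_bal X Y y))
    (fun y y' => LinearMap.congr_fun (f := BalTensor.lift _ (M.insR_bal X Y (y + y')))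
      (g := BalTensor.lift _ (M.insR_bal X Y y) + BalTensor.lift _ (M.insR_bal X Y y'))
      (BalTensor.hom_ext fun a x => by
        simp only [BalTensor.lift_mk, LinearMap.add_apply, LinearMap.compl₂_apply,
          LinearMap.flip_apply, map_add]))
    (fun c y => LinearMap.congr_fun (f := BalTensor.lift _ (M.insR_bal X Y (c • y)))
      (g := c • BalTensor.lift _ (M.insR_bal X Y y))
      (BalTensor.hom_ext fun a x => by
        simp only [BalTensor.lift_mk, LinearMap.smul_apply, LinearMap.compl₂_apply,
          LinearMap.flip_apply, map_smul]))
    (fun a => map_add _) (fun c a => map_smul _ c)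

@[simp] theorem insR_tmul (X Y : CoRep k H) (y : Y) (a : A) (x : X) :
    M.insR X Y y (M.tmul X a x) = M.tmul (CoRep.tensor X Y) a (CoRep.tmul X Y x y) :=
  BalTensor.lift_mk _ (M.insR_bal X Y y) a x

theorem insR_indLeft (X Y : CoRep k H) (y : Y) (a : A) (u : M.Ind X) :
    M.insR X Y y (M.indLeft X a u) = M.indLeft _ a (M.insR X Y y u) :=
  LinearMap.congr_fun (f := M.insR X Y y ∘ₗ M.indLeft X a)
    (g := M.indLeft _ a ∘ₗ M.insR X Y y) (M.ind_ext (by simp)) u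

/-- The right action of `z·1` on `1 ⊗ x` is that of `z` on `x`, so it crosses to `y` over `H^t`.
This gives the balancing needed to multiply by a second factor `b ⊗ y`. -/
theorem insR_indRight (X Y : CoRep k H) (y : Y) {z : H} (hz : z ∈ target k H) (u : M.Ind X) :
    M.insR X Y y (M.indRight X (M.act z 1) u) = M.insR X Y (Y.left z y) u :=
  LinearMap.congr_fun (f := M.insR X Y y ∘ₗ M.indRight X (M.act z 1))
    (g := M.insR X Y (Y.left z y)) (M.ind_ext fun a x => by
      simp [M.halfBraid_act_one X hz, CoRep.tmul_bal X Y hz]) u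

theorem muB_bal (X Y : CoRep k H) (u : M.Ind X) (z : target k H) (b : A) (y : Y) :
    ((M.insR X Y).flip ∘ₗ (M.indRight X).flip u) (M.rt z b) y
      = ((M.insR X Y).flip ∘ₗ (M.indRight X).flip u) b (Y.lt z y) := by
  change M.insR X Y y (M.indRight X (b * M.act z 1) u)
    = M.insR X Y (Y.left z y) (M.indRight X b u)
  rw [← M.insR_indRight X Y y z.2]
  exact congrArg _ ((M.indBim X).right_mul b _ u)

/-- The map `u ⊗ (b ⊗ y) ↦ (u · b) ⊗ y`. -/
def muB (X Y : CoRep k H) : M.Ind X →ₗ[k] M.Ind Y →ₗ[k] M.Ind (CoRep.tensor X Y) :=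
  LinearMap.mk₂ k (fun u => BalTensor.lift _ (M.muB_bal X Y u))
    (fun u u' => LinearMap.congr_fun (f := BalTensor.lift _ (M.muB_bal X Y (u + u')))
      (g := BalTensor.lift _ (M.muB_bal X Y u) + BalTensor.lift _ (M.muB_bal X Y u'))
      (BalTensor.hom_ext fun a x => by
        simp only [BalTensor.lift_mk, LinearMap.add_apply, LinearMap.comp_apply,
          LinearMap.flip_apply, map_add]))
    (fun c u => LinearMap.congr_fun (f := BalTensor.lift _ (M.muB_bal X Y (c • u)))
      (g := c • BalTensor.lift _ (M.muB_bal X Y u))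
      (BalTensor.hom_ext fun a x => by
        simp only [BalTensor.lift_mk, LinearMap.smul_apply, LinearMap.comp_apply,
          LinearMap.flip_apply, map_smul]))
    (fun a => map_add _) (fun c a => map_smul _ c)

theorem muB_tmul (X Y : CoRep k H) (u : M.Ind X) (b : A) (y : Y) :
    M.muB X Y u (M.tmul Y b y) = M.insR X Y y (M.indRight X b u) :=
  BalTensor.lift_mk _ (M.muB_bal X Y u) b y

theorem muB_indRight (X Y : CoRep k H) (a : A) (u : M.Ind X) (v : M.Ind Y) :
    M.muB X Y (M.indRight X a u) v = M.muB X Y u (M.indLeft Y a v) :=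
  LinearMap.congr_fun (f := M.muB X Y (M.indRight X a u)) (g := M.muB X Y u ∘ₗ M.indLeft Y a)
    (M.ind_ext fun b y => by
      simp only [LinearMap.comp_apply, indLeft_tmul, muB_tmul]
      exact congrArg _ ((M.indBim X).right_mul a b u).symm) v

theorem muB_indLeft (X Y : CoRep k H) (a : A) (u : M.Ind X) (v : M.Ind Y) :
    M.muB X Y (M.indLeft X a u) v = M.indLeft _ a (M.muB X Y u v) :=
  LinearMap.congr_fun (f := M.muB X Y (M.indLeft X a u)) (g := M.indLeft _ a ∘ₗ M.muB X Y u)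
    (M.ind_ext fun b y => by
      simp only [LinearMap.comp_apply, muB_tmul, ← indRight_indLeft, insR_indLeft]) v

/-- Passing `a` first through `y` and then through `x` gives `x₍₋₁₎·(y₍₋₁₎·a)`. The axiom `(gh)·a =
g·(h·a)` and the diagonal coaction on `X ⊗ Y` identify this with passing through `x ⊗ y` at once. -/
theorem muB_halfBraid (X Y : CoRep k H) (a : A) (x : X) (y : Y) :
    M.muB X Y (M.tmul X 1 x) (M.halfBraid Y a y)
      = M.halfBraid (CoRep.tensor X Y) a (CoRep.tmul X Y x y) := by
  simp only [halfBraid, LinearMap.comp_apply, CoRep.coact_tmul]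
  generalize Y.coact y = s
  induction s with
  | zero => simp
  | add x y hx hy => simp only [map_add, hx, hy]
  | tmul g y =>
    simp only [TensorProduct.lift.tmul, LinearMap.comp_apply, muB_tmul, indRight_tmul, indLeft_one,
      halfBraid]
    generalize X.coact x = t
    induction t with
    | zero => simp
    | add x y hx hy => simp only [map_add, LinearMap.add_apply, hx, hy]
    | tmul h x => simp [M.mul_act]

/-- Left linearity reduces the first argument to `1 ⊗ x`, where `muB_halfBraid` applies; a
coefficient of the second argument is first moved into the right action on the first. -/
theorem muB_right (X Y : CoRep k H) (a : A) (u : M.Ind X) (v : M.Ind Y) :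
    M.muB X Y u (M.indRight Y a v) = M.indRight _ a (M.muB X Y u v) := by
  have h : ∀ u y, M.muB X Y u (M.halfBraid Y a y) = M.indRight _ a (M.insR X Y y u) := by
    intro u y
    refine LinearMap.congr_fun (f := (M.muB X Y).flip (M.halfBraid Y a y))
      (g := M.indRight _ a ∘ₗ M.insR X Y y) (M.ind_ext fun b x => ?_) u
    have e : M.tmul X b x = M.indLeft X b (M.tmul X 1 x) := by simp
    simp only [LinearMap.flip_apply, LinearMap.comp_apply]
    rw [e, muB_indLeft, muB_halfBraid, insR_indLeft, ← indRight_indLeft, insR_tmul, indRight_tmul,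
      indLeft_one]
  refine LinearMap.congr_fun (f := M.muB X Y u ∘ₗ M.indRight Y a)
      (g := M.indRight _ a ∘ₗ M.muB X Y u) (M.ind_ext fun b y => ?_) v
  simp only [LinearMap.comp_apply]
  rw [indRight_tmul, ← muB_indRight, h, muB_tmul]

/-- The homomorphism `(A ⊗ X) ⊗_A (A ⊗ Y) → A ⊗ (X ⊗ Y)`. -/
def indMu (X Y : CoRep k H) :
    Bim.tensor (M.indBim X) (M.indBim Y) ⟶ M.indBim (CoRep.tensor X Y) :=
  Bim.homOfTensor (M := M.indBim X) (N := M.indBim Y) (P := M.indBim (CoRep.tensor X Y))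
    (BalTensor.lift (M.muB X Y) (M.muB_indRight X Y))
    (fun a u v => M.muB_indLeft X Y a u v)
    (fun a u v => M.muB_right X Y a u v)

theorem lin_indMu (X Y : CoRep k H) (x : X) (y : Y) :
    Bim.lin (M.indMu X Y) (Bim.tmul _ _ (M.bmul X 1 x) (M.bmul Y 1 y))
      = M.bmul _ 1 (CoRep.tmul X Y x y) :=
  (M.muB_tmul X Y _ 1 y).trans ((congrArg _ ((M.indBim X).right_one _)).trans
    (M.insR_tmul X Y y 1 x))

/-- Both `H^t`-actions become multiplication by `z·1`, on the right of the first factor and on the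
left of the second, and these agree over `A`. -/
theorem indMuInv_bal (X Y : CoRep k H) (z : target k H) (x : X) (y : Y) :
    ((Bim.tmul (M.indBim X) (M.indBim Y)).compl₁₂ (M.bmul X 1) (M.bmul Y 1)) (X.rt z x) y
      = ((Bim.tmul (M.indBim X) (M.indBim Y)).compl₁₂ (M.bmul X 1) (M.bmul Y 1)) x (Y.lt z y) := by
  simp only [LinearMap.compl₁₂_apply, CoRep.rt, CoRep.lt]
  rw [← M.right_act_one_bmul X z.2, Bim.tmul_bal, ← M.bmul_bal Y z.2, left_bmul, mul_one, one_mul]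

/-- The map `x ⊗ y ↦ (1 ⊗ x) ⊗ (1 ⊗ y)`. -/
def indMuInvLin (X Y : CoRep k H) :
    CoRep.tensor X Y →ₗ[k] Bim.tensor (M.indBim X) (M.indBim Y) :=
  BalTensor.lift _ (M.indMuInv_bal X Y)

theorem indMuInvLin_tmul (X Y : CoRep k H) (x : X) (y : Y) :
    M.indMuInvLin X Y (CoRep.tmul X Y x y) = Bim.tmul _ _ (M.bmul X 1 x) (M.bmul Y 1 y) :=
  BalTensor.lift_mk _ (M.indMuInv_bal X Y) x y

theorem indMuInvLin_left (X Y : CoRep k H) {z : H} (hz : z ∈ target k H) (t : CoRep.tensor X Y) :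
    M.indMuInvLin X Y ((CoRep.tensor X Y).left z t)
      = (Bim.tensor (M.indBim X) (M.indBim Y)).left (M.act z 1) (M.indMuInvLin X Y t) :=
  LinearMap.congr_fun (f := M.indMuInvLin X Y ∘ₗ (CoRep.tensor X Y).left z)
    (g := (Bim.tensor (M.indBim X) (M.indBim Y)).left (M.act z 1) ∘ₗ M.indMuInvLin X Y)
    (CoRep.tensor_lin_ext fun x y => by
      simp only [LinearMap.comp_apply, CoRep.left_tmul X Y hz, indMuInvLin_tmul,
        Bim.tensor_left_tmul, ← M.bmul_bal X hz, left_bmul, one_mul, mul_one]) t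

theorem indMuInvLin_right (X Y : CoRep k H) (a : A) (t : CoRep.tensor X Y) :
    (Bim.tensor (M.indBim X) (M.indBim Y)).right a (M.indMuInvLin X Y t)
      = TensorProduct.lift (((Bim.tensor (M.indBim X) (M.indBim Y)).left ∘ₗ M.act.flip a).compl₂
        (M.indMuInvLin X Y)) ((CoRep.tensor X Y).coact t) := by
  refine LinearMap.congr_fun
    (f := (Bim.tensor (M.indBim X) (M.indBim Y)).right a ∘ₗ M.indMuInvLin X Y)
    (g := TensorProduct.lift (((Bim.tensor (M.indBim X) (M.indBim Y)).left ∘ₗ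
      M.act.flip a).compl₂ (M.indMuInvLin X Y)) ∘ₗ (CoRep.tensor X Y).coact)
    (CoRep.tensor_lin_ext fun x y => ?_) t
  simp only [LinearMap.comp_apply, indMuInvLin_tmul, Bim.tensor_right_tmul, right_bmul_one,
    CoRep.coact_tmul]
  generalize Y.coact y = s
  induction s with
  | zero => simp
  | add x y hx hy => simp only [map_add, hx, hy]
  | tmul g y =>
    simp only [TensorProduct.lift.tmul, LinearMap.comp_apply, LinearMap.compl₂_apply,
      ← Bim.tmul_bal, right_bmul_one]
    generalize X.coact x = t
    induction t with
    | zero => simp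
    | add x y hx hy => simp only [map_add, LinearMap.add_apply, hx, hy]
    | tmul h x => simp [M.mul_act, indMuInvLin_tmul]

/-- The isomorphism `(A ⊗ X) ⊗_A (A ⊗ Y) ≅ A ⊗ (X ⊗ Y)`. -/
def indMuIso (X Y : CoRep k H) :
    Bim.tensor (M.indBim X) (M.indBim Y) ≅ M.indBim (CoRep.tensor X Y) where
  hom := M.indMu X Y
  inv := M.indLift (M.indMuInvLin X Y) (fun z hz => M.indMuInvLin_left X Y hz)
    (M.indMuInvLin_right X Y)
  -- Both composites are bimodule maps, so they need only be compared on generators, where the two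
  -- maps exchange `(1 ⊗ x) ⊗ (1 ⊗ y)` and `1 ⊗ (x ⊗ y)`.
  hom_inv_id := ((M.gen_bmul X).tensor (M.gen_bmul Y)).hom_ext fun ⟨x, y⟩ => by
    rw [Bim.lin_comp, lin_indMu, lin_indLift, indMuInvLin_tmul, Bim.left_one, Bim.lin_id]
  inv_hom_id := M.ind_hom_ext (LinearMap.congr_fun
    (f := Bim.lin (M.indLift (M.indMuInvLin X Y) (fun z hz => M.indMuInvLin_left X Y hz)
      (M.indMuInvLin_right X Y) ≫ M.indMu X Y) ∘ₗ M.bmul _ 1)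
    (g := M.bmul _ 1) (CoRep.tensor_lin_ext fun x y => by
      rw [LinearMap.comp_apply, Bim.lin_comp, lin_indLift, indMuInvLin_tmul, Bim.left_one,
        lin_indMu]))

/-- The map `z ↦ z · 1` from the target algebra to `A`. -/
def unitMap : CoRep.unit k H →ₗ[k] Bim.unit k A := M.act.flip 1 ∘ₗ (target k H).subtype

theorem unitMap_left {z : H} (hz : z ∈ target k H) (w : CoRep.unit k H) :
    M.unitMap ((CoRep.unit k H).left z w) = (Bim.unit k A).left (M.act z 1) (M.unitMap w) := by
  change M.act ((target k H).subtype ((CoRep.unit k H).left z w)) 1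
    = M.act z 1 * M.act ((target k H).subtype w) 1
  rw [← M.act_target hz, ← M.mul_act]
  exact congrArg (fun h => M.act h 1) (CoRep.unit_coe_left hz w)

/-- Both sides are `w·a`: it is `(w·1) a` because `w` lies in `H^t`, and it is `(w₍₁₎·a)(w₍₂₎·1)` on
writing `a = a·1`. -/
theorem unitMap_right (a : A) (w : CoRep.unit k H) : (Bim.unit k A).right a (M.unitMap w)
      = TensorProduct.lift (((Bim.unit k A).left ∘ₗ M.act.flip a).compl₂ M.unitMap)
        ((CoRep.unit k H).coact w) := by
  have hw : (target k H).subtype w ∈ target k H := Subtype.prop (show target k H from w)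
  have h : TensorProduct.lift (((Bim.unit k A).left ∘ₗ M.act.flip a).compl₂ M.unitMap)
      = LinearMap.mul' k A ∘ₗ TensorProduct.map (M.act.flip a) (M.act.flip 1) ∘ₗ
        (target k H).subtype.lTensor H := TensorProduct.ext' fun h x => rfl
  refine Eq.trans ?_ (LinearMap.congr_fun h ((CoRep.unit k H).coact w)).symm
  refine Eq.trans ?_ (congrArg (fun t => LinearMap.mul' k A (TensorProduct.map (M.act.flip a)
    (M.act.flip 1) t)) (CoRep.lTensor_subtype_unitCoact w)).symm
  refine Eq.trans ?_ (M.act_mul _ a 1)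
  rw [mul_one]
  exact (M.act_target hw a).symm

/-- The homomorphism `A ⊗ H^t → A`. -/
def indEpsInv : M.indBim (CoRep.unit k H) ⟶ Bim.unit k A :=
  M.indLift M.unitMap (fun _ hz => M.unitMap_left hz) M.unitMap_right

theorem lin_indEpsInv (a : A) (z : target k H) :
    Bim.lin M.indEpsInv (M.bmul (CoRep.unit k H) a z)
      = (a * M.act (z : H) 1 : A) :=
  M.lin_indLift M.unitMap (fun _ hz => M.unitMap_left hz) M.unitMap_right a z

/-- The isomorphism `A ≅ A ⊗ H^t`. -/
def indEpsIso : Bim.unit k A ≅ M.indBim (CoRep.unit k H) :=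
  (Bim.isoOfLin (M := M.indBim (CoRep.unit k H)) (N := Bim.unit k A)
    (LinearEquiv.ofLinearMap (Bim.lin M.indEpsInv)
      ((M.bmul (CoRep.unit k H)).flip (CoRep.unitOne k H))
      (LinearMap.ext fun a => (M.lin_indEpsInv a ⟨1, one_mem_target⟩).trans
        ((congrArg (LinearMap.mul k A a) (M.one_act 1)).trans (mul_one (M := A) a)))
      (M.ind_ext fun a z =>
        (congrArg (fun b => M.bmul (CoRep.unit k H) b (CoRep.unitOne k H))
          (M.lin_indEpsInv a z)).trans
        ((M.bmul_bal (CoRep.unit k H) (Subtype.prop (show target k H from z)) a _).trans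
          (congrArg (M.bmul (CoRep.unit k H) a) (CoRep.unit_left_one z)))))
    (Bim.lin_left M.indEpsInv) (Bim.lin_right M.indEpsInv)).symm

theorem lin_indEpsIso_hom (a : A) : Bim.lin M.indEpsIso.hom a
    = M.bmul (CoRep.unit k H) a (CoRep.unitOne k H) := rfl

end ModuleAlgebra

end InductionMonoidal

/-! ### The induced monoidal functor, frames and base spaces. -/

section MonoidalFunctor

variable {k H A : Type u} [Field k] [Ring H] [Algebra k H] [Coalgebra k H] [WeakHopfAlgebra k H]
  [FiniteDimensional k H] [Ring A] [Algebra k A]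

namespace ModuleAlgebra

variable (M : ModuleAlgebra k H A)

/-- The monoidal structure of the functor `X ↦ A ⊗_{H^t} X`. -/
def indCoreMonoidal : M.indFunctor.CoreMonoidal where
  εIso := M.indEpsIso
  μIso := M.indMuIso
  -- Each coherence law is an equality of bimodule maps. On tensors of elements `1 ⊗ x` it becomes
  -- the corresponding law in `coRep(H)`.
  μIso_hom_natural_left {X Y} f Z := ((M.gen_bmul X).tensor (M.gen_bmul Z)).hom_ext fun ⟨x, z⟩ => by
    change Bim.lin (M.indMu Y Z) (Bim.lin (Bim.tensorMap (M.indMap f) (𝟙 (M.indBim Z)))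
      (Bim.tmul _ _ (M.bmul X 1 x) (M.bmul Z 1 z))) = Bim.lin (M.indMap (CoRep.tensorMap f (𝟙 Z)))
        (Bim.lin (M.indMu X Z) (Bim.tmul _ _ (M.bmul X 1 x) (M.bmul Z 1 z)))
    rw [Bim.lin_tensorMap, lin_indMap, Bim.lin_id, lin_indMu, lin_indMu, lin_indMap,
      CoRep.lin_tensorMap, CoRep.lin_id]
  μIso_hom_natural_right {X Y} Z f := ((M.gen_bmul Z).tensor (M.gen_bmul X)).hom_ext fun ⟨z, x⟩ => by
    change Bim.lin (M.indMu Z Y) (Bim.lin (Bim.tensorMap (𝟙 (M.indBim Z)) (M.indMap f))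
      (Bim.tmul _ _ (M.bmul Z 1 z) (M.bmul X 1 x))) = Bim.lin (M.indMap (CoRep.tensorMap (𝟙 Z) f))
        (Bim.lin (M.indMu Z X) (Bim.tmul _ _ (M.bmul Z 1 z) (M.bmul X 1 x)))
    rw [Bim.lin_tensorMap, lin_indMap, Bim.lin_id, lin_indMu, lin_indMu, lin_indMap,
      CoRep.lin_tensorMap, CoRep.lin_id]
  associativity X Y Z :=
    (((M.gen_bmul X).tensor (M.gen_bmul Y)).tensor (M.gen_bmul Z)).hom_ext fun ⟨⟨x, y⟩, z⟩ => by
      change Bim.lin (M.indMap (CoRep.associator X Y Z).hom)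
          (Bim.lin (M.indMu (CoRep.tensor X Y) Z)
            (Bim.lin (Bim.tensorMap (M.indMu X Y) (𝟙 (M.indBim Z)))
          (Bim.tmul _ _ (Bim.tmul _ _ (M.bmul X 1 x) (M.bmul Y 1 y)) (M.bmul Z 1 z))))
        = Bim.lin (M.indMu X (CoRep.tensor Y Z))
          (Bim.lin (Bim.tensorMap (𝟙 (M.indBim X)) (M.indMu Y Z))
            (Bim.lin (Bim.associator _ _ _).hom
          (Bim.tmul _ _ (Bim.tmul _ _ (M.bmul X 1 x) (M.bmul Y 1 y)) (M.bmul Z 1 z))))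
      rw [Bim.lin_tensorMap, Bim.lin_id, lin_indMu, lin_indMu, lin_indMap, CoRep.lin_associator,
        Bim.lin_associator, Bim.lin_tensorMap, Bim.lin_id, lin_indMu, lin_indMu]
  left_unitality X := (Bim.Gen.unit.tensor (M.gen_bmul X)).hom_ext fun ⟨_, x⟩ => by
    change Bim.lin (Bim.leftUnitor (M.indBim X)).hom (Bim.tmul (Bim.unit k A) _ (1 : A) (M.bmul X 1 x))
      = Bim.lin (M.indMap (CoRep.leftUnitor X).hom) (Bim.lin (M.indMu (CoRep.unit k H) X)
        (Bim.lin (Bim.tensorMap M.indEpsIso.hom (𝟙 (M.indBim X)))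
          (Bim.tmul (Bim.unit k A) _ (1 : A) (M.bmul X 1 x))))
    have e := Bim.lin_tensorMap M.indEpsIso.hom (𝟙 (M.indBim X)) (1 : A) (M.bmul X 1 x)
    refine Eq.trans ?_ (congrArg (fun t => Bim.lin (M.indMap (CoRep.leftUnitor X).hom)
      (Bim.lin (M.indMu (CoRep.unit k H) X) t)) e).symm
    rw [Bim.lin_leftUnitor, Bim.left_one, Bim.lin_id, lin_indEpsIso_hom,
      lin_indMu, lin_indMap, CoRep.lin_leftUnitor, CoRep.leftB_one]
  right_unitality X := ((M.gen_bmul X).tensor Bim.Gen.unit).hom_ext fun ⟨x, _⟩ => by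
    change Bim.lin (Bim.rightUnitor (M.indBim X)).hom
        (Bim.tmul _ (Bim.unit k A) (M.bmul X 1 x) (1 : A))
      = Bim.lin (M.indMap (CoRep.rightUnitor X).hom) (Bim.lin (M.indMu X (CoRep.unit k H))
        (Bim.lin (Bim.tensorMap (𝟙 (M.indBim X)) M.indEpsIso.hom)
          (Bim.tmul _ (Bim.unit k A) (M.bmul X 1 x) (1 : A))))
    have e := Bim.lin_tensorMap (𝟙 (M.indBim X)) M.indEpsIso.hom (M.bmul X 1 x) (1 : A)
    refine Eq.trans ?_ (congrArg (fun t => Bim.lin (M.indMap (CoRep.rightUnitor X).hom)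
      (Bim.lin (M.indMu X (CoRep.unit k H)) t)) e).symm
    rw [Bim.lin_rightUnitor, Bim.right_one, Bim.lin_id, lin_indEpsIso_hom,
      lin_indMu, lin_indMap, CoRep.lin_rightUnitor, CoRep.rightB_one]

instance : M.indFunctor.Monoidal := M.indCoreMonoidal.toMonoidal

/-- Separability applies to `z ↦ z·1`, which is multiplicative on `H^t` by `act_target`. This is
where injectivity of `H^t → A` enters: it makes the base spaces copies of the comodules. -/
theorem bmul_one_injective (hM : M.TargetInjective) (X : CoRep k H) :
    Function.Injective (M.bmul X 1) :=
  mk_one_injective (M.act.flip 1) hM (fun z hz w _ => by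
    rw [LinearMap.flip_apply, M.mul_act, M.act_target hz]; rfl) X

end ModuleAlgebra

/-- A compatible family of linear maps `X → F(X)` for a lax monoidal functor `F` from comodules
to bimodules. -/
structure Frame (F : CoRep k H ⥤ Bim k A) [F.LaxMonoidal] where
  lin : ∀ X : CoRep k H, X →ₗ[k] F.obj X
  map : ∀ {X Y : CoRep k H} (f : X ⟶ Y) (x : X), Bim.lin (F.map f) (lin X x) = lin Y (CoRep.lin f x)
  mul : ∀ (X Y : CoRep k H) (x : X) (y : Y), Bim.lin (Functor.LaxMonoidal.μ F X Y)
    (Bim.tmul (F.obj X) (F.obj Y) (lin X x) (lin Y y)) = lin (X ⊗ Y) (CoRep.tmul X Y x y)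
  one : Bim.lin (Functor.LaxMonoidal.ε F) (1 : A) = lin (𝟙_ (CoRep k H)) (CoRep.unitOne k H)

namespace ModuleAlgebra

/-- The maps `a ⊗ x ↦ a J(x)` are isomorphisms of bimodules from `A ⊗_{H^t} X` to `F(X)`. -/
def Realizes (M : ModuleAlgebra k H A) {F : CoRep k H ⥤ Bim k A} [F.LaxMonoidal]
    (J : Frame F) : Prop :=
  ∀ X : CoRep k H, ∃ e : M.indBim X ≅ F.obj X, ∀ x, Bim.lin e.hom (M.bmul X 1 x) = J.lin X x

variable (M : ModuleAlgebra k H A)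

/-- The frame `x ↦ 1 ⊗ x` of the functor `X ↦ A ⊗_{H^t} X`. -/
def indFrame : Frame M.indFunctor where
  lin X := M.bmul X 1
  map f x := M.lin_indMap f 1 x
  mul X Y x y := M.lin_indMu X Y x y
  one := rfl

theorem realizes_indFrame : M.Realizes M.indFrame := fun _ => ⟨Iso.refl _, fun _ => rfl⟩

/-- The based action `X ↦ A ⊗_{H^t} X` with base spaces `1 ⊗ X`. -/
def indAction : BasedAction k H A where
  functor := M.indFunctor
  base X := LinearMap.range (M.bmul X 1)
  finite_base _ := inferInstanceAs (FiniteDimensional k (LinearMap.range (M.bmul _ 1)))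
  one_mem := ⟨CoRep.unitOne k H, rfl⟩
  map_mem f := by
    rintro _ ⟨x, rfl⟩
    exact ⟨_, (M.lin_indMap f 1 x).symm⟩
  tensor_mem X Y := by
    rintro _ ⟨x, rfl⟩ _ ⟨y, rfl⟩
    exact ⟨_, (M.lin_indMu X Y x y).symm⟩

end ModuleAlgebra

namespace BasedAction

variable (B : BasedAction k H A)

/-- The frame of a based action given by a monoidal transformation from the weak fiber functor. -/
def frame (θ : weakFiber k H ⟶ B.induced) (hθ : NatTrans.IsMonoidal θ) : Frame B.functor where
  lin X := (B.base X).subtype ∘ₗ (θ.app X).hom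
  map f x := congrArg Subtype.val (LinearMap.congr_fun
    (congrArg ModuleCat.Hom.hom (θ.naturality f)) x).symm
  mul X Y x y := congrArg Subtype.val (LinearMap.congr_fun
    (congrArg ModuleCat.Hom.hom (hθ.tensor X Y)) (x ⊗ₜ[k] y)).symm
  one := by
    have h := congrArg Subtype.val (LinearMap.congr_fun (congrArg ModuleCat.Hom.hom hθ.unit) (1 : k))
    refine ((one_smul k _).symm.trans h.symm).trans ?_
    exact congrArg (fun z => ((θ.app (CoRep.unit k H)).hom z).1) (one_smul k (CoRep.unitOne k H))

/-- The monoidal transformation from the weak fiber functor given by a frame. -/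
def frameHom (J : Frame B.functor) (hJ : ∀ X, LinearMap.range (J.lin X) = B.base X) :
    weakFiber k H ⟶ B.induced where
  app X := ModuleCat.ofHom ((J.lin X).codRestrict (B.base X) fun x => hJ X ▸ ⟨x, rfl⟩)
  naturality X Y f := by
    apply ModuleCat.hom_ext
    apply LinearMap.ext
    intro x
    apply Subtype.ext
    exact (J.map f x).symm

theorem isMonoidal_frameHom (J : Frame B.functor)
    (hJ : ∀ X, LinearMap.range (J.lin X) = B.base X) :
    NatTrans.IsMonoidal (B.frameHom J hJ) where
  unit := by
    apply ModuleCat.hom_ext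
    apply LinearMap.ext_ring
    apply Subtype.ext
    refine (congrArg (J.lin (CoRep.unit k H)) (one_smul k (CoRep.unitOne k H))).trans ?_
    exact J.one.symm.trans (one_smul k _).symm
  tensor X Y := by
    apply ModuleCat.hom_ext
    apply TensorProduct.ext'
    intro x y
    apply Subtype.ext
    exact (J.mul X Y x y).symm

/-- A frame of a based action that identifies comodules with the base spaces. -/
structure IsBase (J : Frame B.functor) : Prop where
  injective : ∀ X, Function.Injective (J.lin X)
  range_eq : ∀ X, LinearMap.range (J.lin X) = B.base X

/-- Injectivity and the description of the range make each component bijective onto the base space.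
With `isBase_frame`, monoidal isomorphisms from `F_H` to the induced functor can be replaced by
frames. -/
theorem exists_iso_frame {J : Frame B.functor} (hJ : B.IsBase J) :
    ∃ θ : weakFiber k H ≅ B.induced, ∃ hθ : NatTrans.IsMonoidal θ.hom, B.frame θ.hom hθ = J := by
  have : ∀ X, IsIso ((B.frameHom J hJ.range_eq).app X) := fun X => by
    refine (ConcreteCategory.isIso_iff_bijective _).2 ⟨fun x y h => ?_, ?_⟩
    · exact hJ.injective X (congrArg Subtype.val h)
    · rintro ⟨v, hv⟩
      rw [← hJ.range_eq X] at hv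
      obtain ⟨x, rfl⟩ := hv
      exact ⟨x, rfl⟩
  have := NatIso.isIso_of_isIso_app (B.frameHom J hJ.range_eq)
  exact ⟨asIso (B.frameHom J hJ.range_eq), B.isMonoidal_frameHom J hJ.range_eq, rfl⟩

theorem isBase_frame (θ : weakFiber k H ≅ B.induced) (hθ : NatTrans.IsMonoidal θ.hom) :
    B.IsBase (B.frame θ.hom hθ) where
  injective X := Subtype.val_injective.comp
    ((ConcreteCategory.isIso_iff_bijective (θ.hom.app X)).1 inferInstance).1
  range_eq X := by
    ext v
    constructor
    · rintro ⟨x, rfl⟩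
      exact ((θ.hom.app X).hom x).2
    · intro hv
      obtain ⟨x, hx⟩ :=
        ((ConcreteCategory.isIso_iff_bijective (θ.hom.app X)).1 inferInstance).2 ⟨v, hv⟩
      exact ⟨x, congrArg Subtype.val hx⟩

end BasedAction

namespace ModuleAlgebra

variable (M : ModuleAlgebra k H A) (B : BasedAction k H A)

/-- A left `A`-linear bijection extending the frame is right linear precisely when the commutation
relation holds: elements `a ⊗ x` span, and right linearity on `1 ⊗ x` is that relation. -/
theorem induces_iff : M.Induces B ↔ ∃ J : Frame B.functor, B.IsBase J ∧ M.Realizes J := by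
  constructor
  · rintro ⟨θ, hθ, h⟩
    refine ⟨B.frame θ.hom hθ, B.isBase_frame θ hθ, fun X => ?_⟩
    obtain ⟨j, e, hj, hl, hr⟩ := h X
    have hj' : ∀ x, (B.frame θ.hom hθ).lin X x = j x := fun x =>
      congrArg Subtype.val (LinearMap.congr_fun (congrArg ModuleCat.Hom.hom hj) x)
    have hL : ∀ a u, e (M.indLeft X a u) = (B.functor.obj X).left a (e u) := fun a =>
      LinearMap.congr_fun (f := e.toLinearMap ∘ₗ M.indLeft X a)
        (g := (B.functor.obj X).left a ∘ₗ e.toLinearMap) (M.ind_ext fun b x => by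
          simp [hl, (B.functor.obj X).left_mul])
    refine ⟨Bim.isoOfLin (M := M.indBim X) e hL (fun a => LinearMap.congr_fun
      (f := e.toLinearMap ∘ₗ M.indRight X a)
      (g := (B.functor.obj X).right a ∘ₗ e.toLinearMap) (M.ind_ext fun b x => by
        simp [hl, hL, ← hr, (B.functor.obj X).left_right])), fun x => ?_⟩
    exact (hl 1 x).trans (((B.functor.obj X).left_one _).trans (hj' x).symm)
  · rintro ⟨J, hJ, h⟩
    obtain ⟨θ, hθ, rfl⟩ := B.exists_iso_frame hJ
    refine ⟨θ, hθ, fun X => ?_⟩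
    obtain ⟨e, he⟩ := h X
    refine ⟨(θ.hom.app X).hom, LinearEquiv.ofLinearMap (Bim.lin e.hom) (Bim.lin e.inv)
      (LinearMap.ext fun v => ?_) (LinearMap.ext fun v => ?_), rfl, fun a x => ?_, fun a x => ?_⟩
    · exact (Bim.lin_comp e.inv e.hom v).symm.trans (by rw [e.inv_hom_id]; rfl)
    · exact (Bim.lin_comp e.hom e.inv v).symm.trans (by rw [e.hom_inv_id]; rfl)
    · change Bim.lin e.hom (M.bmul X a x) = _
      rw [← left_bmul_one, Bim.lin_left, he]
      rfl
    · change _ = Bim.lin e.hom (M.halfBraid X a x)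
      have : M.halfBraid X a x = (M.indBim X).right a (M.bmul X 1 x) :=
        ((M.right_bmul X 1 a x).trans ((M.indBim X).left_one _)).symm
      rw [this, Bim.lin_right, he]
      rfl

theorem isBase_indFrame (hM : M.TargetInjective) : M.indAction.IsBase M.indFrame where
  injective := M.bmul_one_injective hM
  range_eq _ := rfl

theorem isOver_of_induces {M : ModuleAlgebra k H A} {B : BasedAction k H A} (h : M.Induces B) :
    B.IsOver (weakFiber k H) :=
  let ⟨θ, hθ, _⟩ := h
  ⟨θ, hθ⟩

theorem induces_indAction (hM : M.TargetInjective) : M.Induces M.indAction :=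
  (M.induces_iff _).2 ⟨M.indFrame, M.isBase_indFrame hM, M.realizes_indFrame⟩

end ModuleAlgebra

end MonoidalFunctor

/-! ### Element calculus for monoidal functors and coordinates from duality. -/

section FunctorCalculus

variable {k H A : Type u} [Field k] [Ring H] [Algebra k H] [Coalgebra k H] [WeakHopfAlgebra k H]
  [FiniteDimensional k H] [Ring A] [Algebra k A]

/-- The bilinear map `F(X) × F(Y) → F(X ⊗ Y)` of a lax monoidal functor. -/
def laxMul (F : CoRep k H ⥤ Bim k A) [F.LaxMonoidal] (X Y : CoRep k H) :
    F.obj X →ₗ[k] F.obj Y →ₗ[k] F.obj (CoRep.tensor X Y) :=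
  (Bim.tmul (F.obj X) (F.obj Y)).compr₂
    (Bim.lin (M := Bim.tensor (F.obj X) (F.obj Y)) (N := F.obj (CoRep.tensor X Y))
      (Functor.LaxMonoidal.μ F X Y))

/-- The map `A → F(1)` of a lax monoidal functor. -/
def laxOne (F : CoRep k H ⥤ Bim k A) [F.LaxMonoidal] : A →ₗ[k] F.obj (CoRep.unit k H) :=
  Bim.lin (M := Bim.unit k A) (N := F.obj (CoRep.unit k H)) (Functor.LaxMonoidal.ε F)

section Lax

variable (F : CoRep k H ⥤ Bim k A) [F.LaxMonoidal]

theorem left_laxMul (X Y : CoRep k H) (a : A) (u : F.obj X) (v : F.obj Y) :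
    (F.obj (CoRep.tensor X Y)).left a (laxMul F X Y u v) = laxMul F X Y ((F.obj X).left a u) v :=
  (Bim.lin_left (Functor.LaxMonoidal.μ F X Y) a (Bim.tmul _ _ u v)).symm.trans
    (congrArg (Bim.lin (Functor.LaxMonoidal.μ F X Y)) (Bim.tensor_left_tmul _ _ a u v))

theorem right_laxMul (X Y : CoRep k H) (a : A) (u : F.obj X) (v : F.obj Y) :
    (F.obj (CoRep.tensor X Y)).right a (laxMul F X Y u v) = laxMul F X Y u ((F.obj Y).right a v) :=
  (Bim.lin_right (Functor.LaxMonoidal.μ F X Y) a (Bim.tmul _ _ u v)).symm.trans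
    (congrArg (Bim.lin (Functor.LaxMonoidal.μ F X Y)) (Bim.tensor_right_tmul _ _ a u v))

theorem laxMul_bal (X Y : CoRep k H) (a : A) (u : F.obj X) (v : F.obj Y) :
    laxMul F X Y ((F.obj X).right a u) v = laxMul F X Y u ((F.obj Y).left a v) :=
  congrArg (Bim.lin (Functor.LaxMonoidal.μ F X Y)) (Bim.tmul_bal _ _ a u v)

theorem map_laxMul_left {X X' : CoRep k H} (Y : CoRep k H) (f : X ⟶ X') (u : F.obj X)
    (v : F.obj Y) : Bim.lin (F.map (CoRep.tensorMap f (𝟙 Y))) (laxMul F X Y u v)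
      = laxMul F X' Y (Bim.lin (F.map f) u) v :=
  (congrArg (fun g => Bim.lin g (Bim.tmul _ _ u v))
    (Functor.LaxMonoidal.μ_natural_left F f Y)).symm.trans
    (congrArg (Bim.lin (Functor.LaxMonoidal.μ F X' Y)) (Bim.lin_tensorMap (F.map f) (𝟙 _) u v))

theorem map_laxMul_right (X : CoRep k H) {Y Y' : CoRep k H} (f : Y ⟶ Y') (u : F.obj X)
    (v : F.obj Y) : Bim.lin (F.map (CoRep.tensorMap (𝟙 X) f)) (laxMul F X Y u v)
      = laxMul F X Y' u (Bim.lin (F.map f) v) :=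
  (congrArg (fun g => Bim.lin g (Bim.tmul _ _ u v))
    (Functor.LaxMonoidal.μ_natural_right F X f)).symm.trans
    (congrArg (Bim.lin (Functor.LaxMonoidal.μ F X Y')) (Bim.lin_tensorMap (𝟙 _) (F.map f) u v))

theorem map_associator_laxMul (X Y Z : CoRep k H) (u : F.obj X) (v : F.obj Y) (w : F.obj Z) :
    Bim.lin (F.map (CoRep.associator X Y Z).hom)
      (laxMul F (CoRep.tensor X Y) Z (laxMul F X Y u v) w)
      = laxMul F X (CoRep.tensor Y Z) u (laxMul F Y Z v w) := by
  have h := congrArg (fun g => Bim.lin g (Bim.tmul _ _ (Bim.tmul _ _ u v) w))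
    (Functor.LaxMonoidal.associativity F X Y Z)
  have e1 := congrArg (fun t => Bim.lin (F.map (α_ X Y Z).hom)
      (Bim.lin (Functor.LaxMonoidal.μ F (X ⊗ Y) Z) t))
    (Bim.lin_tensorMap (Functor.LaxMonoidal.μ F X Y) (𝟙 (F.obj Z)) (Bim.tmul _ _ u v) w)
  have e2 := congrArg (fun t => Bim.lin (Functor.LaxMonoidal.μ F X (Y ⊗ Z))
      (Bim.lin (Bim.tensorMap (𝟙 (F.obj X)) (Functor.LaxMonoidal.μ F Y Z)) t))
    (Bim.lin_associator _ _ _ u v w)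
  have e3 := congrArg (Bim.lin (Functor.LaxMonoidal.μ F X (Y ⊗ Z)))
    (Bim.lin_tensorMap (𝟙 (F.obj X)) (Functor.LaxMonoidal.μ F Y Z) u (Bim.tmul _ _ v w))
  exact e1.symm.trans (h.trans (e2.trans e3))

theorem map_leftUnitor_laxMul (X : CoRep k H) (a : A) (u : F.obj X) :
    Bim.lin (F.map (CoRep.leftUnitor X).hom) (laxMul F (CoRep.unit k H) X (laxOne F a) u)
      = (F.obj X).left a u := by
  have h := congrArg (fun g => Bim.lin g (Bim.tmul (Bim.unit k A) (F.obj X) a u))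
    (Functor.LaxMonoidal.left_unitality F X)
  have e := congrArg (fun t => Bim.lin (F.map (λ_ X).hom)
    (Bim.lin (Functor.LaxMonoidal.μ F (𝟙_ _) X) t))
    (Bim.lin_tensorMap (Functor.LaxMonoidal.ε F) (𝟙 (F.obj X)) a u)
  exact e.symm.trans h.symm

theorem map_rightUnitor_laxMul (X : CoRep k H) (a : A) (u : F.obj X) :
    Bim.lin (F.map (CoRep.rightUnitor X).hom) (laxMul F X (CoRep.unit k H) u (laxOne F a))
      = (F.obj X).right a u := by
  have h := congrArg (fun g => Bim.lin g (Bim.tmul (F.obj X) (Bim.unit k A) u a))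
    (Functor.LaxMonoidal.right_unitality F X)
  have e := congrArg (fun t => Bim.lin (F.map (ρ_ X).hom)
    (Bim.lin (Functor.LaxMonoidal.μ F X (𝟙_ _)) t))
    (Bim.lin_tensorMap (𝟙 (F.obj X)) (Functor.LaxMonoidal.ε F) u a)
  exact e.symm.trans h.symm

theorem left_laxOne (a b : A) :
    (F.obj (CoRep.unit k H)).left a (laxOne F b) = laxOne F (a * b) :=
  (Bim.lin_left (M := Bim.unit k A) (Functor.LaxMonoidal.ε F) a b).symm

theorem right_laxOne (a b : A) :
    (F.obj (CoRep.unit k H)).right a (laxOne F b) = laxOne F (b * a) :=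
  (Bim.lin_right (M := Bim.unit k A) (Functor.LaxMonoidal.ε F) a b).symm

theorem lin_map_inv_hom {X Y : CoRep k H} (e : X ≅ Y) (u : F.obj X) :
    Bim.lin (F.map e.inv) (Bim.lin (F.map e.hom) u) = u := by
  rw [← Bim.lin_comp, ← F.map_comp, e.hom_inv_id, F.map_id, Bim.lin_id]

end Lax

section Strong

variable (F : CoRep k H ⥤ Bim k A) [F.Monoidal]

/-- The inverse `F(1) → A` of the unit map of a monoidal functor. -/
def unitInv : F.obj (CoRep.unit k H) →ₗ[k] A :=
  Bim.lin (M := F.obj (CoRep.unit k H)) (N := Bim.unit k A) (Functor.OplaxMonoidal.η F)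

theorem unitInv_laxOne (a : A) : unitInv F (laxOne F a) = a :=
  congrArg (fun g : Bim.unit k A ⟶ Bim.unit k A => Bim.lin g a) (Functor.Monoidal.ε_η (F := F))

theorem laxOne_unitInv (u : F.obj (CoRep.unit k H)) : laxOne F (unitInv F u) = u :=
  congrArg (fun g : F.obj (CoRep.unit k H) ⟶ F.obj (CoRep.unit k H) => Bim.lin g u)
    (Functor.Monoidal.η_ε (F := F))

theorem unitInv_left (a : A) (u : F.obj (CoRep.unit k H)) :
    unitInv F ((F.obj (CoRep.unit k H)).left a u) = a * unitInv F u :=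
  Bim.lin_left (N := Bim.unit k A) (Functor.OplaxMonoidal.η F) a u

end Strong

namespace Frame

variable {F : CoRep k H ⥤ Bim k A} [F.Monoidal] (J : Frame F)

theorem laxMul_lin (X Y : CoRep k H) (x : X) (y : Y) :
    laxMul F X Y (J.lin X x) (J.lin Y y) = J.lin (CoRep.tensor X Y) (CoRep.tmul X Y x y) :=
  J.mul X Y x y

theorem laxOne_one : laxOne F 1 = J.lin (CoRep.unit k H) (CoRep.unitOne k H) := J.one

/-- The map `H^t → A` induced by a frame. -/
def scalar : CoRep.unit k H →ₗ[k] A := unitInv F ∘ₗ J.lin (CoRep.unit k H)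

theorem laxOne_scalar (z : CoRep.unit k H) : laxOne F (J.scalar z) = J.lin (CoRep.unit k H) z :=
  laxOne_unitInv F _

theorem scalar_one : J.scalar (CoRep.unitOne k H) = 1 :=
  (congrArg (unitInv F) J.laxOne_one.symm).trans (unitInv_laxOne F 1)

/-- Left multiplication by an element of `A` is multiplication by its image in `F(1)` followed by
the left unitor; on elements of the frame, both operations take place in `coRep(H)`. -/
theorem left_scalar (X : CoRep k H) (z : CoRep.unit k H) (x : X) :
    (F.obj X).left (J.scalar z) (J.lin X x) = J.lin X (CoRep.leftB X z x) := by
  rw [← map_leftUnitor_laxMul, laxOne_scalar, laxMul_lin, J.map, CoRep.lin_leftUnitor]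

theorem right_scalar (X : CoRep k H) (z : CoRep.unit k H) (x : X) :
    (F.obj X).right (J.scalar z) (J.lin X x) = J.lin X (CoRep.rightB X x z) := by
  rw [← map_rightUnitor_laxMul, laxOne_scalar, laxMul_lin, J.map, CoRep.lin_rightUnitor]

theorem scalar_mul (z w : CoRep.unit k H) :
    J.scalar z * J.scalar w = J.scalar (CoRep.leftB (CoRep.unit k H) z w) := by
  rw [scalar, LinearMap.comp_apply, LinearMap.comp_apply, LinearMap.comp_apply, ← left_scalar, unitInv_left]
  rfl

theorem scalar_injective (h : Function.Injective (J.lin (CoRep.unit k H))) :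
    Function.Injective J.scalar := fun z w e =>
  h (by rw [← laxOne_scalar, e, laxOne_scalar])

/-- The coordinates of the elements of `F(X)` with respect to a frame. -/
def coord (X : CoRep k H) (j : Fin (Module.finrank k X)) : F.obj X →ₗ[k] A :=
  unitInv F ∘ₗ Bim.lin (F.map (CoRep.ev X)) ∘ₗ
    (laxMul F X X.dual).flip (J.lin X.dual (X.dualBasis j))

theorem coord_left (X : CoRep k H) (j) (a : A) (u : F.obj X) :
    J.coord X j ((F.obj X).left a u) = a * J.coord X j u := by
  simp only [coord, LinearMap.comp_apply, LinearMap.flip_apply]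
  rw [← left_laxMul, Bim.lin_left, unitInv_left]

theorem coord_lin (X : CoRep k H) (j) (x : X) :
    J.coord X j (J.lin X x) = J.scalar (X.evBilin x (X.dualBasis j)) := by
  simp only [coord, LinearMap.comp_apply, LinearMap.flip_apply]
  rw [laxMul_lin, J.map, CoRep.lin_ev]
  rfl

/-- This is `F` applied to the zigzag identity: tensor `u` with the unit, replace the unit by the
canonical element `∑ y_j ⊗ x_j`, and evaluate `u` against `y_j`. It requires no freeness, and it
shows that the frame generates `F(X)`. -/
theorem sum_coord (X : CoRep k H) (u : F.obj X) :
    ∑ j, (F.obj X).left (J.coord X j u) (J.lin X (X.basis j)) = u := by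
  have h1 : Bim.lin (F.map (CoRep.rightUnitor X).inv) u
      = laxMul F X (CoRep.unit k H) u (J.lin _ (CoRep.unitOne k H)) := by
    have h : Bim.lin (F.map (CoRep.rightUnitor X).hom)
        (laxMul F X (CoRep.unit k H) u (laxOne F 1)) = u :=
      (map_rightUnitor_laxMul F X 1 u).trans ((F.obj X).right_one u)
    rw [← J.laxOne_one, ← lin_map_inv_hom F (CoRep.rightUnitor X)
      (laxMul F X (CoRep.unit k H) u (laxOne F 1)), h]
  have h2 := congrArg (fun f => Bim.lin (F.map f) u) (CoRep.zigzag X)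
  simp only [F.map_comp, F.map_id, Bim.lin_comp, Bim.lin_id] at h2
  rw [h1, map_laxMul_right, J.map, CoRep.lin_coev_one, CoRep.coevOne, map_sum, map_sum, map_sum,
    map_sum, map_sum] at h2
  refine Eq.trans (Finset.sum_congr rfl fun j _ => ?_) h2
  rw [← J.laxMul_lin, ← map_associator_laxMul, lin_map_inv_hom, map_laxMul_left,
    ← map_leftUnitor_laxMul]
  simp only [coord, LinearMap.comp_apply, laxOne_unitInv, LinearMap.flip_apply]

theorem gen (X : CoRep k H) : Bim.Gen (J.lin X) := by
  apply Bim.Gen.of_forall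
  intro u
  rw [← J.sum_coord X u]
  exact Submodule.sum_mem _ fun j _ => Submodule.subset_span ⟨_, _, rfl⟩

/-- The left `A`-linear map on `F(X)` that extends a linear map on `X`. -/
def extend {X : CoRep k H} {N : Bim k A} (T : X →ₗ[k] N) : F.obj X →ₗ[k] N :=
  ∑ j, (N.left.flip (T (X.basis j))) ∘ₗ J.coord X j

theorem extend_apply {X : CoRep k H} {N : Bim k A} (T : X →ₗ[k] N) (u : F.obj X) :
    J.extend T u = ∑ j, N.left (J.coord X j u) (T (X.basis j)) := by
  simp [extend]

theorem extend_left {X : CoRep k H} {N : Bim k A} (T : X →ₗ[k] N) (a : A) (u : F.obj X) :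
    J.extend T ((F.obj X).left a u) = N.left a (J.extend T u) := by
  simp only [extend_apply, coord_left, N.left_mul, map_sum]

/-- The coordinates of `J(x)` are the scalars attached to `ev(x, y_j)`. By `H^t`-linearity they move
inside `T`, where `∑ ev(x, y_j)·x_j = x`. -/
theorem extend_lin {X : CoRep k H} {N : Bim k A} (T : X →ₗ[k] N)
    (hT : ∀ z x, T (CoRep.leftB X z x) = N.left (J.scalar z) (T x)) (x : X) :
    J.extend T (J.lin X x) = T x := by
  simp only [extend_apply, coord_lin, ← hT]
  rw [← map_sum, CoRep.sum_left_evBilin]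

end Frame

end FunctorCalculus

/-! ### The module algebra structure determined by a frame. -/

section Reconstruction

variable {k H A : Type u} [Field k] [Ring H] [Algebra k H] [Coalgebra k H] [WeakHopfAlgebra k H]
  [FiniteDimensional k H] [Ring A] [Algebra k A]

namespace CoRep

theorem regular_left {z : H} (hz : z ∈ target k H) (h : H) :
    (regular k H).left z h = z * h := slice_left_comul hz h

theorem regular_right {z : H} (hz : z ∈ target k H) (h : H) :
    (regular k H).right z h = h * z := slice_right_comul hz h

/-- The elements of `H` as elements of the regular comodule. -/
def toRegular (k H : Type u) [Field k] [Ring H] [Algebra k H] [Coalgebra k H]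
    [FiniteDimensional k H] : H →ₗ[k] regular k H := LinearMap.id

theorem regularMul_bal (z : target k H) (g h : H) :
    LinearMap.mul k H ((regular k H).rt z g) h = LinearMap.mul k H g ((regular k H).lt z h) :=
  (congrArg (· * h) (regular_right z.2 g)).trans ((mul_assoc g (z : H) h).trans
    (congrArg (g * ·) (regular_left z.2 h)).symm)

theorem mul_eq_lTensor_pair {W : Type u} [AddCommGroup W] [Module k W] {B : H →ₗ[k] H →ₗ[k] W}
    (f : W →ₗ[k] H) (hf : ∀ g h, f (B g h) = g * h) (s t : H ⊗[k] H) :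
    s * t = f.lTensor H (pair B s t) := by
  induction s with
  | zero => simp
  | add x y hx hy => simp only [map_add, LinearMap.add_apply, add_mul, hx, hy]
  | tmul g g' =>
    induction t with
    | zero => simp
    | add x y hx hy => simp only [map_add, mul_add, hx, hy]
    | tmul h h' => simp [hf]

/-- The multiplication of `H` as a homomorphism of comodules. -/
def regularMul (k H : Type u) [Field k] [Ring H] [Algebra k H] [Coalgebra k H]
    [WeakHopfAlgebra k H] [FiniteDimensional k H] :
    tensor (regular k H) (regular k H) ⟶ regular k H :=
  homOfTensor (X := regular k H) (Y := regular k H) (P := regular k H)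
    (BalTensor.lift (LinearMap.mul k H) regularMul_bal) fun g h =>
      (congrArg (Coalgebra.comul (R := k) (A := H))
        (BalTensor.lift_mk (LinearMap.mul k H) regularMul_bal g h)).trans
      ((WeakHopfAlgebra.comul_mul (k := k) (H := H) g h).trans
        (mul_eq_lTensor_pair (H := H) (W := tensor (regular k H) (regular k H))
          (B := tmul (regular k H) (regular k H)) _
          (BalTensor.lift_mk (LinearMap.mul k H) regularMul_bal) _ _))

theorem lin_regularMul (g h : H) : lin (regularMul k H)
    (tmul (regular k H) (regular k H) (toRegular k H g) (toRegular k H h))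
      = toRegular k H (g * h) :=
  BalTensor.lift_mk _ regularMul_bal g h

/-- The inclusion of `H^t` in `H` as a homomorphism of comodules. -/
def unitIncl (k H : Type u) [Field k] [Ring H] [Algebra k H] [Coalgebra k H]
    [WeakHopfAlgebra k H] [FiniteDimensional k H] : unit k H ⟶ regular k H :=
  ofLin (X := unit k H) (Y := regular k H) (target k H).subtype
    fun z => (lTensor_subtype_unitCoact z).symm

/-- The homomorphism `x ↦ x₍₋₁₎ f(x₍₀₎)` to the regular comodule. -/
def coeffHom (X : CoRep k H) (f : X →ₗ[k] k) : X ⟶ regular k H :=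
  ofLin (X := X) (Y := regular k H) (X.coeffLin f) (X.comul_coeffLin f)

theorem lin_coeffHom (X : CoRep k H) (f : X →ₗ[k] k) (x : X) :
    lin (X.coeffHom f) x = toRegular k H (X.coeffLin f x) := rfl

end CoRep

open CoRep

namespace Frame

variable {F : CoRep k H ⥤ Bim k A} [F.Monoidal] (J : Frame F)

/-- The frame on the regular comodule. -/
def reg : H →ₗ[k] F.obj (regular k H) := J.lin (regular k H) ∘ₗ toRegular k H

/-- The map `h ↦ ε_t(h) · 1`. -/
def regScalar : regular k H →ₗ[k] Bim.unit k A := J.scalar ∘ₗ toTarget k H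

/-- The map `a j(h) ↦ a (ε_t(h) · 1)` from `F(H)` to `A`. -/
def retract : F.obj (regular k H) →ₗ[k] A :=
  J.extend J.regScalar

theorem retract_left (a : A) (u : F.obj (regular k H)) :
    J.retract ((F.obj (regular k H)).left a u) = a * J.retract u :=
  J.extend_left (N := Bim.unit k A) _ a u

/-- Left `H^t`-linearity of `ε_t` is what ensures that `retract` takes the prescribed values on the
frame. -/
theorem regScalar_left (z : CoRep.unit k H) (h : regular k H) :
    J.regScalar (leftB (regular k H) z h) = (Bim.unit k A).left (J.scalar z) (J.regScalar h) := by
  have hz : (target k H).subtype z ∈ target k H := Subtype.prop (show target k H from z)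
  refine Eq.trans (congrArg J.scalar ?_) (J.scalar_mul z (toTarget k H h)).symm
  refine (target k H).injective_subtype ?_
  refine Eq.trans ?_ (unit_coe_left hz _).symm
  exact (congrArg (targetMap k (H := H)) (regular_left hz h)).trans (targetMap_target_mul (H := H) hz h)

theorem retract_reg (h : H) : J.retract (J.reg h) = J.scalar (toTarget k H h) :=
  J.extend_lin (N := Bim.unit k A) (X := regular k H) J.regScalar J.regScalar_left h

/-- The action of `H` on `A` determined by a frame. -/
def act : H →ₗ[k] A →ₗ[k] A := ((F.obj (regular k H)).right.flip ∘ₗ J.reg).compr₂ J.retract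

theorem act_apply (h : H) (a : A) :
    J.act h a = J.retract ((F.obj (regular k H)).right a (J.reg h)) := rfl

/-- The matrix coefficient maps carry `F(X)` into `F(H)`, where `retract` reads off coefficients. On
a generator `a J(x)` the formula reduces to `ε_t(x₍₋₁₎)·x₍₀₎ = x`. -/
theorem sum_retract_coeff (X : CoRep k H) (u : F.obj X) :
    ∑ i, (F.obj X).left (J.retract (Bim.lin (F.map (X.coeffHom (X.basis.coord i))) u))
      (J.lin X (X.basis i)) = u := by
  refine (J.gen X).ind (C := fun u => ∑ i, (F.obj X).left (J.retract (Bim.lin (F.map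
    (X.coeffHom (X.basis.coord i))) u)) (J.lin X (X.basis i)) = u) u ?_ ?_ ?_
  · simp
  · intro u v hu hv
    simp only [map_add, LinearMap.add_apply, Finset.sum_add_distrib]
    rw [hu, hv]
  · intro a x
    have h : ∀ i, (F.obj X).left (J.retract (Bim.lin (F.map (X.coeffHom (X.basis.coord i)))
        ((F.obj X).left a (J.lin X x)))) (J.lin X (X.basis i))
        = (F.obj X).left a (J.lin X (X.left (targetMap k (X.coeffLin (X.basis.coord i) x))
          (X.basis i))) := by
      intro i
      rw [Bim.lin_left, J.map, lin_coeffHom, retract_left, (F.obj X).left_mul]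
      refine congrArg _ ((congrArg (fun b => (F.obj X).left b _) (J.retract_reg _)).trans ?_)
      exact J.left_scalar X _ _
    rw [Finset.sum_congr rfl fun i _ => h i, ← map_sum, ← map_sum]
    have h2 := X.left_targetMap_coact x
    rw [coact_eq_sum, map_sum] at h2
    exact congrArg (fun y => (F.obj X).left a (J.lin X y)) h2

/-- Expand `J(x) a` by `sum_retract_coeff`. Each coefficient is the retraction of `J(c_i(x)) a` in
`F(H)`, which is the definition of `c_i(x)·a`. -/
theorem right_lin (X : CoRep k H) (a : A) (x : X) :
    (F.obj X).right a (J.lin X x)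
      = TensorProduct.lift (((F.obj X).left ∘ₗ J.act.flip a).compl₂ (J.lin X)) (X.coact x) := by
  rw [← J.sum_retract_coeff X ((F.obj X).right a (J.lin X x)), coact_eq_sum, map_sum]
  refine Finset.sum_congr rfl fun i _ => ?_
  rw [Bim.lin_right, J.map]
  rfl

theorem right_reg (a : A) (h : H) : (F.obj (regular k H)).right a (J.reg h)
    = TensorProduct.lift (((F.obj (regular k H)).left ∘ₗ J.act.flip a).compl₂ J.reg)
      (Coalgebra.comul (R := k) h) :=
  J.right_lin (regular k H) a (toRegular k H h)

theorem right_scalar_reg (z : target k H) (h : H) :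
    (F.obj (regular k H)).right (J.scalar z) (J.reg h) = J.reg (h * z) :=
  (J.right_scalar (regular k H) z (toRegular k H h)).trans
    (congrArg (J.lin (regular k H)) (regular_right z.2 h))

/-- The element `J(1)` of `F(H)` comes from `F(1) ≅ A` along `H^t → H`, so it commutes with `A`; its
retraction is `1`. -/
theorem one_act (a : A) : J.act 1 a = a := by
  have h1 : J.reg 1 = Bim.lin (F.map (unitIncl k H)) (laxOne F 1) := by
    rw [J.laxOne_one, J.map]
    rfl
  rw [act_apply, h1, ← Bim.lin_right, right_laxOne, one_mul, ← mul_one a, ← left_laxOne, mul_one,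
    Bim.lin_left, ← h1, retract_left, retract_reg]
  have h2 : toTarget k H 1 = ⟨1, one_mem_target⟩ := Subtype.ext targetMap_one
  rw [h2]
  exact (congrArg (a * ·) J.scalar_one).trans (mul_one a)

theorem act_one (h : H) : J.act h 1 = J.scalar (toTarget k H h) := by
  rw [act_apply, (F.obj _).right_one, retract_reg]

theorem act_one_targetMap (h : H) : J.act h 1 = J.act (targetMap k h) 1 := by
  rw [act_one, act_one]
  exact congrArg J.scalar (Subtype.ext (targetMap_idem h).symm)

theorem scalar_eq_act (z : target k H) : J.scalar z = J.act z 1 := by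
  rw [act_one]
  exact congrArg J.scalar (Subtype.ext (targetMap_of_mem z.2).symm)

/-- Move `a` and then `b` past `J(h)`: the commutation rule takes care of `a`, and the retraction of
what remains is the action on `b`. -/
theorem act_mul (h : H) (a b : A) : J.act h (a * b) = LinearMap.mul' k A
    (TensorProduct.map (J.act.flip a) (J.act.flip b) (Coalgebra.comul (R := k) h)) := by
  rw [act_apply, (F.obj _).right_mul, right_reg]
  generalize Coalgebra.comul (R := k) h = t
  induction t with
  | zero => simp
  | add x y hx hy => simp only [map_add, hx, hy]
  | tmul g h =>
    simp only [TensorProduct.lift.tmul, LinearMap.compl₂_apply, LinearMap.comp_apply,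
      TensorProduct.map_tmul, LinearMap.mul'_apply, LinearMap.flip_apply]
    rw [← (F.obj _).left_right, retract_left]
    rfl

theorem reg_mul (g h : H) : J.reg (g * h) = Bim.lin (F.map (regularMul k H))
    (laxMul F (regular k H) (regular k H) (J.reg g) (J.reg h)) := by
  have e := J.laxMul_lin (regular k H) (regular k H) (toRegular k H g) (toRegular k H h)
  refine Eq.trans ?_ (congrArg (Bim.lin (F.map (regularMul k H))) e.symm)
  rw [J.map, lin_regularMul]
  rfl

/-- As `J(gh)` is the image of `J(g) ⊗ J(h)` under the multiplication of `H`, `a` passes `J(h)`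
first, crosses the tensor sign over `A`, then passes `J(g)`. This leaves `g₍₁₎·(h₍₁₎·a)` times the
scalar of `ε_t(g₍₂₎ h₍₂₎)`. -/
theorem mul_act (g h : H) (a : A) : J.act (g * h) a = J.act g (J.act h a) := by
  rw [act_apply, reg_mul, ← Bim.lin_right, right_laxMul, act_apply, act_apply, right_reg J a h]
  generalize Coalgebra.comul (R := k) h = t
  induction t with
  | zero => simp
  | add x y hx hy => simp only [map_add, LinearMap.add_apply, hx, hy]
  | tmul h h' =>
    simp only [TensorProduct.lift.tmul, LinearMap.compl₂_apply, LinearMap.comp_apply,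
      LinearMap.flip_apply]
    rw [← laxMul_bal, retract_left, retract_reg, (F.obj _).right_mul, right_reg]
    generalize Coalgebra.comul (R := k) g = s
    induction s with
    | zero => simp
    | add x y hx hy => simp only [map_add, LinearMap.add_apply, hx, hy]
    | tmul g g' =>
      simp only [TensorProduct.lift.tmul, LinearMap.compl₂_apply, LinearMap.comp_apply,
        LinearMap.flip_apply]
      rw [← left_laxMul, Bim.lin_left, retract_left, ← (F.obj _).left_right, retract_left]
      rw [← reg_mul, right_scalar_reg, retract_reg, retract_reg]
      -- Computing `g·(h·a)` directly produces `ε_t(g₍₂₎ ε_t(h₍₂₎))` instead; the two agree by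
      -- `targetMap_mul_targetMap`.
      exact congrArg (fun w => _ * J.scalar w) (Subtype.ext (targetMap_mul_targetMap g' h').symm)

/-- The module algebra structure determined by a frame. -/
def moduleAlgebra : ModuleAlgebra k H A where
  act := J.act
  one_act := J.one_act
  mul_act := J.mul_act
  act_mul := J.act_mul
  act_one := J.act_one_targetMap

theorem targetInjective_moduleAlgebra (h : Function.Injective (J.lin (CoRep.unit k H))) :
    J.moduleAlgebra.TargetInjective := by
  intro z hz w hw e
  have e' : J.scalar (⟨z, hz⟩ : target k H) = J.scalar (⟨w, hw⟩ : target k H) := by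
    rw [scalar_eq_act, scalar_eq_act]
    exact e
  exact congrArg Subtype.val (J.scalar_injective h e')

theorem lin_left (X : CoRep k H) {z : H} (hz : z ∈ target k H) (x : X) :
    J.lin X (X.left z x) = (F.obj X).left (J.moduleAlgebra.act z 1) (J.lin X x) := by
  have h := J.left_scalar X (⟨z, hz⟩ : target k H) x
  rw [scalar_eq_act] at h
  exact h.symm

/-- The map `a ⊗ x ↦ a J(x)` is a bimodule map by `right_lin`. Extending `x ↦ 1 ⊗ x` by coordinates
gives a left linear map the other way, and the two are inverse on generators. -/
theorem realizes_moduleAlgebra : J.moduleAlgebra.Realizes J := by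
  intro X
  let f : J.moduleAlgebra.indBim X ⟶ F.obj X := J.moduleAlgebra.indLift (J.lin X)
    (fun z hz => J.lin_left X hz) (J.right_lin X)
  have hf : ∀ a x, Bim.lin f (J.moduleAlgebra.bmul X a x) = (F.obj X).left a (J.lin X x) :=
    J.moduleAlgebra.lin_indLift (J.lin X) (fun z hz => J.lin_left X hz) (J.right_lin X)
  let g := J.extend (J.moduleAlgebra.bmul X 1)
  have hg : ∀ x, g (J.lin X x) = J.moduleAlgebra.bmul X 1 x := J.extend_lin _ fun z x => by
    have e := J.scalar_eq_act z
    refine ((J.moduleAlgebra.bmul_bal X (Subtype.prop (show target k H from z)) 1 x).symm.trans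
      ?_).trans (congrArg (fun a => (J.moduleAlgebra.indBim X).left a _) e.symm)
    rw [ModuleAlgebra.left_bmul, mul_one, one_mul]
    rfl
  refine ⟨Bim.isoOfLin (LinearEquiv.ofLinearMap (Bim.lin f) g ?_ ?_) (Bim.lin_left f)
    (Bim.lin_right f), fun x => (hf 1 x).trans ((F.obj X).left_one _)⟩
  · refine LinearMap.ext fun u => (J.gen X).ind (C := fun u => Bim.lin f (g u) = u) u (by simp)
      (fun u v hu hv => by rw [map_add, map_add, hu, hv]) fun a x => ?_
    rw [J.extend_left, hg, ModuleAlgebra.left_bmul_one, hf]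
  · refine J.moduleAlgebra.ind_ext fun a x => ?_
    refine (congrArg g (hf a x)).trans ((J.extend_left _ a _).trans ?_)
    exact (congrArg _ (hg x)).trans (J.moduleAlgebra.left_bmul_one X a x)

end Frame

end Reconstruction

/-! ### Change of frame and the classification. -/

section Classification

variable {k H A : Type u} [Field k] [Ring H] [Algebra k H] [Coalgebra k H] [WeakHopfAlgebra k H]
  [FiniteDimensional k H] [Ring A] [Algebra k A]

open CoRep

theorem ModuleAlgebra.act_injective :
    Function.Injective (ModuleAlgebra.act : ModuleAlgebra k H A → H →ₗ[k] A →ₗ[k] A) := by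
  rintro ⟨⟩ ⟨⟩ rfl
  rfl

theorem Frame.retract_reg_eq_act {F : CoRep k H ⥤ Bim k A} [F.Monoidal] (J : Frame F) (h : H) :
    J.retract (J.reg h) = J.act h 1 := by
  rw [J.act_apply, (F.obj _).right_one]

/-- The module algebra structure determined by a frame is the only one that satisfies the
commutation relation on the regular comodule. -/
theorem Frame.eq_moduleAlgebra {F : CoRep k H ⥤ Bim k A} [F.Monoidal] (J : Frame F)
    (M : ModuleAlgebra k H A) (h : ∀ (a : A) (g : H), (F.obj (regular k H)).right a (J.reg g)
      = TensorProduct.lift (((F.obj (regular k H)).left ∘ₗ M.act.flip a).compl₂ J.reg)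
        (Coalgebra.comul (R := k) g)) : M = J.moduleAlgebra := by
  -- Commuting the unit of `A` past `J(z)`, with `Δ(z) = (z ⊗ 1)Δ(1)`, gives `J(z) = (z·1) J(1)`;
  -- its retraction identifies the two scalars.
  have h1 : ∀ z ∈ target k H, J.act z 1 = M.act z 1 := by
    intro z hz
    have e : J.reg z = (F.obj (regular k H)).left (M.act z 1) (J.reg 1) := by
      rw [← (F.obj (regular k H)).right_one (J.reg z), h, comul_target hz,
        ← (F.obj (regular k H)).right_one (J.reg 1), h]
      generalize Coalgebra.comul (R := k) (1 : H) = t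
      induction t with
      | zero => simp
      | add x y hx hy => simp only [map_add, mul_add, hx, hy]
      | tmul g g' => simp [M.mul_act, M.act_target hz (M.act g 1), (F.obj _).left_mul]
    rw [← J.retract_reg_eq_act, e, J.retract_left, J.retract_reg_eq_act, J.one_act, mul_one]
  have h2 : J.act.flip 1 = M.act.flip 1 := LinearMap.ext fun g => by
    rw [LinearMap.flip_apply, LinearMap.flip_apply, J.act_one_targetMap, h1 _ (targetMap_mem g),
      ← M.act_one]
  -- With both actions equal on `1`, retracting `J(g) a = ∑ (g₍₁₎·a) J(g₍₂₎)` gives `∑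
  -- (g₍₁₎·a)(g₍₂₎·1)`, which is `g·(a·1)` by the module algebra axiom.
  have h3 : M.act = J.act := LinearMap.ext₂ fun g a => by
    rw [J.act_apply, h, ← mul_one a, M.act_mul, mul_one, ← h2]
    generalize Coalgebra.comul (R := k) g = t
    induction t with
    | zero => simp
    | add x y hx hy => simp only [map_add, hx, hy]
    | tmul g g' =>
      simp [J.retract_left, J.retract_reg_eq_act]
  exact ModuleAlgebra.act_injective h3

namespace ModuleAlgebra

variable {M N : ModuleAlgebra k H A}

theorem Realizes.right_lin {F : CoRep k H ⥤ Bim k A} [F.LaxMonoidal] {J : Frame F}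
    (hM : M.Realizes J) (X : CoRep k H) (a : A) (x : X) : (F.obj X).right a (J.lin X x)
      = TensorProduct.lift (((F.obj X).left ∘ₗ M.act.flip a).compl₂ (J.lin X)) (X.coact x) := by
  obtain ⟨e, he⟩ := hM X
  rw [← he, ← Bim.lin_right, right_bmul_one]
  generalize X.coact x = t
  induction t with
  | zero => simp
  | add x y hx hy => rw [map_add _ x y, map_add _ x y, map_add, hx, hy]
  | tmul h x =>
    simp only [TensorProduct.lift.tmul, LinearMap.compl₂_apply, LinearMap.comp_apply, Bim.lin_left,
      he]

/-- The relation of a twisted isomorphism in `A ⊗_{H^t} H` is a commutation relation between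
frames. -/
theorem Realizes.halfBraid_eq_iff {F : CoRep k H ⥤ Bim k A} [F.Monoidal] {J K : Frame F}
    (hN : N.Realizes K) (α : H →ₗ[k] H) (hα : ∀ g, K.reg (α g) = J.reg g) (a : A) (h : H) :
    N.halfBraid (regular k H) a (α h) = TensorProduct.lift
        ((N.tmul (regular k H)).compl₁₂ (M.act.flip a) α) (Coalgebra.comul (R := k) h)
      ↔ (F.obj (regular k H)).right a (J.reg h)
        = TensorProduct.lift (((F.obj (regular k H)).left ∘ₗ M.act.flip a).compl₂ J.reg)
          (Coalgebra.comul (R := k) h) := by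
  obtain ⟨e, he⟩ := hN (regular k H)
  have hinj : Function.Injective (Bim.lin e.hom) := fun u v huv => by
    have := congrArg (Bim.lin e.inv) huv
    rwa [← Bim.lin_comp, ← Bim.lin_comp, e.hom_inv_id, Bim.lin_id, Bim.lin_id] at this
  have e1 : N.halfBraid (regular k H) a (α h) = (N.indBim (regular k H)).right a
      (N.bmul (regular k H) 1 (toRegular k H (α h))) :=
    ((N.right_bmul (regular k H) 1 a _).trans ((N.indBim (regular k H)).left_one _)).symm
  -- The isomorphism realising `N` is right linear, so it carries the half braiding at `α(h)` to the
  -- right action on `K(α(h)) = J(h)`.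
  have e2 : Bim.lin e.hom (N.halfBraid (regular k H) a (α h))
      = (F.obj (regular k H)).right a (J.reg h) := by
    refine (congrArg (Bim.lin e.hom) e1).trans ?_
    rw [Bim.lin_right, he, ← hα]
    rfl
  have e3 : ∀ t : H ⊗[k] H, Bim.lin e.hom (TensorProduct.lift
      ((N.tmul (regular k H)).compl₁₂ (M.act.flip a) α) t)
      = TensorProduct.lift (((F.obj (regular k H)).left ∘ₗ M.act.flip a).compl₂ J.reg) t := by
    intro t
    induction t with
    | zero => rw [map_zero, map_zero]; exact map_zero _
    | add x y hx hy => rw [map_add _ x y, map_add _ x y, ← hx, ← hy]; exact map_add _ _ _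
    | tmul g g' =>
      refine (congrArg (Bim.lin e.hom)
        (N.left_bmul_one (regular k H) (M.act g a) (toRegular k H (α g')))).symm.trans ?_
      rw [Bim.lin_left, he]
      exact congrArg _ (hα g')
  rw [← e2, ← e3]
  exact ⟨fun e => congrArg _ e, fun e => hinj e⟩

end ModuleAlgebra

/-- A frame transported along a monoidal transformation. -/
def Frame.comp {F G : CoRep k H ⥤ Bim k A} [F.LaxMonoidal] [G.LaxMonoidal] (J : Frame F)
    (e : F ⟶ G) [he : NatTrans.IsMonoidal e] : Frame G where
  lin X := Bim.lin (e.app X) ∘ₗ J.lin X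
  map {X Y} f x := by
    rw [LinearMap.comp_apply, LinearMap.comp_apply, ← J.map, ← Bim.lin_comp, ← Bim.lin_comp,
      e.naturality]
  mul X Y x y := by
    have h := congrArg (fun g => Bim.lin g (Bim.tmul _ _ (J.lin X x) (J.lin Y y))) (he.tensor X Y)
    refine Eq.trans ?_ (h.symm.trans (congrArg (Bim.lin (e.app (X ⊗ Y))) (J.mul X Y x y)))
    exact (congrArg (Bim.lin (Functor.LaxMonoidal.μ G X Y))
      (Bim.lin_tensorMap (e.app X) (e.app Y) (J.lin X x) (J.lin Y y))).symm
  one := by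
    have h := congrArg (fun g => Bim.lin (M := Bim.unit k A) g (1 : A)) he.unit
    exact h.symm.trans (congrArg (Bim.lin (e.app (𝟙_ (CoRep k H)))) J.one)

/-! ### Monoidal endomorphisms of the weak fiber functor. -/

section WeakFiber

variable (η : weakFiber k H ⟶ weakFiber k H)

/-- The components of a transformation of the weak fiber functor. -/
def component (X : CoRep k H) : X →ₗ[k] X := (η.app X).hom

theorem component_natural {X Y : CoRep k H} (f : X ⟶ Y) (x : X) :
    component η Y (CoRep.lin f x) = CoRep.lin f (component η X x) :=
  LinearMap.congr_fun (congrArg ModuleCat.Hom.hom (η.naturality f)) x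

theorem component_tmul [hη : NatTrans.IsMonoidal η] (X Y : CoRep k H) (x : X) (y : Y) :
    component η (tensor X Y) (tmul X Y x y) = tmul X Y (component η X x) (component η Y y) :=
  LinearMap.congr_fun (congrArg ModuleCat.Hom.hom (hη.tensor X Y)) (x ⊗ₜ[k] y)

theorem component_one [hη : NatTrans.IsMonoidal η] :
    component η (CoRep.unit k H) (unitOne k H) = unitOne k H := by
  have h := LinearMap.congr_fun (congrArg ModuleCat.Hom.hom hη.unit) (1 : k)
  refine Eq.trans ?_ (h.trans (one_smul k (unitOne k H)))
  exact congrArg (component η (CoRep.unit k H)) (one_smul k (unitOne k H)).symm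

/-- The algebra automorphism of `H` given by a monoidal automorphism of the weak fiber functor. -/
def componentEquiv (η : weakFiber k H ≅ weakFiber k H) (hη : NatTrans.IsMonoidal η.hom) :
    H ≃ₐ[k] H :=
  AlgEquiv.ofLinearEquiv
    (show H ≃ₗ[k] H from (η.app (regular k H)).toLinearEquiv)
    -- The unit is preserved by naturality along `H^t → H`; products are preserved by naturality
    -- along the multiplication of `H`, which is a comodule map.
    ((component_natural η.hom (unitIncl k H) (unitOne k H)).trans
      (congrArg (CoRep.lin (unitIncl k H)) (component_one η.hom)))
    (fun g h => by
      have e := component_natural η.hom (regularMul k H)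
        (tmul (regular k H) (regular k H) (toRegular k H g) (toRegular k H h))
      rw [component_tmul, lin_regularMul] at e
      exact e.trans (lin_regularMul _ _))

theorem isJTwisted_componentEquiv (η : weakFiber k H ≅ weakFiber k H)
    (hη : NatTrans.IsMonoidal η.hom) : IsJTwisted k H (componentEquiv η hη) :=
  ⟨η, hη, rfl⟩

end WeakFiber

namespace ModuleAlgebra

variable {M N : ModuleAlgebra k H A} {B C : BasedAction k H A}

/-- The two trivialisations of the same induced functor differ by a monoidal automorphism of `F_H`.
Its component at `H` is the required `α`, and the twisted relation is the commutation rule of `M` in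
its own frame. -/
theorem JTwisted.of_induces (hM : M.Induces B) (hN : N.Induces B) : M.JTwisted N := by
  obtain ⟨J, hJ, hM⟩ := (M.induces_iff B).1 hM
  obtain ⟨K, hK, hN⟩ := (N.induces_iff B).1 hN
  obtain ⟨θ, hθ, rfl⟩ := B.exists_iso_frame hJ
  obtain ⟨τ, hτ, rfl⟩ := B.exists_iso_frame hK
  have hη : NatTrans.IsMonoidal (θ ≪≫ τ.symm).hom :=
    inferInstanceAs (NatTrans.IsMonoidal (θ.hom ≫ τ.inv))
  refine ⟨componentEquiv (θ ≪≫ τ.symm) hη, isJTwisted_componentEquiv _ hη, fun h a => ?_⟩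
  refine (hN.halfBraid_eq_iff (componentEquiv (θ ≪≫ τ.symm) hη).toLinearMap
    (J := B.frame θ.hom hθ) (fun g => ?_) a h).2 (hM.right_lin (regular k H) a (toRegular k H h))
  exact congrArg Subtype.val (LinearMap.congr_fun
    (congrArg ModuleCat.Hom.hom (τ.inv_hom_id_app (regular k H)))
    ((θ.hom.app (regular k H)).hom (toRegular k H g)))

/-- Precompose the frame realising `N` with the automorphism of `F_H` behind `α`. In the new frame
`M` satisfies the commutation rule on the regular comodule, so it is the structure determined by
that frame and realises it on every comodule. -/
theorem Induces.of_jTwisted (hMN : M.JTwisted N) (hN : N.Induces B) : M.Induces B := by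
  obtain ⟨α, ⟨η, hη, hα⟩, h⟩ := hMN
  obtain ⟨K, hK, hN⟩ := (N.induces_iff B).1 hN
  obtain ⟨τ, hτ, rfl⟩ := B.exists_iso_frame hK
  have hη' : NatTrans.IsMonoidal (η ≪≫ τ).hom :=
    inferInstanceAs (NatTrans.IsMonoidal (η.hom ≫ τ.hom))
  refine (M.induces_iff B).2 ⟨B.frame _ hη', B.isBase_frame (η ≪≫ τ) hη', ?_⟩
  have key : M = (B.frame _ hη').moduleAlgebra := by
    apply Frame.eq_moduleAlgebra
    intro a g
    refine (hN.halfBraid_eq_iff α.toLinearMap (fun g => ?_) a g).1 (h g a)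
    exact congrArg (fun f => ((τ.hom.app (regular k H)).hom (f.hom g)).1) hα.symm
  rw [key]
  exact (B.frame _ hη').realizes_moduleAlgebra

theorem Induces.of_equivalent (hB : M.Induces B) (hBC : B.Equivalent C) : M.Induces C := by
  obtain ⟨J, hJ, hM⟩ := (M.induces_iff B).1 hB
  obtain ⟨e, he, h⟩ := hBC
  refine (M.induces_iff C).2 ⟨J.comp e.hom, ⟨fun X => ?_, fun X => ?_⟩, fun X => ?_⟩
  · refine Function.Injective.comp (g := Bim.lin (e.hom.app X)) (fun u v huv => ?_) (hJ.injective X)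
    have := congrArg (Bim.lin (e.inv.app X)) huv
    rwa [← Bim.lin_comp, ← Bim.lin_comp, e.hom_inv_id_app, Bim.lin_id, Bim.lin_id] at this
  · rw [← h X, ← hJ.range_eq X]
    exact LinearMap.range_comp _ _
  · obtain ⟨f, hf⟩ := hM X
    exact ⟨f ≪≫ e.app X, fun x => congrArg (Bim.lin (e.hom.app X)) (hf x)⟩

/-- Both functors are identified with `A ⊗_{H^t} X`, and the resulting isomorphisms match the two
frames. Frames generate, so naturality, monoidality and the equality of base spaces can all be read
off on them. -/
theorem Induces.equivalent (hB : M.Induces B) (hC : M.Induces C) : B.Equivalent C := by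
  obtain ⟨J, hJ, hB⟩ := (M.induces_iff B).1 hB
  obtain ⟨K, hK, hC⟩ := (M.induces_iff C).1 hC
  choose e he using hB
  choose f hf using hC
  have hef : ∀ X x, Bim.lin ((e X).symm ≪≫ f X).hom (J.lin X x) = K.lin X x := fun X x => by
    rw [← he, ← hf, ← Bim.lin_comp]
    simp
  refine ⟨NatIso.ofComponents (fun X => (e X).symm ≪≫ f X) fun {X Y} g =>
    (J.gen X).hom_ext fun x => ?_, ⟨?_, fun X Y => ?_⟩, fun X => ?_⟩
  · rw [Bim.lin_comp, Bim.lin_comp, J.map, hef, hef, K.map]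
  · refine Bim.Gen.unit.hom_ext fun _ => ?_
    refine (congrArg (Bim.lin ((e (𝟙_ _)).symm ≪≫ f (𝟙_ _)).hom) J.one).trans ?_
    exact (hef _ _).trans K.one.symm
  · refine ((J.gen X).tensor (J.gen Y)).hom_ext fun ⟨x, y⟩ => ?_
    refine (congrArg (Bim.lin ((e (X ⊗ Y)).symm ≪≫ f (X ⊗ Y)).hom) (J.mul X Y x y)).trans ?_
    refine (hef _ _).trans ((K.mul X Y x y).symm.trans ?_)
    refine congrArg (Bim.lin (Functor.LaxMonoidal.μ C.functor X Y)) ?_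
    refine Eq.trans ?_ (Bim.lin_tensorMap _ _ _ _).symm
    exact congrArg₂ (fun u v => Bim.tmul _ _ u v) (hef X x).symm (hef Y y).symm
  · rw [← hJ.range_eq X, ← hK.range_eq X, ← LinearMap.range_comp]
    exact congrArg LinearMap.range (LinearMap.ext (hef X))

theorem exists_induces (hB : B.IsOver (weakFiber k H)) :
    ∃ M : ModuleAlgebra k H A, M.TargetInjective ∧ M.Induces B := by
  obtain ⟨θ, hθ⟩ := hB
  have h := B.isBase_frame θ hθ
  exact ⟨_, (B.frame _ hθ).targetInjective_moduleAlgebra (h.injective _),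
    (induces_iff _ B).2 ⟨_, h, (B.frame _ hθ).realizes_moduleAlgebra⟩⟩

/-- The structure `N` induces its own action, so agreement up to twist with `N` means inducing that
same action. The equivalence relation then follows from symmetry in `JTwisted.of_induces` and
transport by `Induces.of_jTwisted`. -/
theorem jTwisted_iff (hN : N.TargetInjective) : M.JTwisted N ↔ M.Induces N.indAction :=
  ⟨fun h => .of_jTwisted h (N.induces_indAction hN), fun h => .of_induces h
    (N.induces_indAction hN)⟩

theorem jTwisted_equivalence : Equivalence
    (fun M N : {M : ModuleAlgebra k H A // M.TargetInjective} => M.1.JTwisted N.1) where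
  refl M := (jTwisted_iff M.2).2 (M.1.induces_indAction M.2)
  symm {_ N} h := .of_induces (N.1.induces_indAction N.2) ((jTwisted_iff N.2).1 h)
  trans {_ _ P} h h' := .of_induces (.of_jTwisted h ((jTwisted_iff P.2).1 h'))
    (P.1.induces_indAction P.2)

variable (k H A) in
/-- The map from classes of module algebra structures to classes of based actions. -/
def toAction : Quot (fun M N : {M : ModuleAlgebra k H A // M.TargetInjective} => M.1.JTwisted N.1) →
    Quotient (BasedAction.overSetoid k H A) :=
  Quot.lift (fun M => Quotient.mk _ ⟨M.1.indAction, isOver_of_induces (M.1.induces_indAction M.2)⟩)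
    fun M N h => Quotient.sound
      (Induces.equivalent (M.1.induces_indAction M.2) ((jTwisted_iff N.2).1 h))

theorem toAction_eq_iff (M : {M : ModuleAlgebra k H A // M.TargetInjective})
    (B : {B : BasedAction k H A // B.IsOver (weakFiber k H)}) :
    toAction k H A (Quot.mk _ M) = Quotient.mk _ B ↔ M.1.Induces B.1 :=
  ⟨fun h => (M.1.induces_indAction M.2).of_equivalent (Quotient.exact h),
    fun h => Quotient.sound ((M.1.induces_indAction M.2).equivalent h)⟩

/-- If two structures induce equivalent actions, then both induce the same one, which gives
injectivity; surjectivity is reconstruction from a frame. -/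
theorem toAction_bijective : Function.Bijective (toAction k H A) := by
  refine ⟨?_, ?_⟩
  · rintro ⟨M⟩ ⟨N⟩ h
    exact Quot.sound (.of_induces ((toAction_eq_iff M _).1 h) (N.1.induces_indAction N.2))
  · rintro ⟨B⟩
    obtain ⟨M, hM, h⟩ := exists_induces B.2
    exact ⟨Quot.mk _ ⟨M, hM⟩, (toAction_eq_iff ⟨M, hM⟩ B).2 h⟩

end ModuleAlgebra

end Classification

end WeakHopf

end

theorem mainTheorem1 (k H A : Type u) [Field k] [Ring H] [Algebra k H] [Coalgebra k H]
    [WeakHopf.WeakHopfAlgebra k H] [FiniteDimensional k H] [IsSemisimpleRing H]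
    [Ring A] [Algebra k A] :
    Equivalence (fun M N : {M : WeakHopf.ModuleAlgebra k H A // M.TargetInjective} =>
      M.1.JTwisted N.1) ∧
    ∃ Φ : Quot (fun M N : {M : WeakHopf.ModuleAlgebra k H A // M.TargetInjective} =>
        M.1.JTwisted N.1) ≃ Quotient (WeakHopf.BasedAction.overSetoid k H A),
      ∀ (M : {M : WeakHopf.ModuleAlgebra k H A // M.TargetInjective})
        (B : {B : WeakHopf.BasedAction k H A // B.IsOver (WeakHopf.weakFiber k H)}),
        Φ (Quot.mk _ M) = Quotient.mk _ B ↔ M.1.Induces B.1 :=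
  ⟨WeakHopf.ModuleAlgebra.jTwisted_equivalence,
    Equiv.ofBijective _ WeakHopf.ModuleAlgebra.toAction_bijective,
    WeakHopf.ModuleAlgebra.toAction_eq_iff⟩
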